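/- Let $M$ be a closed (compact, without boundary), connected smooth 3-manifold, let $\alpha$ be a smooth contact form on $M$ (a 1-form with $\alpha\wedge d\alpha$ nowhere zero; $M$ is oriented by $\alpha\wedge d\alpha$), and let $X=X_\alpha$ be its Reeb vector field, determined by $\alpha(X)=1$ and $d\alpha(X,\cdot)=0$. A smooth Riemannian metric $g$ on $M$ is a \emph{contact metric} adapted to $\alpha$ if there is a $(1,1)$-tensor $\phi$ with $$g(X,\cdot)=\alpha,\qquad g(\cdot,\phi\,\cdot)=\tfrac12\,d\alpha(\cdot,\cdot),\qquad \phi^2=-I+\alpha\otimes X .$$ For such $g$, let $\|\mathcal{L}_Xg\|\ge 0$ be the pointwise norm of its torsion $\mathcal{L}_Xg$, normalised by $\|\mathcal{L}_Xg\|^2=\tfrac12\sum_{i,j}(\mathcal{L}_Xg)(e_i,e_j)^2$ for a $g$-orthonormal basis $(e_i)$ (the \emph{scalar torsion}), and let $$\mathcal{E}(g)=\frac12\int_M\|\mathcal{L}_Xg\|^2\,d\mathrm{Vol}(g)$$ be the Dirichlet energy. Call a contact metric $g$ \emph{critical} if it is a critical point of $\mathcal{E}$ on the space of contact metrics adapted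 to $\alpha$, i.e. $\frac{d}{dt}\big|_{t=0}\mathcal{E}(g_t)=0$ for every smooth family $(g_t)_{t\in\mathbb{R}}$ of contact metrics adapted to $\alpha$ with $g_0=g$. \textbf{Theorem.} If $g$ is a critical contact metric adapted to $\alpha$, then the scalar torsion $\lambda=\|\mathcal{L}_Xg\|$ is a constant function on $M$. -/

import Mathlib

open Set MeasureTheory Bundle
open scoped Manifold ContDiff Topology

/-! # Contact metrics on 3-manifolds and the Dirichlet energy -/

/-- The model space `ℝ³`. -/
abbrev E3 : Type := EuclideanSpace ℝ (Fin 3)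

namespace ContactThree

noncomputable section

/-! ### Tensors in charts

Mathlib defines the tangent space `T_pM` as the model space `E3`, read in the preferred chart at `p`;
the derivative at `p` of `extChartAt (𝓡 3) p` is the identity (`mfderiv_extChartAt_self`).  Therefore
the usual coordinate formulas for `dα` and `L_X g`, evaluated at `p` in the preferred chart at `p`,
give tensors on `T_pM`. -/

section Coordinates

variable {M : Type*} [TopologicalSpace M] [ChartedSpace E3 M]

/-- The coordinate frame of the preferred chart at `x`: the derivative at the coordinate point `y` of
the inverse chart. -/
def coordFrame (x : M) (y : E3) :
    E3 →L[ℝ] TangentSpace (𝓡 3) ((extChartAt (𝓡 3) x).symm y) :=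
  mfderiv 𝓘(ℝ, E3) (𝓡 3) (extChartAt (𝓡 3) x).symm y

/-- A 1-form in the coordinates of the preferred chart at `x`. -/
def oneFormInChart (α : ∀ p : M, TangentSpace (𝓡 3) p →L[ℝ] ℝ) (x : M) (y : E3) : E3 →L[ℝ] ℝ :=
  (α ((extChartAt (𝓡 3) x).symm y)).comp (coordFrame x y)

/-- A vector field in the coordinates of the preferred chart at `x`. -/
def vectorFieldInChart (X : ∀ p : M, TangentSpace (𝓡 3) p) (x : M) : E3 → E3 :=
  VectorField.mpullback 𝓘(ℝ, E3) (𝓡 3) (extChartAt (𝓡 3) x).symm X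

/-- A bilinear form on the tangent bundle in the coordinates of the preferred chart at `x`. -/
def bilinInChart (b : ∀ p : M, TangentSpace (𝓡 3) p →L[ℝ] TangentSpace (𝓡 3) p →L[ℝ] ℝ)
    (x : M) (y : E3) : E3 →L[ℝ] E3 →L[ℝ] ℝ :=
  let B : E3 →L[ℝ] E3 →L[ℝ] ℝ := b ((extChartAt (𝓡 3) x).symm y)
  let D : E3 →L[ℝ] E3 := coordFrame x y
  B.bilinearComp D D

/-- The exterior derivative of a 1-form, `dα(u, v) = ∂ᵤ(α(v)) - ∂ᵥ(α(u))` for coordinate vectors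
(so `dα(U, V) = U α(V) - V α(U) - α([U, V])` for vector fields). -/
def extDerivOneForm (α : ∀ p : M, TangentSpace (𝓡 3) p →L[ℝ] ℝ) (p : M) :
    TangentSpace (𝓡 3) p →L[ℝ] TangentSpace (𝓡 3) p →L[ℝ] ℝ :=
  let A : E3 →L[ℝ] E3 →L[ℝ] ℝ := fderiv ℝ (oneFormInChart α p) (extChartAt (𝓡 3) p p)
  A - A.flip

/-- The Lie derivative `L_X b` of a bilinear form along a vector field; in coordinates,
`(L_X b)(u, v) = (∂_X b)(u, v) + b(∂ᵤX, v) + b(u, ∂ᵥX)`. -/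
def lieDerivBilin (X : ∀ p : M, TangentSpace (𝓡 3) p)
    (b : ∀ p : M, TangentSpace (𝓡 3) p →L[ℝ] TangentSpace (𝓡 3) p →L[ℝ] ℝ) (p : M) :
    TangentSpace (𝓡 3) p →L[ℝ] TangentSpace (𝓡 3) p →L[ℝ] ℝ :=
  let y : E3 := extChartAt (𝓡 3) p p
  let DX : E3 →L[ℝ] E3 := fderiv ℝ (vectorFieldInChart X p) y
  let B : E3 →L[ℝ] E3 →L[ℝ] ℝ := bilinInChart b p y
  fderiv ℝ (bilinInChart b p) y (vectorFieldInChart X p y)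
    + B.bilinearComp DX (ContinuousLinearMap.id ℝ E3)
    + B.bilinearComp (ContinuousLinearMap.id ℝ E3) DX

/-- The value `(α ∧ dα)(u, v, w)`. -/
def wedgeExtDeriv (α : ∀ p : M, TangentSpace (𝓡 3) p →L[ℝ] ℝ) (p : M)
    (u v w : TangentSpace (𝓡 3) p) : ℝ :=
  α p u * extDerivOneForm α p v w + α p v * extDerivOneForm α p w u
    + α p w * extDerivOneForm α p u v

end Coordinates

/-! ### Contact forms -/

/-- A smooth contact form on a 3-manifold: a smooth 1-form with `α ∧ dα` nowhere zero.
It is positive for the orientation of `M` that `α ∧ dα` defines. -/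
structure ContactForm (M : Type*) [TopologicalSpace M] [ChartedSpace E3 M]
    [IsManifold (𝓡 3) ∞ M] where
  /-- The underlying 1-form. -/
  form : ∀ p : M, TangentSpace (𝓡 3) p →L[ℝ] ℝ
  smooth : ContMDiff (𝓡 3) ((𝓡 3).prod 𝓘(ℝ, E3 →L[ℝ] ℝ)) ∞
    (fun p : M => (TotalSpace.mk' (E3 →L[ℝ] ℝ) p (form p) :
      TotalSpace (E3 →L[ℝ] ℝ) (fun p : M => TangentSpace (𝓡 3) p →L[ℝ] Bundle.Trivial M ℝ p)))
  nondegenerate : ∀ p : M, ∃ u v w : TangentSpace (𝓡 3) p, wedgeExtDeriv form p u v w ≠ 0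

section Reeb

/-- The linear algebra behind the Reeb field: if `a ∧ W ≠ 0` on a 3-dimensional space, then there is
exactly one vector `X` with `a X = 1` and `W(X, ·) = 0`, where `W = A - Aᵗ`. -/
theorem existsUnique_reeb_vector (a : E3 →L[ℝ] ℝ) (A : E3 →L[ℝ] E3 →L[ℝ] ℝ)
    (h : ∃ u v w : E3, a u * (A - A.flip) v w + a v * (A - A.flip) w u
      + a w * (A - A.flip) u v ≠ 0) :
    ∃! X : E3, a X = 1 ∧ ∀ v, (A - A.flip) X v = 0 := by
  obtain ⟨u, v, w, h⟩ := h
  set W : E3 →L[ℝ] E3 →L[ℝ] ℝ := A - A.flip with hW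
  have anti : ∀ x y, W x y = -W y x := by intro x y; simp [hW]
  have self : ∀ x, W x x = 0 := fun x => by have := anti x x; linarith
  have key : ∀ x y z : ℝ, a (x • u + y • v + z • w) = 0 →
      (∀ q, W (x • u + y • v + z • w) q = 0) → x = 0 ∧ y = 0 ∧ z = 0 := by
    intro x y z h0 h1
    have hu := h1 u
    have hv := h1 v
    have hw := h1 w
    simp only [map_add, map_smul, add_apply, smul_apply,
      smul_eq_mul, self] at h0 hu hv hw
    rw [anti v u] at hu
    rw [anti w v] at hv
    rw [anti u w] at hw
    refine ⟨?_, ?_, ?_⟩ <;> refine (mul_eq_zero.mp ?_).resolve_right h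
    · linear_combination W v w * h0 + a v * (-hw) + a w * hv
    · linear_combination W w u * h0 + a w * (-hu) + a u * hw
    · linear_combination W u v * h0 + a u * (-hv) + a v * hu
  have li : LinearIndependent ℝ ![u, v, w] := by
    rw [Fintype.linearIndependent_iff]
    intro c hc
    simp only [Fin.sum_univ_three, Matrix.cons_val_zero, Matrix.cons_val_one,
      Matrix.cons_val] at hc
    obtain ⟨h0, h1, h2⟩ := key (c 0) (c 1) (c 2) (by rw [hc]; simp) (by rw [hc]; simp)
    intro i
    fin_cases i
    · exact h0
    · exact h1
    · exact h2
  have spn : ∀ q : E3, ∃ x y z : ℝ, q = x • u + y • v + z • w := by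
    intro q
    let b := basisOfLinearIndependentOfCardEqFinrank li (by simp)
    refine ⟨b.repr q 0, b.repr q 1, b.repr q 2, ?_⟩
    have := b.sum_repr q
    simp only [Fin.sum_univ_three, b, coe_basisOfLinearIndependentOfCardEqFinrank,
      Matrix.cons_val_zero, Matrix.cons_val_one, Matrix.cons_val] at this
    exact this.symm
  set N := a u * W v w + a v * W w u + a w * W u v with hN
  refine ⟨N⁻¹ • (W v w • u + W w u • v + W u v • w), ⟨?_, ?_⟩, ?_⟩
  · simp only [map_add, map_smul, smul_eq_mul]
    field_simp
    rw [hN]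
    ring
  · intro q
    obtain ⟨x, y, z, rfl⟩ := spn q
    simp only [map_add, map_smul, add_apply, smul_apply,
      smul_eq_mul, self]
    rw [anti v u, anti w v, anti u w]
    ring
  · rintro Y ⟨hY1, hY2⟩
    obtain ⟨x, y, z, hd⟩ := spn (Y - N⁻¹ • (W v w • u + W w u • v + W u v • w))
    have h0 : a (x • u + y • v + z • w) = 0 := by
      rw [← hd]
      simp only [map_sub, map_add, map_smul, smul_eq_mul, hY1]
      field_simp
      rw [hN]
      ring
    have h1 : ∀ q, W (x • u + y • v + z • w) q = 0 := by
      intro q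
      rw [← hd]
      obtain ⟨x, y, z, rfl⟩ := spn q
      simp only [map_sub, sub_apply, hY2]
      simp only [map_add, map_smul, add_apply, smul_apply,
        smul_eq_mul, self]
      rw [anti v u, anti w v, anti u w]
      ring
    obtain ⟨rfl, rfl, rfl⟩ := key x y z h0 h1
    simpa [sub_eq_zero] using hd

variable {M : Type*} [TopologicalSpace M] [ChartedSpace E3 M] [IsManifold (𝓡 3) ∞ M]

theorem ContactForm.existsUnique_reeb (α : ContactForm M) (p : M) :
    ∃! X : TangentSpace (𝓡 3) p,
      α.form p X = 1 ∧ ∀ v, extDerivOneForm α.form p X v = 0 :=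
  existsUnique_reeb_vector (α.form p) _ (α.nondegenerate p)

/-- The Reeb vector field `X_α` of a contact form: the unique vector field with `α(X_α) = 1` and
`dα(X_α, ·) = 0`. -/
def ContactForm.reeb (α : ContactForm M) (p : M) : TangentSpace (𝓡 3) p :=
  (α.existsUnique_reeb p).choose

end Reeb

/-! ### Riemannian metrics -/

/-- Smooth Riemannian metrics on `M`. -/
abbrev Metric (M : Type*) [TopologicalSpace M] [ChartedSpace E3 M] [IsManifold (𝓡 3) ∞ M] :
    Type _ :=
  ContMDiffRiemannianMetric (𝓡 3) ∞ E3 (fun p : M => TangentSpace (𝓡 3) p)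

variable {M : Type*} [TopologicalSpace M] [ChartedSpace E3 M] [IsManifold (𝓡 3) ∞ M]

/-- The matrix of a bilinear form in the standard basis of `ℝ³`. -/
def bilinMatrix (b : E3 →L[ℝ] E3 →L[ℝ] ℝ) : Matrix (Fin 3) (Fin 3) ℝ :=
  Matrix.of fun i j => b (EuclideanSpace.single i 1) (EuclideanSpace.single j 1)

/-- The Riemannian volume on the domain of the preferred chart at `x` (extended by zero to `M`): in
coordinates, `√det(g_ij)` times Lebesgue measure. -/
def chartVolume [MeasurableSpace M] (g : Metric M) (x : M) : Measure M :=
  Measure.map (extChartAt (𝓡 3) x).symm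
    ((volume.restrict (extChartAt (𝓡 3) x).target).withDensity fun y =>
      ENNReal.ofReal (Real.sqrt (bilinMatrix (bilinInChart g.inner x y)).det))

/-- The Riemannian volume measure `dVol(g)`.  The measures `chartVolume g x` are the restrictions of
the Riemannian volume to the chart domains; since these cover `M`, the Riemannian volume is their
least upper bound in the lattice of measures. -/
def riemannianVolume [MeasurableSpace M] (g : Metric M) : Measure M :=
  ⨆ x : M, chartVolume g x

/-- `g` is a contact metric adapted to `α`: for some field `φ` of endomorphisms of `TM`,
`g(X_α, ·) = α`, `g(u, φ v) = dα(u, v) / 2` and `φ² = -Id + α ⊗ X_α`.  The second equation determines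
`φ` and makes it smooth. -/
def IsContactMetric (α : ContactForm M) (g : Metric M) : Prop :=
  ∃ φ : ∀ p : M, TangentSpace (𝓡 3) p →L[ℝ] TangentSpace (𝓡 3) p, ∀ p : M,
    (∀ v, g.inner p (α.reeb p) v = α.form p v) ∧
    (∀ u v, g.inner p u (φ p v) = (1 / 2) * extDerivOneForm α.form p u v) ∧
    (∀ v, φ p (φ p v) = -v + α.form p v • α.reeb p)

/-- The torsion `τ = L_{X_α} g`. -/
def torsion (α : ContactForm M) (g : Metric M) (p : M) :
    TangentSpace (𝓡 3) p →L[ℝ] TangentSpace (𝓡 3) p →L[ℝ] ℝ :=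
  lieDerivBilin α.reeb g.inner p

/-- The squared scalar torsion `‖τ‖²` at `p`.  The norm on symmetric 2-tensors is normalised by
`‖τ‖² = ½ Tr((g⁻¹τ)²)`, that is, half the sum of the squares of the entries of `τ` in an orthonormal
basis.  For a contact metric, `τ` has eigenvalues `0, ‖τ‖, -‖τ‖` with respect to `g`. -/
def torsionNormSq (α : ContactForm M) (g : Metric M) (p : M) : ℝ :=
  let G := bilinMatrix (g.inner p)
  let T := bilinMatrix (torsion α g p)
  (1 / 2) * (G⁻¹ * T * (G⁻¹ * T)).trace

/-- The scalar torsion `‖τ‖ = ‖L_{X_α} g‖`, a function on `M`. -/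
def scalarTorsion (α : ContactForm M) (g : Metric M) (p : M) : ℝ :=
  Real.sqrt (torsionNormSq α g p)

/-- The Dirichlet energy `ℰ(g) = ½ ∫_M ‖τ‖² dVol(g)`. -/
def dirichletEnergy [MeasurableSpace M] (α : ContactForm M) (g : Metric M) : ℝ :=
  (1 / 2) * ∫ p, scalarTorsion α g p ^ 2 ∂(riemannianVolume g)

/-- A family of Riemannian metrics that depends smoothly on `(t, p) ∈ ℝ × M`. -/
def IsSmoothFamily (γ : ℝ → Metric M) : Prop :=
  ContMDiff ((𝓘(ℝ, ℝ)).prod (𝓡 3)) ((𝓡 3).prod 𝓘(ℝ, E3 →L[ℝ] E3 →L[ℝ] ℝ)) ∞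
    (fun q : ℝ × M => (TotalSpace.mk' (E3 →L[ℝ] E3 →L[ℝ] ℝ) q.2 ((γ q.1).inner q.2) :
      TotalSpace (E3 →L[ℝ] E3 →L[ℝ] ℝ)
        (fun p : M => TangentSpace (𝓡 3) p →L[ℝ] TangentSpace (𝓡 3) p →L[ℝ] ℝ)))

/-- `g` is a critical contact metric for `α`: a contact metric that is a critical point of the
Dirichlet energy on the space of contact metrics adapted to `α`, that is, the first variation of the
energy vanishes along every smooth family of contact metrics adapted to `α` that starts at `g`. -/
def IsCriticalContactMetric [MeasurableSpace M] (α : ContactForm M) (g : Metric M) : Prop :=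
  IsContactMetric α g ∧
    ∀ γ : ℝ → Metric M, (∀ t, IsContactMetric α (γ t)) → IsSmoothFamily γ → γ 0 = g →
      HasDerivAt (fun t => dirichletEnergy α (γ t)) 0 0

end

end ContactThree

/-! Write `τ = L_X g` and `f = ‖τ‖²`. The proof derives the Euler–Lagrange equation of the energy
and then applies a maximum principle along the Reeb field to `|df|²`.

Pointwise algebra. Relative to an adapted frame (the Reeb vector, a horizontal unit vector `e`, and
`φ e`) of one contact metric, the contact metrics for the same `α` are the positive symmetric 2×2
blocks of determinant one on the contact plane. Their tangent directions, the admissible forms, are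
the trace-free symmetric blocks. Two such blocks anticommute up to a multiple of the identity, so `b
g⁻¹ b` is a multiple of `g - α ⊗ α` (`Admissible.mul_inv_mul_self`). The flow of `X` preserves `α`
and `dα`, so `τ` is itself admissible (`admissible_torsion`), and `τ g⁻¹ τ = f (g - α ⊗ α)`.

First variation. All contact metrics for `α` have the same volume (`Adapted.det_eq`), and `X`
preserves it. Along a deformation with velocity `b`, the derivative of `f` is `⟨τ, L_X b⟩`.
Integration by parts along `X` turns its integral into `-∫ ⟨E, b⟩` with `E = L_X L_X g - f (g - α ⊗
α)`, which is again admissible. Testing with `b = ψ E` for a bump function `ψ` gives `E = 0`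
(`eulerLagrange_eq_zero`).

Maximum principle. If `E = 0`, then `X f = 0`, hence `L_X df = 0`, and differentiating the inverse
metric twice gives `X X |df|² = f |df|²` (`reeb_reeb_gradSq`). At a maximum of `|df|²` on the
compact manifold the left side is nonpositive, so `f |df|² = 0` there. If `f` vanishes at that
point, the point is a minimum of `f ≥ 0` and `df` vanishes as well. Thus `df = 0` everywhere, and
`f` is constant because `M` is connected.

The analysis takes place on open subsets of `ℝ³` with matrix-valued functions
(`LocalContactMetric`). Naturality of `d` and `L_X` under coordinate changes carries it to `M`, and
`modifiedMetric` glues compactly supported deformations into `M`. -/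

namespace ContactThree

noncomputable section

set_option synthInstance.maxHeartbeats 400000

open Matrix

/-! ### Smoothness of tensor fields read in a chart -/

section TensorBundles

variable {M : Type*} [TopologicalSpace M] [ChartedSpace E3 M] [IsManifold (𝓡 3) ∞ M]

/-- The bundle of bilinear forms on the tangent spaces is smooth. -/
instance contMDiffVectorBundle_bilin : ContMDiffVectorBundle ∞ (E3 →L[ℝ] E3 →L[ℝ] ℝ)
    (fun p : M => TangentSpace (𝓡 3) p →L[ℝ] TangentSpace (𝓡 3) p →L[ℝ] ℝ) (𝓡 3) := by
  have h1 : ContMDiffVectorBundle ∞ E3 (fun p : M => TangentSpace (𝓡 3) p) (𝓡 3) := inferInstance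
  have h2 : ContMDiffVectorBundle ∞ ℝ (Bundle.Trivial M ℝ) (𝓡 3) := inferInstance
  have h3 : ContMDiffVectorBundle ∞ (E3 →L[ℝ] ℝ)
      (fun p : M => TangentSpace (𝓡 3) p →L[ℝ] Bundle.Trivial M ℝ p) (𝓡 3) := inferInstance
  exact ContMDiffVectorBundle.continuousLinearMap (IB := 𝓡 3) (n := ∞)
    (E₁ := fun p : M => TangentSpace (𝓡 3) p)
    (E₂ := fun p : M => TangentSpace (𝓡 3) p →L[ℝ] Bundle.Trivial M ℝ p)

/-- Smoothness of sections is phrased with trivializations, the coordinate formulas with the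
derivative of the inverse chart. This identification lets the two be exchanged. -/
theorem coordFrame_eq_symmL (x : M) {p : M} (hp : p ∈ (chartAt E3 x).source) :
    (coordFrame x (extChartAt (𝓡 3) x p) : E3 →L[ℝ] E3) =
      (trivializationAt E3 (TangentSpace (𝓡 3)) x).symmL ℝ p := by
  have h := TangentBundle.symmL_trivializationAt (I := 𝓡 3) (x₀ := x) hp
  rw [coordFrame, ← mfderivWithin_univ, ← ModelWithCorners.range_eq_univ (𝓡 3)]
  exact h.symm

theorem trivialization_symm_eq_coordFrame (x : M) {p : M} (hp : p ∈ (chartAt E3 x).source)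
    (u : E3) : (trivializationAt E3 (TangentSpace (𝓡 3)) x).symm p u =
      (coordFrame x (extChartAt (𝓡 3) x p) : E3 →L[ℝ] E3) u := by
  rw [coordFrame_eq_symmL x hp]
  exact (Trivialization.symmL_apply (R := ℝ) (trivializationAt E3 (TangentSpace (𝓡 3)) x) hp u).symm

theorem trivialization_bilin
    (b : ∀ p : M, TangentSpace (𝓡 3) p →L[ℝ] TangentSpace (𝓡 3) p →L[ℝ] ℝ) (x : M) {p : M}
    (hp : p ∈ (chartAt E3 x).source) :
    (trivializationAt (E3 →L[ℝ] E3 →L[ℝ] ℝ)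
      (fun p : M => TangentSpace (𝓡 3) p →L[ℝ] TangentSpace (𝓡 3) p →L[ℝ] ℝ) x
      (TotalSpace.mk' (E3 →L[ℝ] E3 →L[ℝ] ℝ) p (b p))).2 =
        bilinInChart b x (extChartAt (𝓡 3) x p) := by
  rw [hom_trivializationAt_apply]
  ext u v
  dsimp only
  have := inCoordinates_apply_eq₂ (𝕜 := ℝ) (F₁ := E3) (F₂ := E3) (F₃ := ℝ)
    (E₁ := fun p : M => TangentSpace (𝓡 3) p) (E₂ := fun p : M => TangentSpace (𝓡 3) p)
    (E₃ := Bundle.Trivial M ℝ) (x₀ := x) (x := p) (ϕ := b p) (v := u) (w := v) hp hp (mem_univ _)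
  have hl (r : ℝ) : (trivializationAt ℝ (Bundle.Trivial M ℝ) x).linearMapAt ℝ p r = r := by
    rw [Trivialization.linearMapAt_apply]
    exact if_pos (mem_univ p)
  refine this.trans ((hl _).trans ?_)
  have h : (extChartAt (𝓡 3) x).symm (extChartAt (𝓡 3) x p) = p :=
    (extChartAt (𝓡 3) x).left_inv (by simpa using hp)
  -- All tangent spaces are `E3` by definition. Forgetting the dependent type allows the base point
  -- to be rewritten.
  let b' : M → (E3 →L[ℝ] E3 →L[ℝ] ℝ) := b
  have hb : b' p = b' ((extChartAt (𝓡 3) x).symm (extChartAt (𝓡 3) x p)) := by rw [h]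
  rw [trivialization_symm_eq_coordFrame x hp u, trivialization_symm_eq_coordFrame x hp v]
  change b' p _ _ = _
  rw [hb]
  rfl

/-- The smoothness of a family of bilinear forms can be checked in a chart. -/
theorem contMDiffAt_bilin_iff
    (γ : ℝ → ∀ p : M, TangentSpace (𝓡 3) p →L[ℝ] TangentSpace (𝓡 3) p →L[ℝ] ℝ) (x : M) {p : M}
    (hp : p ∈ (chartAt E3 x).source) (t : ℝ) :
    ContMDiffAt ((𝓘(ℝ, ℝ)).prod (𝓡 3)) ((𝓡 3).prod 𝓘(ℝ, E3 →L[ℝ] E3 →L[ℝ] ℝ)) ∞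
      (fun q : ℝ × M => (TotalSpace.mk' (E3 →L[ℝ] E3 →L[ℝ] ℝ) q.2 (γ q.1 q.2) :
        TotalSpace (E3 →L[ℝ] E3 →L[ℝ] ℝ)
          (fun p : M => TangentSpace (𝓡 3) p →L[ℝ] TangentSpace (𝓡 3) p →L[ℝ] ℝ))) (t, p) ↔
    ContDiffAt ℝ ∞ (fun r : ℝ × E3 => bilinInChart (γ r.1) x r.2) (t, extChartAt (𝓡 3) x p) := by
  set e := trivializationAt (E3 →L[ℝ] E3 →L[ℝ] ℝ)
    (fun p : M => TangentSpace (𝓡 3) p →L[ℝ] TangentSpace (𝓡 3) p →L[ℝ] ℝ) x with he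
  have hps : p ∈ (extChartAt (𝓡 3) x).source := by simpa using hp
  have hpt := (extChartAt (𝓡 3) x).map_source hps
  rw [e.contMDiffAt_iff (by rw [he, hom_trivializationAt_source]; exact ⟨hp, hp, mem_univ _⟩)]
  have h1 : ContMDiffAt ((𝓘(ℝ, ℝ)).prod (𝓡 3)) (𝓡 3) ∞ (fun q : ℝ × M => q.2) (t, p) :=
    contMDiffAt_snd
  have hev : ∀ᶠ q : ℝ × M in 𝓝 (t, p), q.2 ∈ (chartAt E3 x).source :=
    continuousAt_snd.eventually ((chartAt E3 x).open_source.mem_nhds hp)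
  have h2 : (fun q : ℝ × M => (e (TotalSpace.mk' (E3 →L[ℝ] E3 →L[ℝ] ℝ) q.2 (γ q.1 q.2))).2)
      =ᶠ[𝓝 (t, p)] fun q => bilinInChart (γ q.1) x (extChartAt (𝓡 3) x q.2) := by
    filter_upwards [hev] with q hq
    exact trivialization_bilin (γ q.1) x hq
  rw [h2.contMDiffAt_iff]
  simp only [h1, true_and]
  have hsm : ContMDiffAt 𝓘(ℝ, E3) (𝓡 3) ∞ (extChartAt (𝓡 3) x).symm (extChartAt (𝓡 3) x p) :=
    (contMDiffOn_extChartAt_symm (n := ∞) x).contMDiffAt (extChartAt_target_mem_nhds' hpt)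
  have hcm : ContMDiffAt (𝓡 3) 𝓘(ℝ, E3) ∞ (extChartAt (𝓡 3) x) p := contMDiffAt_extChartAt' hp
  constructor
  · intro h
    rw [← contMDiffAt_iff_contDiffAt, modelWithCornersSelf_prod, ← chartedSpaceSelf_prod]
    have hk : ContMDiffAt (𝓘(ℝ, ℝ).prod 𝓘(ℝ, E3)) (𝓘(ℝ, ℝ).prod (𝓡 3)) ∞
        (fun r : ℝ × E3 => (r.1, (extChartAt (𝓡 3) x).symm r.2)) (t, extChartAt (𝓡 3) x p) :=
      contMDiffAt_fst.prodMk (ContMDiffAt.comp (t, extChartAt (𝓡 3) x p) hsm contMDiffAt_snd)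
    have h3 := ContMDiffAt.comp (t, extChartAt (𝓡 3) x p)
      (g := fun q : ℝ × M => bilinInChart (γ q.1) x (extChartAt (𝓡 3) x q.2))
      (by rw [(extChartAt (𝓡 3) x).left_inv hps]; exact h) hk
    refine h3.congr_of_eventuallyEq ?_
    have : ∀ᶠ r : ℝ × E3 in 𝓝 (t, extChartAt (𝓡 3) x p), r.2 ∈ (extChartAt (𝓡 3) x).target :=
      continuousAt_snd.eventually (extChartAt_target_mem_nhds' hpt)
    filter_upwards [this] with r hr
    simp only [Function.comp, (extChartAt (𝓡 3) x).right_inv hr]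
  · intro h
    exact ContMDiffAt.comp (t, p) (f := fun q : ℝ × M => (q.1, extChartAt (𝓡 3) x q.2))
      h.contMDiffAt (contMDiffAt_fst.prodMk_space (ContMDiffAt.comp (t, p) hcm contMDiffAt_snd))

theorem trivialization_oneForm (a : ∀ p : M, TangentSpace (𝓡 3) p →L[ℝ] ℝ) (x : M) {p : M}
    (hp : p ∈ (chartAt E3 x).source) :
    (trivializationAt (E3 →L[ℝ] ℝ)
      (fun p : M => TangentSpace (𝓡 3) p →L[ℝ] Bundle.Trivial M ℝ p) x
      (TotalSpace.mk' (E3 →L[ℝ] ℝ) p (a p))).2 = oneFormInChart a x (extChartAt (𝓡 3) x p) := by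
  rw [hom_trivializationAt_apply]
  ext u
  dsimp only
  rw [ContinuousLinearMap.inCoordinates_eq hp (mem_univ _)]
  have h : (extChartAt (𝓡 3) x).symm (extChartAt (𝓡 3) x p) = p :=
    (extChartAt (𝓡 3) x).left_inv (by simpa using hp)
  let a' : M → (E3 →L[ℝ] ℝ) := a
  have hb : a' p = a' ((extChartAt (𝓡 3) x).symm (extChartAt (𝓡 3) x p)) := by rw [h]
  change a' p ((trivializationAt E3 (TangentSpace (𝓡 3)) x).symm p u) = _
  rw [trivialization_symm_eq_coordFrame x hp u, hb]
  rfl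

theorem contDiffAt_oneFormInChart {a : ∀ p : M, TangentSpace (𝓡 3) p →L[ℝ] ℝ}
    (ha : ContMDiff (𝓡 3) ((𝓡 3).prod 𝓘(ℝ, E3 →L[ℝ] ℝ)) ∞
      (fun p : M => (TotalSpace.mk' (E3 →L[ℝ] ℝ) p (a p) : TotalSpace (E3 →L[ℝ] ℝ)
        (fun p : M => TangentSpace (𝓡 3) p →L[ℝ] Bundle.Trivial M ℝ p))))
    (x : M) {y : E3} (hy : y ∈ (extChartAt (𝓡 3) x).target) :
    ContDiffAt ℝ ∞ (oneFormInChart a x) y := by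
  set e := trivializationAt (E3 →L[ℝ] ℝ)
    (fun p : M => TangentSpace (𝓡 3) p →L[ℝ] Bundle.Trivial M ℝ p) x with he
  have hs {z : E3} (hz : z ∈ (extChartAt (𝓡 3) x).target) :
      (extChartAt (𝓡 3) x).symm z ∈ (chartAt E3 x).source := by
    have := (extChartAt (𝓡 3) x).map_target hz
    rwa [extChartAt_source] at this
  have h := ha ((extChartAt (𝓡 3) x).symm y)
  rw [e.contMDiffAt_iff (by rw [he, hom_trivializationAt_source]; exact ⟨hs hy, mem_univ _⟩)] at h
  have hsm : ContMDiffAt 𝓘(ℝ, E3) (𝓡 3) ∞ (extChartAt (𝓡 3) x).symm y :=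
    (contMDiffOn_extChartAt_symm (n := ∞) x).contMDiffAt (extChartAt_target_mem_nhds' hy)
  have h3 := ContMDiffAt.comp y h.2 hsm
  rw [← contMDiffAt_iff_contDiffAt]
  refine h3.congr_of_eventuallyEq ?_
  filter_upwards [extChartAt_target_mem_nhds' hy] with z hz
  have := trivialization_oneForm a x (hs hz)
  rw [(extChartAt (𝓡 3) x).right_inv hz] at this
  exact this.symm

end TensorBundles

/-! ### Contact metrics on one tangent space: adapted frames and admissible forms -/

/-- Real `3 × 3` matrices. -/
abbrev Mat3 : Type := Matrix (Fin 3) (Fin 3) ℝ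

/-- The matrix form of the contact metric condition: `G` is the metric, `W` is `dα` and `a` is `α`. -/
structure Adapted (G W : Mat3) (a : Fin 3 → ℝ) : Prop where
  symm : Gᵀ = G
  pos : ∀ v : Fin 3 → ℝ, v ≠ 0 → 0 < v ⬝ᵥ G *ᵥ v
  skew : Wᵀ = -W
  ker : W *ᵥ (G⁻¹ *ᵥ a) = 0
  norm : a ⬝ᵥ (G⁻¹ *ᵥ a) = 1
  compat : W * G⁻¹ * W = -(4 : ℝ) • (G - vecMulVec a a)

/-- The symmetric bilinear forms tangent to the space of contact metrics. -/
structure Admissible (G W : Mat3) (a : Fin 3 → ℝ) (b : Mat3) : Prop where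
  symm : bᵀ = b
  ker : b *ᵥ (G⁻¹ *ᵥ a) = 0
  anti : W * G⁻¹ * b * G⁻¹ * W = (4 : ℝ) • b

/-- The model of `dα / 2`. -/
def modelJ : Mat3 := !![0, 0, 0; 0, 0, -1; 0, 1, 0]

/-- The model of `α ⊗ α`. -/
def modelE : Mat3 := !![1, 0, 0; 0, 0, 0; 0, 0, 0]

/-- The model of an admissible form. -/
def modelM (p q : ℝ) : Mat3 := !![0, 0, 0; 0, p, q; 0, q, -p]

/-- An adapted orthonormal frame, the columns of `P`, with dual frame the rows of `Q`. -/
structure AdaptedFrame (P Q G W : Mat3) (a : Fin 3 → ℝ) : Prop where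
  mul_PQ : P * Q = 1
  mul_QP : Q * P = 1
  metric : G = Qᵀ * Q
  form : W = (2 : ℝ) • (Qᵀ * modelJ * Q)
  covec : a = Qᵀ *ᵥ ![1, 0, 0]

theorem vecMulVec_modelE : vecMulVec ![1, 0, 0] ![1, 0, 0] = modelE := by
  ext i j; fin_cases i <;> fin_cases j <;> simp [modelE, vecMulVec_apply]

theorem transpose_mulVec_dotProduct (A : Mat3) (u v : Fin 3 → ℝ) :
    u ⬝ᵥ A *ᵥ v = (Aᵀ *ᵥ u) ⬝ᵥ v := by
  rw [dotProduct_mulVec, mulVec_transpose]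

/-- Supplies the horizontal vector from which an adapted frame is built. -/
theorem exists_orthogonal_ne_zero (a : Fin 3 → ℝ) : ∃ v : Fin 3 → ℝ, v ≠ 0 ∧ a ⬝ᵥ v = 0 := by
  by_cases h : a 0 = 0
  · refine ⟨![1, 0, 0], fun h' => by simpa using congrFun h' 0, ?_⟩
    simp [dotProduct, Fin.sum_univ_three, h]
  · refine ⟨![a 1, -a 0, 0], fun h' => h (by simpa using congrFun h' 1), ?_⟩
    simp [dotProduct, Fin.sum_univ_three]
    ring

theorem isUnit_det_of_pos {G : Mat3} (pos : ∀ v : Fin 3 → ℝ, v ≠ 0 → 0 < v ⬝ᵥ G *ᵥ v) :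
    IsUnit G.det := by
  rw [isUnit_iff_ne_zero]
  intro h
  obtain ⟨v, hv, hv'⟩ := exists_mulVec_eq_zero_iff.mpr h
  have := pos v hv
  simp [hv'] at this

namespace Adapted

variable {G W : Mat3} {a : Fin 3 → ℝ}

theorem isUnit_det (h : Adapted G W a) : IsUnit G.det := isUnit_det_of_pos h.pos

theorem mul_inv (h : Adapted G W a) : G * G⁻¹ = 1 := mul_nonsing_inv _ h.isUnit_det
theorem inv_mul (h : Adapted G W a) : G⁻¹ * G = 1 := nonsing_inv_mul _ h.isUnit_det
theorem inv_symm (h : Adapted G W a) : (G⁻¹)ᵀ = G⁻¹ := by rw [transpose_nonsing_inv, h.symm]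

/-- The frame is `X, e, φ e` with `e` a horizontal unit vector. It reduces the later pointwise
identities to computations with the constant matrices `modelE`, `modelJ` and `modelM`. -/
theorem exists_frame (h : Adapted G W a) : ∃ P Q, AdaptedFrame P Q G W a := by
  have hskew (u v : Fin 3 → ℝ) : u ⬝ᵥ W *ᵥ v = -(v ⬝ᵥ W *ᵥ u) := by
    rw [transpose_mulVec_dotProduct, h.skew, neg_mulVec, neg_dotProduct, dotProduct_comm]
  have hsymm (u v : Fin 3 → ℝ) : u ⬝ᵥ G *ᵥ v = v ⬝ᵥ G *ᵥ u := by
    rw [transpose_mulVec_dotProduct, h.symm, dotProduct_comm]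
  set X := G⁻¹ *ᵥ a with hX
  have hGX : G *ᵥ X = a := by rw [hX, mulVec_mulVec, h.mul_inv, one_mulVec]
  obtain ⟨v, hv0, hv⟩ := exists_orthogonal_ne_zero a
  have hvp := h.pos v hv0
  set r := Real.sqrt (v ⬝ᵥ G *ᵥ v) with hr
  have hr0 : 0 < r := Real.sqrt_pos.mpr hvp
  set e := r⁻¹ • v with he
  have hae : a ⬝ᵥ e = 0 := by rw [he, dotProduct_smul, hv, smul_zero]
  have hee : e ⬝ᵥ G *ᵥ e = 1 := by
    rw [he, mulVec_smul, dotProduct_smul, smul_dotProduct, smul_eq_mul, smul_eq_mul]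
    have : r * r = v ⬝ᵥ G *ᵥ v := Real.mul_self_sqrt hvp.le
    rw [← this]; field_simp
  -- Since `g(u, φ v) = dα(u, v) / 2`, the matrix of `φ` is `G⁻¹ W / 2`; thus `f = φ e`.
  set f := (1 / 2 : ℝ) • (G⁻¹ *ᵥ (W *ᵥ e)) with hf
  have hGf : G *ᵥ f = (1 / 2 : ℝ) • (W *ᵥ e) := by
    rw [hf, mulVec_smul, mulVec_mulVec, h.mul_inv, one_mulVec]
  -- This is `φ² e = -e`, the only use of `compat` in the construction.
  have hWf : W *ᵥ f = -(2 : ℝ) • (G *ᵥ e) := by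
    rw [hf, mulVec_smul, mulVec_mulVec, mulVec_mulVec, h.compat, smul_mulVec, sub_mulVec,
      vecMulVec_mulVec, hae, smul_smul]
    norm_num
  have hWX : W *ᵥ X = 0 := h.ker
  have haX : a ⬝ᵥ X = 1 := h.norm
  have hself (u : Fin 3 → ℝ) : u ⬝ᵥ W *ᵥ u = 0 := by linarith [hskew u u]
  have haf : a ⬝ᵥ f = 0 := by
    rw [← hGX, dotProduct_comm, hsymm, hGf, dotProduct_smul, hskew, hWX]; simp
  let P : Mat3 := of fun i j => (![X, e, f] j) i
  have hPm (B : Mat3) : Pᵀ * B * P = of fun i j => (![X, e, f] i) ⬝ᵥ B *ᵥ (![X, e, f] j) := by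
    ext i j
    rw [Matrix.mul_assoc]
    simp only [P, Matrix.mul_apply, of_apply, transpose_apply, dotProduct, mulVec]
  have hPG : Pᵀ * G * P = 1 := by
    rw [hPm]
    ext i j
    have e01 : X ⬝ᵥ G *ᵥ e = 0 := by rw [hsymm, hGX, dotProduct_comm, hae]
    have e02 : X ⬝ᵥ G *ᵥ f = 0 := by rw [hsymm, hGX, dotProduct_comm, haf]
    have e12 : e ⬝ᵥ G *ᵥ f = 0 := by rw [hGf, dotProduct_smul, hself, smul_zero]
    have e22 : f ⬝ᵥ G *ᵥ f = 1 := by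
      rw [hGf, dotProduct_smul, hskew, hWf, dotProduct_smul, hee]; norm_num
    fin_cases i <;> fin_cases j
    · simpa [hGX, dotProduct_comm] using haX
    · simpa using e01
    · simpa using e02
    · simpa [hsymm e X] using e01
    · simpa using hee
    · simpa using e12
    · simpa [hsymm f X] using e02
    · simpa [hsymm f e] using e12
    · simpa using e22
  have hPW : Pᵀ * W * P = (2 : ℝ) • modelJ := by
    rw [hPm]
    ext i j
    have e01 (u) : X ⬝ᵥ W *ᵥ u = 0 := by rw [hskew, hWX]; simp
    have e12 : e ⬝ᵥ W *ᵥ f = -2 := by rw [hWf, dotProduct_smul, hee]; norm_num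
    have e21 : f ⬝ᵥ W *ᵥ e = 2 := by rw [hskew, e12]; norm_num
    fin_cases i <;> fin_cases j <;> simp [modelJ, e01, hWX, hself, e12, e21]
  have hPa : Pᵀ *ᵥ a = ![1, 0, 0] := by
    ext i
    have : (Pᵀ *ᵥ a) i = (![X, e, f] i) ⬝ᵥ a := by
      simp only [P, mulVec, dotProduct, transpose_apply, of_apply]
    rw [this, dotProduct_comm]
    fin_cases i
    · simpa using haX
    · simpa using hae
    · simpa using haf
  have hQP : (Pᵀ * G) * P = 1 := hPG
  have hPQ : P * (Pᵀ * G) = 1 := mul_eq_one_comm.mp hQP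
  set Q := Pᵀ * G with hQ
  have hQt : Qᵀ * Pᵀ = 1 := by rw [← transpose_mul, hPQ, transpose_one]
  refine ⟨P, Q, hPQ, hQP, ?_, ?_, ?_⟩
  · rw [hQ, ← Matrix.mul_assoc, ← hQ, hQt, Matrix.one_mul]
  · rw [← Matrix.smul_mul, ← Matrix.mul_smul, ← hPW]
    calc W = (Qᵀ * Pᵀ) * W * (P * Q) := by rw [hQt, hPQ, Matrix.one_mul, Matrix.mul_one]
      _ = _ := by simp only [Matrix.mul_assoc]
  · rw [← hPa, mulVec_mulVec, hQt, one_mulVec]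

end Adapted

namespace AdaptedFrame

variable {P Q G W : Mat3} {a : Fin 3 → ℝ}

theorem transpose_QP (h : AdaptedFrame P Q G W a) : Qᵀ * Pᵀ = 1 := by
  rw [← transpose_mul, h.mul_PQ, transpose_one]

theorem transpose_PQ (h : AdaptedFrame P Q G W a) : Pᵀ * Qᵀ = 1 := by
  rw [← transpose_mul, h.mul_QP, transpose_one]

theorem inv_congr (h : AdaptedFrame P Q G W a) {Z Z' : Mat3} (hZ : Z * Z' = 1) :
    (Qᵀ * Z * Q)⁻¹ = P * Z' * Pᵀ := by
  apply inv_eq_right_inv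
  calc Qᵀ * Z * Q * (P * Z' * Pᵀ) = Qᵀ * Z * (Q * P) * Z' * Pᵀ := by simp only [Matrix.mul_assoc]
    _ = Qᵀ * (Z * Z') * Pᵀ := by rw [h.mul_QP]; simp only [Matrix.mul_assoc, Matrix.one_mul]
    _ = 1 := by rw [hZ, Matrix.mul_one, h.transpose_QP]

theorem inv_metric (h : AdaptedFrame P Q G W a) : G⁻¹ = P * Pᵀ := by
  have := h.inv_congr (Z := 1) (Z' := 1) (Matrix.one_mul 1)
  simpa [← h.metric] using this

theorem vecMulVec_covec (h : AdaptedFrame P Q G W a) : vecMulVec a a = Qᵀ * modelE * Q := by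
  rw [← vecMulVec_modelE, mul_vecMulVec, vecMulVec_mul, ← mulVec_transpose, ← h.covec]

theorem mul_mid (h : AdaptedFrame P Q G W a) (A B C : Mat3) :
    (Qᵀ * A * Q) * (P * B * Pᵀ) * (Qᵀ * C * Q) = Qᵀ * (A * B * C) * Q := by
  calc (Qᵀ * A * Q) * (P * B * Pᵀ) * (Qᵀ * C * Q)
      = Qᵀ * A * (Q * P) * B * (Pᵀ * Qᵀ) * C * Q := by simp only [Matrix.mul_assoc]
    _ = _ := by
      rw [h.mul_QP, h.transpose_PQ]; simp only [Matrix.mul_assoc, Matrix.one_mul]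

theorem mul_inv_mul (h : AdaptedFrame P Q G W a) (A C : Mat3) :
    (Qᵀ * A * Q) * G⁻¹ * (Qᵀ * C * Q) = Qᵀ * (A * C) * Q := by
  have := h.mul_mid A 1 C
  simpa [h.inv_metric] using this

theorem trace_inv_mul (h : AdaptedFrame P Q G W a) (A : Mat3) :
    (G⁻¹ * (Qᵀ * A * Q)).trace = A.trace := by
  calc (G⁻¹ * (Qᵀ * A * Q)).trace = (P * ((Pᵀ * Qᵀ) * A * Q)).trace := by
        rw [h.inv_metric]; simp only [Matrix.mul_assoc]
    _ = _ := by
      rw [trace_mul_comm, h.transpose_PQ, Matrix.one_mul, Matrix.mul_assoc, h.mul_QP,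
        Matrix.mul_one]

theorem congr_injective (h : AdaptedFrame P Q G W a) {A B : Mat3}
    (hAB : Qᵀ * A * Q = Qᵀ * B * Q) : A = B := by
  have key (C : Mat3) : Pᵀ * (Qᵀ * C * Q) * P = C := by
    calc Pᵀ * (Qᵀ * C * Q) * P = (Pᵀ * Qᵀ) * C * (Q * P) := by simp only [Matrix.mul_assoc]
      _ = C := by rw [h.transpose_PQ, h.mul_QP, Matrix.one_mul, Matrix.mul_one]
  rw [← key A, hAB, key]

theorem eq_congr (h : AdaptedFrame P Q G W a) (b : Mat3) : b = Qᵀ * (Pᵀ * b * P) * Q := by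
  calc b = (Qᵀ * Pᵀ) * b * (P * Q) := by
        rw [h.transpose_QP, h.mul_PQ, Matrix.one_mul, Matrix.mul_one]
    _ = _ := by simp only [Matrix.mul_assoc]

theorem inv_covec (h : AdaptedFrame P Q G W a) : G⁻¹ *ᵥ a = P *ᵥ ![1, 0, 0] := by
  rw [h.inv_metric, h.covec, mulVec_mulVec, Matrix.mul_assoc, h.transpose_PQ, Matrix.mul_one]

/-- In an adapted frame the kernel condition removes the first row and column, and `J c J = c`
forces the remaining symmetric block to be trace-free. Two parameters are left. -/
theorem admissible_iff (h : AdaptedFrame P Q G W a) {b : Mat3} :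
    Admissible G W a b ↔ ∃ p q, b = Qᵀ * modelM p q * Q := by
  constructor
  · intro hb
    set c := Pᵀ * b * P with hc
    have hbc : b = Qᵀ * c * Q := h.eq_congr b
    have h1 : cᵀ = c := by
      rw [hc]; simp only [transpose_mul, transpose_transpose, hb.symm, Matrix.mul_assoc]
    have h2 : c *ᵥ ![1, 0, 0] = 0 := by
      rw [hc, ← mulVec_mulVec, ← mulVec_mulVec, ← h.inv_covec, hb.ker, mulVec_zero]
    have h3 : modelJ * c * modelJ = c := by
      apply h.congr_injective
      have h4 := hb.anti
      have h5 : W * G⁻¹ * b * G⁻¹ * W = (4 : ℝ) • (Qᵀ * (modelJ * c * modelJ) * Q) := by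
        conv_lhs => rw [hbc]
        rw [h.form]
        simp only [Matrix.smul_mul, Matrix.mul_smul, smul_smul]
        rw [h.mul_inv_mul, h.mul_inv_mul]
        norm_num
      rw [h5] at h4
      rw [← hbc]
      exact smul_right_injective _ (by norm_num : (4 : ℝ) ≠ 0) h4
    have k0 := congrFun h2 0
    have k1 := congrFun h2 1
    have k2 := congrFun h2 2
    have s01 := congrFun (congrFun h1 0) 1
    have s02 := congrFun (congrFun h1 0) 2
    have s12 := congrFun (congrFun h1 1) 2
    have j11 := congrFun (congrFun h3 1) 1
    simp [mulVec, vecMul, dotProduct, Fin.sum_univ_three, modelJ, Matrix.mul_apply] at k0 k1 k2 s01 s02 s12 j11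
    refine ⟨c 1 1, c 1 2, ?_⟩
    rw [hbc]
    congr 2
    ext i j
    fin_cases i <;> fin_cases j <;> simp [modelM] <;> linarith
  · rintro ⟨p, q, rfl⟩
    refine ⟨?_, ?_, ?_⟩
    · have : (modelM p q)ᵀ = modelM p q := by
        ext i j; fin_cases i <;> fin_cases j <;> simp [modelM]
      simp only [transpose_mul, transpose_transpose, Matrix.mul_assoc, this]
    · rw [h.inv_covec, mulVec_mulVec, Matrix.mul_assoc, h.mul_QP, Matrix.mul_one, ← mulVec_mulVec]
      have : modelM p q *ᵥ ![1, 0, 0] = 0 := by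
        ext i; fin_cases i <;> simp [modelM, mulVec, dotProduct, Fin.sum_univ_three]
      rw [this, mulVec_zero]
    · rw [h.form]
      simp only [Matrix.smul_mul, Matrix.mul_smul, smul_smul]
      rw [h.mul_inv_mul, h.mul_inv_mul]
      have : modelJ * modelM p q * modelJ = modelM p q := by
        ext i j
        fin_cases i <;> fin_cases j <;>
          simp [modelM, modelJ, Matrix.mul_apply, Fin.sum_univ_three]
      rw [this]; norm_num

end AdaptedFrame

/-! ### Algebra of admissible forms; the deformation of a contact metric -/

section Consequences

variable {G W b c : Mat3} {a : Fin 3 → ℝ}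

/-- This is the polarised Cayley–Hamilton identity for trace-free 2×2 matrices. -/
theorem modelM_mul_add (p q r s : ℝ) : modelM p q * modelM r s + modelM r s * modelM p q =
    (2 * (p * r + q * s)) • (1 - modelE) := by
  ext i j
  fin_cases i <;> fin_cases j <;>
    simp [modelM, modelE] <;> ring

theorem trace_modelM_mul (p q r s : ℝ) :
    (modelM p q * modelM r s).trace = 2 * (p * r + q * s) := by
  simp [Matrix.trace_fin_three, modelM]
  ring

theorem AdaptedFrame.horizontal {P Q : Mat3} (h : AdaptedFrame P Q G W a) :
    G - vecMulVec a a = Qᵀ * (1 - modelE) * Q := by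
  rw [h.vecMulVec_covec, Matrix.mul_sub, Matrix.sub_mul, Matrix.mul_one, ← h.metric]

/-- Both determinants are `(det Q)²`, because `modelJ + modelE` has determinant one. The volume
density is therefore a function of `α` alone: it is common to all contact metrics and invariant
under the Reeb flow. -/
theorem Adapted.det_eq (h : Adapted G W a) :
    G.det = ((1 / 2 : ℝ) • W + vecMulVec a a).det := by
  obtain ⟨P, Q, f⟩ := h.exists_frame
  have : (1 / 2 : ℝ) • W + vecMulVec a a = Qᵀ * (modelJ + modelE) * Q := by
    rw [f.vecMulVec_covec, f.form, smul_smul, Matrix.mul_add, Matrix.add_mul]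
    norm_num
  have hd : (modelJ + modelE).det = 1 := by
    simp [modelJ, modelE, det_fin_three]
  rw [this, f.metric]
  simp only [det_mul, hd, mul_one]

/-- The pairing of bilinear forms that the metric `G` induces. -/
def pairing (G b c : Mat3) : ℝ := (G⁻¹ * b * (G⁻¹ * c)).trace

theorem pairing_comm (G b c : Mat3) : pairing G b c = pairing G c b := trace_mul_comm _ _

theorem AdaptedFrame.pairing_eq {P Q : Mat3} (h : AdaptedFrame P Q G W a) (B C : Mat3) :
    pairing G (Qᵀ * B * Q) (Qᵀ * C * Q) = (B * C).trace := by
  rw [pairing, Matrix.mul_assoc, ← Matrix.mul_assoc (Qᵀ * B * Q), h.mul_inv_mul, h.trace_inv_mul]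

theorem Admissible.mul_inv_mul_add (h : Adapted G W a) (hb : Admissible G W a b)
    (hc : Admissible G W a c) :
    b * G⁻¹ * c + c * G⁻¹ * b = pairing G b c • (G - vecMulVec a a) := by
  obtain ⟨P, Q, f⟩ := h.exists_frame
  obtain ⟨p, q, rfl⟩ := f.admissible_iff.mp hb
  obtain ⟨r, s, rfl⟩ := f.admissible_iff.mp hc
  rw [f.pairing_eq, trace_modelM_mul, f.mul_inv_mul, f.mul_inv_mul, f.horizontal,
    ← Matrix.add_mul, ← Matrix.mul_add, modelM_mul_add, Matrix.mul_smul, Matrix.smul_mul]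

/-- Applied to the torsion, this is the origin of every factor `‖τ‖²` in the argument. -/
theorem Admissible.mul_inv_mul_self (h : Adapted G W a) (hb : Admissible G W a b) :
    b * G⁻¹ * b = (1 / 2 * pairing G b b) • (G - vecMulVec a a) := by
  have := hb.mul_inv_mul_add h hb
  rw [← two_smul ℝ] at this
  rw [mul_smul, ← this, smul_smul]
  norm_num

/-- Admissible forms are trace-free on the contact plane. This removes the terms produced by
differentiating the inverse metric in the first variation. -/
theorem Adapted.pairing_horizontal (h : Adapted G W a) (hb : Admissible G W a b) :
    pairing G b (G - vecMulVec a a) = 0 := by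
  obtain ⟨P, Q, f⟩ := h.exists_frame
  obtain ⟨p, q, rfl⟩ := f.admissible_iff.mp hb
  rw [f.horizontal, f.pairing_eq]
  simp [trace_fin_three, modelM, modelE, vecMul, dotProduct, Fin.sum_univ_three]

theorem Admissible.pairing_nonneg (h : Adapted G W a) (hb : Admissible G W a b) :
    0 ≤ pairing G b b := by
  obtain ⟨P, Q, f⟩ := h.exists_frame
  obtain ⟨p, q, rfl⟩ := f.admissible_iff.mp hb
  rw [f.pairing_eq, trace_modelM_mul]
  nlinarith [mul_self_nonneg p, mul_self_nonneg q]

theorem Admissible.eq_zero_of_pairing (h : Adapted G W a) (hb : Admissible G W a b)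
    (h0 : pairing G b b = 0) : b = 0 := by
  obtain ⟨P, Q, f⟩ := h.exists_frame
  obtain ⟨p, q, rfl⟩ := f.admissible_iff.mp hb
  rw [f.pairing_eq, trace_modelM_mul] at h0
  have hp : p = 0 := by nlinarith [mul_self_nonneg p, mul_self_nonneg q]
  have hq : q = 0 := by nlinarith [mul_self_nonneg p, mul_self_nonneg q]
  have : modelM p q = 0 := by
    ext i j; fin_cases i <;> fin_cases j <;> simp [modelM, hp, hq]
  rw [this]; simp

/-- The deformation of a contact metric in the direction `b`, with `s = √(1 + t² |b|² / 2)`. -/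
def deform (G b : Mat3) (a : Fin 3 → ℝ) (s t : ℝ) : Mat3 :=
  vecMulVec a a + s • (G - vecMulVec a a) + t • b

theorem AdaptedFrame.deform_eq {P Q : Mat3} (h : AdaptedFrame P Q G W a) (M : Mat3) (s t : ℝ) :
    deform G (Qᵀ * M * Q) a s t = Qᵀ * (modelE + s • (1 - modelE) + t • M) * Q := by
  rw [deform, h.horizontal, h.vecMulVec_covec]
  simp only [Matrix.mul_add, Matrix.add_mul, Matrix.mul_smul, Matrix.smul_mul]

/-- The lower block has rows `(s + tp, tq)` and `(tq, s - tp)` and determinant `s² - t²(p² + q²) =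
1`. Changing the sign of `t` gives its adjugate, which is its inverse. -/
theorem deform_model_mul {p q s t : ℝ} (hs : s * s = 1 + t * t * (p * p + q * q)) :
    (modelE + s • (1 - modelE) + t • modelM p q) *
      (modelE + s • (1 - modelE) + (-t) • modelM p q) = 1 := by
  ext i j
  fin_cases i <;> fin_cases j <;>
    simp [modelM, modelE, Matrix.mul_apply, Fin.sum_univ_three] <;> linarith

theorem Adapted.deform_inv (h : Adapted G W a) (hb : Admissible G W a b) {s t : ℝ}
    (hs : s * s = 1 + t * t * (1 / 2 * pairing G b b)) :
    (deform G b a s t)⁻¹ = G⁻¹ * deform G b a s (-t) * G⁻¹ := by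
  obtain ⟨P, Q, f⟩ := h.exists_frame
  obtain ⟨p, q, rfl⟩ := f.admissible_iff.mp hb
  rw [f.pairing_eq, trace_modelM_mul] at hs
  rw [f.deform_eq, f.deform_eq, f.inv_congr (deform_model_mul (p := p) (q := q) (s := s) (t := t)
    (by linarith)), f.inv_metric]
  symm
  calc _ = P * (Pᵀ * Qᵀ) * (modelE + s • (1 - modelE) + -t • modelM p q) * (Q * P) * Pᵀ := by
        simp only [Matrix.mul_assoc]
    _ = _ := by rw [f.transpose_PQ, f.mul_QP, Matrix.mul_one, Matrix.mul_one]

/-- The scale `s` is chosen so that the block on the contact plane has determinant one. Positivity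
amounts to `s > |t| √(p² + q²)`, and the Reeb direction is left unchanged. -/
theorem Adapted.deform (h : Adapted G W a) (hb : Admissible G W a b) {s t : ℝ} (hs0 : 0 < s)
    (hs : s * s = 1 + t * t * (1 / 2 * pairing G b b)) :
    Adapted (deform G b a s t) W a := by
  obtain ⟨P, Q, f⟩ := h.exists_frame
  obtain ⟨p, q, rfl⟩ := f.admissible_iff.mp hb
  rw [f.pairing_eq, trace_modelM_mul] at hs
  have hinv := f.inv_congr (deform_model_mul (p := p) (q := q) (s := s) (t := t) (by linarith))
  rw [← f.deform_eq] at hinv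
  have hcov : (ContactThree.deform G (Qᵀ * modelM p q * Q) a s t)⁻¹ *ᵥ a = G⁻¹ *ᵥ a := by
    rw [hinv, f.inv_covec]
    conv_lhs => rw [f.covec]
    rw [mulVec_mulVec, Matrix.mul_assoc, f.transpose_PQ, Matrix.mul_one, ← mulVec_mulVec]
    congr 1
    ext i; fin_cases i <;> simp [modelE, modelM, mulVec, dotProduct, Fin.sum_univ_three]
  refine ⟨?_, ?_, h.skew, ?_, ?_, ?_⟩
  · rw [f.deform_eq]
    have : (modelE + s • (1 - modelE) + t • modelM p q)ᵀ =
        modelE + s • (1 - modelE) + t • modelM p q := by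
      ext i j; fin_cases i <;> fin_cases j <;> simp [modelM, modelE]
    simp only [transpose_mul, transpose_transpose, Matrix.mul_assoc, this]
  · intro v hv
    rw [f.deform_eq, ← mulVec_mulVec, ← mulVec_mulVec, transpose_mulVec_dotProduct,
      transpose_transpose]
    set w := Q *ᵥ v with hw
    have hw0 : w ≠ 0 := by
      intro h0
      apply hv
      rw [← one_mulVec v, ← f.mul_PQ, ← mulVec_mulVec, ← hw, h0, mulVec_zero]
    have key : w ⬝ᵥ (modelE + s • (1 - modelE) + t • modelM p q) *ᵥ w =
        w 0 ^ 2 + s * (w 1 ^ 2 + w 2 ^ 2) + t * (p * (w 1 ^ 2 - w 2 ^ 2) + 2 * q * w 1 * w 2) := by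
      simp [mulVec, dotProduct, Fin.sum_univ_three, modelE, modelM]
      ring
    rw [key]
    set n := w 1 ^ 2 + w 2 ^ 2 with hn
    set m := t * (p * (w 1 ^ 2 - w 2 ^ 2) + 2 * q * w 1 * w 2) with hm
    have hn0 : 0 ≤ n := by positivity
    -- Lagrange's identity `(pA + qB)² + (qA - pB)² = (p² + q²)(A² + B²)` with `A = w₁² - w₂²`, `B =
    -- 2 w₁ w₂`, and `A² + B² = n²`.
    have hmn : m ^ 2 ≤ (s ^ 2 - 1) * n ^ 2 := by
      have e1 : s ^ 2 - 1 = t ^ 2 * (p ^ 2 + q ^ 2) := by linear_combination hs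
      rw [e1]
      have : t ^ 2 * (p ^ 2 + q ^ 2) * n ^ 2 - m ^ 2 =
          (t * (q * (w 1 ^ 2 - w 2 ^ 2) - 2 * p * w 1 * w 2)) ^ 2 := by
        rw [hn, hm]; ring
      nlinarith [sq_nonneg (t * (q * (w 1 ^ 2 - w 2 ^ 2) - 2 * p * w 1 * w 2))]
    rcases hn0.eq_or_lt with h0 | h0
    · have m0 : m = 0 := by
        rw [← h0] at hmn
        exact pow_eq_zero_iff (two_ne_zero) |>.mp (le_antisymm (by simpa using hmn) (sq_nonneg m))
      have w0 : w 0 ≠ 0 := by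
        intro hw'
        apply hw0
        have h1 : w 1 = 0 := by nlinarith [sq_nonneg (w 1), sq_nonneg (w 2)]
        have h2 : w 2 = 0 := by nlinarith [sq_nonneg (w 1), sq_nonneg (w 2)]
        ext i; fin_cases i <;> simp [hw', h1, h2]
      rw [m0, ← h0]
      have := sq_pos_of_ne_zero w0
      linarith
    · have : |m| < s * n := by
        apply abs_lt_of_sq_lt_sq _ (by positivity)
        nlinarith [sq_pos_of_pos h0]
      have := neg_abs_le m
      nlinarith [sq_nonneg (w 0)]
  · rw [hcov, h.ker]
  · rw [hcov, h.norm]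
  · rw [hinv, f.form]
    have hZ (t : ℝ) : modelE + s • (1 - modelE) + t • modelM p q =
        !![1, 0, 0; 0, s + t * p, t * q; 0, t * q, s - t * p] := by
      ext i j
      fin_cases i <;> fin_cases j <;> simp [modelM, modelE]
      ring
    -- Conjugation by `J` fixes trace-free blocks and negates the identity block, so it sends the
    -- inverse block to minus the block itself.
    have hJ : modelJ * (modelE + s • (1 - modelE) + -t • modelM p q) * modelJ =
        -(modelE + s • (1 - modelE) + t • modelM p q - modelE) := by
      rw [hZ, hZ]
      ext i j
      fin_cases i <;> fin_cases j <;>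
        simp [modelE, modelJ, Matrix.mul_apply, Fin.sum_univ_three] <;> ring
    simp only [Matrix.smul_mul, Matrix.mul_smul, smul_smul]
    rw [f.mul_mid, hJ, f.deform_eq, f.vecMulVec_covec, ← Matrix.sub_mul, ← Matrix.mul_sub,
      Matrix.mul_neg, Matrix.neg_mul]
    norm_num

/-- The condition is tensorial, so it can be moved between a tangent space and the coordinates of
any chart. -/
theorem Adapted.congr (h : Adapted G W a) {D : Mat3} (hD : IsUnit D.det) :
    Adapted (Dᵀ * G * D) (Dᵀ * W * D) (Dᵀ *ᵥ a) := by
  have e1 : D * D⁻¹ = 1 := mul_nonsing_inv _ hD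
  have e1' : D⁻¹ * D = 1 := nonsing_inv_mul _ hD
  have e2 : (D⁻¹)ᵀ * Dᵀ = 1 := by rw [← transpose_mul, e1, transpose_one]
  have hinv : (Dᵀ * G * D)⁻¹ = D⁻¹ * G⁻¹ * (D⁻¹)ᵀ := by
    rw [Matrix.mul_inv_rev, Matrix.mul_inv_rev, transpose_nonsing_inv, Matrix.mul_assoc]
  have hcov : (Dᵀ * G * D)⁻¹ *ᵥ (Dᵀ *ᵥ a) = D⁻¹ *ᵥ (G⁻¹ *ᵥ a) := by
    rw [hinv, mulVec_mulVec, Matrix.mul_assoc, e2, Matrix.mul_one, mulVec_mulVec]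
  refine ⟨?_, ?_, ?_, ?_, ?_, ?_⟩
  · simp only [transpose_mul, transpose_transpose, h.symm, Matrix.mul_assoc]
  · intro v hv
    rw [← mulVec_mulVec, ← mulVec_mulVec, transpose_mulVec_dotProduct, transpose_transpose]
    apply h.pos
    intro h0
    apply hv
    rw [← one_mulVec v, ← e1', ← mulVec_mulVec, h0, mulVec_zero]
  · simp only [transpose_mul, transpose_transpose, h.skew, Matrix.mul_assoc, Matrix.neg_mul,
      Matrix.mul_neg]
  · rw [hcov, mulVec_mulVec, Matrix.mul_assoc, e1, Matrix.mul_one, ← mulVec_mulVec, h.ker,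
      mulVec_zero]
  · rw [hcov, dotProduct_comm, transpose_mulVec_dotProduct, transpose_transpose, mulVec_mulVec, e1,
      one_mulVec, dotProduct_comm, h.norm]
  · rw [hinv]
    have e3 : vecMulVec (Dᵀ *ᵥ a) (Dᵀ *ᵥ a) = Dᵀ * vecMulVec a a * D := by
      rw [mul_vecMulVec, vecMulVec_mul, ← mulVec_transpose]
    calc Dᵀ * W * D * (D⁻¹ * G⁻¹ * (D⁻¹)ᵀ) * (Dᵀ * W * D)
        = Dᵀ * W * (D * D⁻¹) * G⁻¹ * ((D⁻¹)ᵀ * Dᵀ) * W * D := by simp only [Matrix.mul_assoc]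
      _ = Dᵀ * (W * G⁻¹ * W) * D := by
        rw [e1, e2]; simp only [Matrix.mul_assoc, Matrix.mul_one]
      _ = _ := by
        rw [h.compat, e3, Matrix.mul_smul, Matrix.smul_mul, Matrix.mul_sub, Matrix.sub_mul]

theorem pairing_congr {D : Mat3} (hD : IsUnit D.det) (G b c : Mat3) :
    pairing (Dᵀ * G * D) (Dᵀ * b * D) (Dᵀ * c * D) = pairing G b c := by
  have e1 : D * D⁻¹ = 1 := mul_nonsing_inv _ hD
  have e2 : (D⁻¹)ᵀ * Dᵀ = 1 := by rw [← transpose_mul, e1, transpose_one]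
  have hinv : (Dᵀ * G * D)⁻¹ = D⁻¹ * G⁻¹ * (D⁻¹)ᵀ := by
    rw [Matrix.mul_inv_rev, Matrix.mul_inv_rev, transpose_nonsing_inv, Matrix.mul_assoc]
  rw [pairing, pairing, hinv]
  calc _ = (D⁻¹ * (G⁻¹ * ((D⁻¹)ᵀ * Dᵀ) * b * (D * D⁻¹) * G⁻¹ * ((D⁻¹)ᵀ * Dᵀ) * c * D)).trace := by
        simp only [Matrix.mul_assoc]
    _ = _ := by
      rw [trace_mul_comm, e1, e2]
      simp only [Matrix.mul_one]
      rw [Matrix.mul_assoc _ D, e1]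
      simp only [Matrix.mul_one, Matrix.mul_assoc]

end Consequences

/-! ### Naturality of the Lie derivative and the exterior derivative -/

section Euclidean

/-- The coordinate formula for the Lie derivative of a bilinear form. -/
def coordLie (X : E3 → E3) (b : E3 → E3 →L[ℝ] E3 →L[ℝ] ℝ) (y : E3) : E3 →L[ℝ] E3 →L[ℝ] ℝ :=
  fderiv ℝ b y (X y) + (b y).bilinearComp (fderiv ℝ X y) (ContinuousLinearMap.id ℝ E3)
    + (b y).bilinearComp (ContinuousLinearMap.id ℝ E3) (fderiv ℝ X y)

theorem coordLie_apply (X : E3 → E3) (b : E3 → E3 →L[ℝ] E3 →L[ℝ] ℝ) (y u v : E3) :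
    coordLie X b y u v =
      fderiv ℝ b y (X y) u v + b y (fderiv ℝ X y u) v + b y u (fderiv ℝ X y v) := by
  simp [coordLie]

theorem hasFDerivAt_bilin_apply {F : Type*} [NormedAddCommGroup F] [NormedSpace ℝ F]
    {b : F → E3 →L[ℝ] E3 →L[ℝ] ℝ} {b' : F →L[ℝ] E3 →L[ℝ] E3 →L[ℝ] ℝ} {c d : F → E3}
    {c' d' : F →L[ℝ] E3} {y : F} (hb : HasFDerivAt b b' y) (hc : HasFDerivAt c c' y)
    (hd : HasFDerivAt d d' y) (w : F) :
    fderiv ℝ (fun z => b z (c z) (d z)) y w =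
      b' w (c y) (d y) + b y (c' w) (d y) + b y (c y) (d' w) := by
  have := ((hb.clm_apply hc).clm_apply hd).fderiv
  rw [this]
  simp
  ring

theorem fderiv_bilin_apply_const {F : Type*} [NormedAddCommGroup F] [NormedSpace ℝ F]
    {b : F → E3 →L[ℝ] E3 →L[ℝ] ℝ} {y : F} (hb : DifferentiableAt ℝ b y) (u v : E3) (w : F) :
    fderiv ℝ (fun z => b z u v) y w = fderiv ℝ b y w u v := by
  have := hasFDerivAt_bilin_apply hb.hasFDerivAt (hasFDerivAt_const u y) (hasFDerivAt_const v y) w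
  simpa using this

/-- The Lie derivative of a bilinear form is natural under changes of coordinates. -/
theorem coordLie_pullback {F : E3 → E3} {X₁ X₂ : E3 → E3} {b₁ b₂ : E3 → E3 →L[ℝ] E3 →L[ℝ] ℝ}
    {y : E3} (hF : ContDiffAt ℝ ∞ F y) (hX₁ : DifferentiableAt ℝ X₁ y)
    (hX₂ : DifferentiableAt ℝ X₂ (F y)) (hb₁ : DifferentiableAt ℝ b₁ y)
    (hb₂ : DifferentiableAt ℝ b₂ (F y))
    (hX : ∀ᶠ z in 𝓝 y, fderiv ℝ F z (X₁ z) = X₂ (F z))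
    (hb : ∀ᶠ z in 𝓝 y, ∀ u v, b₁ z u v = b₂ (F z) (fderiv ℝ F z u) (fderiv ℝ F z v)) (u v : E3) :
    coordLie X₁ b₁ y u v = coordLie X₂ b₂ (F y) (fderiv ℝ F y u) (fderiv ℝ F y v) := by
  have hFd : HasFDerivAt F (fderiv ℝ F y) y := (hF.differentiableAt (by simp)).hasFDerivAt
  have hDF : DifferentiableAt ℝ (fderiv ℝ F) y :=
    (hF.fderiv_right (m := 1) (by norm_cast)).differentiableAt (by norm_num)
  have hD (w : E3) : HasFDerivAt (fun z => fderiv ℝ F z w) ((fderiv ℝ (fderiv ℝ F) y).flip w) y := by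
    have := hDF.hasFDerivAt.clm_apply (hasFDerivAt_const w y)
    rwa [ContinuousLinearMap.comp_zero, zero_add] at this
  -- The second-order terms appear as `D²F(X, u)` on one side and as `D²F(u, X)` on the other;
  -- symmetry identifies them.
  have hsymm : IsSymmSndFDerivAt ℝ F y := hF.isSymmSndFDerivAt (by norm_num [minSmoothness]; norm_cast)
  have e1 : fderiv ℝ b₁ y (X₁ y) u v =
      fderiv ℝ b₂ (F y) (fderiv ℝ F y (X₁ y)) (fderiv ℝ F y u) (fderiv ℝ F y v)
      + b₂ (F y) (fderiv ℝ (fderiv ℝ F) y (X₁ y) u) (fderiv ℝ F y v)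
      + b₂ (F y) (fderiv ℝ F y u) (fderiv ℝ (fderiv ℝ F) y (X₁ y) v) := by
    rw [← fderiv_bilin_apply_const hb₁]
    have : (fun z => b₁ z u v) =ᶠ[𝓝 y]
        fun z => (b₂ ∘ F) z (fderiv ℝ F z u) (fderiv ℝ F z v) := by
      filter_upwards [hb] with z hz using hz u v
    have hc : HasFDerivAt (b₂ ∘ F) ((fderiv ℝ b₂ (F y)).comp (fderiv ℝ F y)) y :=
      HasFDerivAt.comp (g := b₂) (g' := fderiv ℝ b₂ (F y)) y hb₂.hasFDerivAt hFd
    rw [this.fderiv_eq, hasFDerivAt_bilin_apply hc (hD u) (hD v) (X₁ y)]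
    simp
  -- Differentiate the relation `DF · X₁ = X₂ ∘ F` in the direction `w`.
  have e2 (w : E3) : fderiv ℝ X₂ (F y) (fderiv ℝ F y w) =
      fderiv ℝ (fderiv ℝ F) y w (X₁ y) + fderiv ℝ F y (fderiv ℝ X₁ y w) := by
    have h1 := (hDF.hasFDerivAt.clm_apply hX₁.hasFDerivAt).fderiv
    have h2 := (hX₂.hasFDerivAt.comp y hFd).fderiv
    have h3 : (fun z => fderiv ℝ F z (X₁ z)) =ᶠ[𝓝 y] X₂ ∘ F := hX
    rw [← h3.fderiv_eq, h1] at h2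
    have := congrArg (fun L => L w) h2
    simp at this
    rw [← this]; abel
  have hX0 := hX.self_of_nhds
  have hb0 := hb.self_of_nhds
  rw [coordLie_apply, coordLie_apply, e1, e2, e2, hb0, hb0, ← hX0, hsymm u, hsymm v]
  simp only [map_add, _root_.add_apply]
  ring

/-- The exterior derivative of a 1-form is natural under changes of coordinates. -/
theorem fderiv_oneForm_pullback {F : E3 → E3} {a₁ a₂ : E3 → E3 →L[ℝ] ℝ}
    {y : E3} (hF : ContDiffAt ℝ ∞ F y) (ha₁ : DifferentiableAt ℝ a₁ y)
    (ha₂ : DifferentiableAt ℝ a₂ (F y))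
    (ha : ∀ᶠ z in 𝓝 y, ∀ u, a₁ z u = a₂ (F z) (fderiv ℝ F z u)) (u v : E3) :
    fderiv ℝ a₁ y u v - fderiv ℝ a₁ y v u =
      fderiv ℝ a₂ (F y) (fderiv ℝ F y u) (fderiv ℝ F y v) -
        fderiv ℝ a₂ (F y) (fderiv ℝ F y v) (fderiv ℝ F y u) := by
  have hFd : HasFDerivAt F (fderiv ℝ F y) y := (hF.differentiableAt (by simp)).hasFDerivAt
  have hDF : DifferentiableAt ℝ (fderiv ℝ F) y :=
    (hF.fderiv_right (m := 1) (by norm_cast)).differentiableAt (by norm_num)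
  have hsymm : IsSymmSndFDerivAt ℝ F y := hF.isSymmSndFDerivAt (by norm_num [minSmoothness]; norm_cast)
  have key (u v : E3) : fderiv ℝ a₁ y u v =
      fderiv ℝ a₂ (F y) (fderiv ℝ F y u) (fderiv ℝ F y v) +
        a₂ (F y) (fderiv ℝ (fderiv ℝ F) y u v) := by
    have h1 : fderiv ℝ (fun z => a₁ z v) y u = fderiv ℝ a₁ y u v := by
      rw [(ha₁.hasFDerivAt.clm_apply (hasFDerivAt_const v y)).fderiv]; simp
    have h2 : (fun z => a₁ z v) =ᶠ[𝓝 y] fun z => (a₂ ∘ F) z (fderiv ℝ F z v) := by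
      filter_upwards [ha] with z hz using hz v
    rw [← h1, h2.fderiv_eq, ((ha₂.hasFDerivAt.comp y hFd).clm_apply
      (hDF.hasFDerivAt.clm_apply (hasFDerivAt_const v y))).fderiv]
    simp
    ring
  -- The second-order term is symmetric in `u` and `v`, so it drops out of the alternation.
  rw [key, key, hsymm u v]
  ring

end Euclidean

/-! ### Tensors in the preferred charts and under transitions -/

section Chart

variable {M : Type*} [TopologicalSpace M] [ChartedSpace E3 M] [IsManifold (𝓡 3) ∞ M]

/-- The coordinate frame as an endomorphism of `ℝ³`, the tangent spaces being `ℝ³` by definition. -/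
def frame (x : M) (y : E3) : E3 →L[ℝ] E3 := coordFrame x y

/-- The coordinate change from the chart at `x` to the chart at `q`. -/
def transition (x q : M) : E3 → E3 := extChartAt (𝓡 3) q ∘ (extChartAt (𝓡 3) x).symm

omit [IsManifold (𝓡 3) ∞ M] in
theorem bilinInChart_apply (b : ∀ p : M, TangentSpace (𝓡 3) p →L[ℝ] TangentSpace (𝓡 3) p →L[ℝ] ℝ)
    (x : M) (y u v : E3) :
    bilinInChart b x y u v =
      (b ((extChartAt (𝓡 3) x).symm y) : E3 →L[ℝ] E3 →L[ℝ] ℝ) (frame x y u) (frame x y v) := rfl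

omit [IsManifold (𝓡 3) ∞ M] in
theorem oneFormInChart_apply (a : ∀ p : M, TangentSpace (𝓡 3) p →L[ℝ] ℝ) (x : M) (y u : E3) :
    oneFormInChart a x y u = (a ((extChartAt (𝓡 3) x).symm y) : E3 →L[ℝ] ℝ) (frame x y u) := rfl

theorem isInvertible_frame (x : M) {y : E3} (hy : y ∈ (extChartAt (𝓡 3) x).target) :
    (frame x y).IsInvertible := by
  have := isInvertible_mfderivWithin_extChartAt_symm hy
  rw [ModelWithCorners.range_eq_univ, mfderivWithin_univ] at this
  exact this

theorem frame_injective (x : M) {y : E3} (hy : y ∈ (extChartAt (𝓡 3) x).target) :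
    Function.Injective (frame x y) := (isInvertible_frame x hy).injective

theorem frame_vectorFieldInChart (X : ∀ p : M, TangentSpace (𝓡 3) p) (x : M) {y : E3}
    (hy : y ∈ (extChartAt (𝓡 3) x).target) :
    frame x y (vectorFieldInChart X x y) = X ((extChartAt (𝓡 3) x).symm y) := by
  have := (isInvertible_frame x hy).self_apply_inverse (X ((extChartAt (𝓡 3) x).symm y))
  exact this

theorem frame_self (q : M) : frame q (extChartAt (𝓡 3) q q) = ContinuousLinearMap.id ℝ E3 := by
  have := mfderivWithin_range_extChartAt_symm (I := 𝓡 3) (x := q)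
  rw [ModelWithCorners.range_eq_univ, mfderivWithin_univ] at this
  exact this

theorem contMDiffAt_chart_symm (x : M) {y : E3} (hy : y ∈ (extChartAt (𝓡 3) x).target) :
    ContMDiffAt 𝓘(ℝ, E3) (𝓡 3) ∞ (extChartAt (𝓡 3) x).symm y :=
  (contMDiffOn_extChartAt_symm (n := ∞) x).contMDiffAt (extChartAt_target_mem_nhds' hy)

theorem contDiffAt_transition {x q : M} {y : E3} (hy : y ∈ (extChartAt (𝓡 3) x).target)
    (hq : (extChartAt (𝓡 3) x).symm y ∈ (extChartAt (𝓡 3) q).source) :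
    ContDiffAt ℝ ∞ (transition x q) y := by
  rw [← contMDiffAt_iff_contDiffAt]
  refine ContMDiffAt.comp y (contMDiffAt_extChartAt' ?_) (contMDiffAt_chart_symm x hy)
  rwa [extChartAt_source] at hq

theorem frame_transition {x q : M} {y : E3} (hy : y ∈ (extChartAt (𝓡 3) x).target)
    (hq : (extChartAt (𝓡 3) x).symm y ∈ (extChartAt (𝓡 3) q).source) (u : E3) :
    frame q (transition x q y) (fderiv ℝ (transition x q) y u) = frame x y u := by
  have h1 : transition x q y ∈ (extChartAt (𝓡 3) q).target := (extChartAt (𝓡 3) q).map_source hq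
  have h2 := (contMDiffAt_chart_symm q h1).mdifferentiableAt (by simp)
  have h3 : MDifferentiableAt 𝓘(ℝ, E3) 𝓘(ℝ, E3) (transition x q) y :=
    ((contDiffAt_transition hy hq).differentiableAt (by simp)).mdifferentiableAt
  have h4 := mfderiv_comp y h2 h3
  have h5 : (extChartAt (𝓡 3) q).symm ∘ transition x q =ᶠ[𝓝 y] (extChartAt (𝓡 3) x).symm := by
    have hc := (contMDiffAt_chart_symm x hy).continuousAt
    filter_upwards [hc.eventually (extChartAt_source_mem_nhds' hq)] with z hz
    exact (extChartAt (𝓡 3) q).left_inv hz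
  rw [mfderiv_eq_fderiv] at h4
  have h6 : (mfderiv 𝓘(ℝ, E3) (𝓡 3) ((extChartAt (𝓡 3) q).symm ∘ transition x q) y : E3 →L[ℝ] E3)
      = frame x y := h5.mfderiv_eq
  have h7 := congrArg (fun L : E3 →L[ℝ] E3 => L u) (h6.symm.trans h4)
  exact h7.symm

theorem eventually_mem_chart {x q : M} {y : E3} (hy : y ∈ (extChartAt (𝓡 3) x).target)
    (hq : (extChartAt (𝓡 3) x).symm y ∈ (extChartAt (𝓡 3) q).source) :
    ∀ᶠ z in 𝓝 y, z ∈ (extChartAt (𝓡 3) x).target ∧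
      (extChartAt (𝓡 3) x).symm z ∈ (extChartAt (𝓡 3) q).source :=
  Filter.Eventually.and (extChartAt_target_mem_nhds' hy) ((contMDiffAt_chart_symm x hy).continuousAt.eventually
    (extChartAt_source_mem_nhds' hq))

theorem bilinInChart_transition (b : ∀ p : M, TangentSpace (𝓡 3) p →L[ℝ] TangentSpace (𝓡 3) p →L[ℝ] ℝ)
    {x q : M} {y : E3} (hy : y ∈ (extChartAt (𝓡 3) x).target)
    (hq : (extChartAt (𝓡 3) x).symm y ∈ (extChartAt (𝓡 3) q).source) (u v : E3) :
    bilinInChart b x y u v = bilinInChart b q (transition x q y)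
      (fderiv ℝ (transition x q) y u) (fderiv ℝ (transition x q) y v) := by
  rw [bilinInChart_apply, bilinInChart_apply, frame_transition hy hq, frame_transition hy hq]
  have h : (extChartAt (𝓡 3) q).symm (transition x q y) = (extChartAt (𝓡 3) x).symm y :=
    (extChartAt (𝓡 3) q).left_inv hq
  let b' : M → E3 →L[ℝ] E3 →L[ℝ] ℝ := b
  change b' _ _ _ = b' _ _ _
  rw [h]

theorem oneFormInChart_transition (a : ∀ p : M, TangentSpace (𝓡 3) p →L[ℝ] ℝ)
    {x q : M} {y : E3} (hy : y ∈ (extChartAt (𝓡 3) x).target)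
    (hq : (extChartAt (𝓡 3) x).symm y ∈ (extChartAt (𝓡 3) q).source) (u : E3) :
    oneFormInChart a x y u = oneFormInChart a q (transition x q y)
      (fderiv ℝ (transition x q) y u) := by
  rw [oneFormInChart_apply, oneFormInChart_apply, frame_transition hy hq]
  have h : (extChartAt (𝓡 3) q).symm (transition x q y) = (extChartAt (𝓡 3) x).symm y :=
    (extChartAt (𝓡 3) q).left_inv hq
  let a' : M → E3 →L[ℝ] ℝ := a
  change a' _ _ = a' _ _
  rw [h]

theorem vectorFieldInChart_transition (X : ∀ p : M, TangentSpace (𝓡 3) p)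
    {x q : M} {y : E3} (hy : y ∈ (extChartAt (𝓡 3) x).target)
    (hq : (extChartAt (𝓡 3) x).symm y ∈ (extChartAt (𝓡 3) q).source) :
    fderiv ℝ (transition x q) y (vectorFieldInChart X x y) =
      vectorFieldInChart X q (transition x q y) := by
  have h1 : transition x q y ∈ (extChartAt (𝓡 3) q).target := (extChartAt (𝓡 3) q).map_source hq
  apply frame_injective q h1
  rw [frame_transition hy hq, frame_vectorFieldInChart X x hy, frame_vectorFieldInChart X q h1]
  have h : (extChartAt (𝓡 3) q).symm (transition x q y) = (extChartAt (𝓡 3) x).symm y :=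
    (extChartAt (𝓡 3) q).left_inv hq
  let X' : M → E3 := X
  change X' _ = X' _
  rw [h]

/-- A preferred chart has the identity frame at its own base point, so the transition into it has
derivative equal to the coordinate frame. -/
theorem fderiv_transition_self {x : M} {y : E3} (hy : y ∈ (extChartAt (𝓡 3) x).target) (u : E3) :
    fderiv ℝ (transition x ((extChartAt (𝓡 3) x).symm y)) y u = frame x y u := by
  have := frame_transition hy (mem_extChartAt_source ((extChartAt (𝓡 3) x).symm y)) u
  rw [← this]
  have h := frame_self ((extChartAt (𝓡 3) x).symm y)
  change _ = frame _ (extChartAt (𝓡 3) ((extChartAt (𝓡 3) x).symm y) ((extChartAt (𝓡 3) x).symm y)) _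
  rw [h]
  rfl

/-- The invariant definition uses a different chart at each point. Naturality replaces all of them
by the single chart at `x`, in which the result can be differentiated again. -/
theorem lieDerivBilin_frame (X : ∀ p : M, TangentSpace (𝓡 3) p)
    (b : ∀ p : M, TangentSpace (𝓡 3) p →L[ℝ] TangentSpace (𝓡 3) p →L[ℝ] ℝ)
    (hX : ∀ (q : M) (z : E3), z ∈ (extChartAt (𝓡 3) q).target →
      DifferentiableAt ℝ (vectorFieldInChart X q) z)
    (hb : ∀ (q : M) (z : E3), z ∈ (extChartAt (𝓡 3) q).target →
      DifferentiableAt ℝ (bilinInChart b q) z)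
    {x : M} {y : E3} (hy : y ∈ (extChartAt (𝓡 3) x).target) (u v : E3) :
    (lieDerivBilin X b ((extChartAt (𝓡 3) x).symm y) : E3 →L[ℝ] E3 →L[ℝ] ℝ)
      (frame x y u) (frame x y v) = coordLie (vectorFieldInChart X x) (bilinInChart b x) y u v := by
  set q := (extChartAt (𝓡 3) x).symm y with hq
  have hqs : (extChartAt (𝓡 3) x).symm y ∈ (extChartAt (𝓡 3) q).source := mem_extChartAt_source q
  have hT : transition x q y = extChartAt (𝓡 3) q q := rfl
  have hqt : transition x q y ∈ (extChartAt (𝓡 3) q).target := (extChartAt (𝓡 3) q).map_source hqs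
  have hev := eventually_mem_chart hy hqs
  rw [coordLie_pullback (contDiffAt_transition hy hqs) (hX x y hy) (hX q _ hqt) (hb x y hy)
    (hb q _ hqt)
    (by filter_upwards [hev] with z hz using vectorFieldInChart_transition X hz.1 hz.2)
    (by filter_upwards [hev] with z hz using bilinInChart_transition b hz.1 hz.2) u v,
    fderiv_transition_self hy, fderiv_transition_self hy]
  rfl

theorem extDerivOneForm_frame (a : ∀ p : M, TangentSpace (𝓡 3) p →L[ℝ] ℝ)
    (ha : ∀ (q : M) (z : E3), z ∈ (extChartAt (𝓡 3) q).target →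
      DifferentiableAt ℝ (oneFormInChart a q) z)
    {x : M} {y : E3} (hy : y ∈ (extChartAt (𝓡 3) x).target) (u v : E3) :
    (extDerivOneForm a ((extChartAt (𝓡 3) x).symm y) : E3 →L[ℝ] E3 →L[ℝ] ℝ)
      (frame x y u) (frame x y v) =
        fderiv ℝ (oneFormInChart a x) y u v - fderiv ℝ (oneFormInChart a x) y v u := by
  set q := (extChartAt (𝓡 3) x).symm y with hq
  have hqs : (extChartAt (𝓡 3) x).symm y ∈ (extChartAt (𝓡 3) q).source := mem_extChartAt_source q
  have hqt : transition x q y ∈ (extChartAt (𝓡 3) q).target := (extChartAt (𝓡 3) q).map_source hqs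
  have hev := eventually_mem_chart hy hqs
  rw [fderiv_oneForm_pullback (contDiffAt_transition hy hqs) (ha x y hy) (ha q _ hqt)
    (by filter_upwards [hev] with z hz using oneFormInChart_transition a hz.1 hz.2) u v,
    fderiv_transition_self hy, fderiv_transition_self hy]
  rfl

end Chart

/-! ### Smooth matrix-valued functions -/

section SmoothMatrices

variable {F : Type*} [NormedAddCommGroup F] [NormedSpace ℝ F] {S : Set F}

/-- Matrix functions with smooth entries. -/
def SmoothMat (S : Set F) (B : F → Mat3) : Prop := ∀ i j, ContDiffOn ℝ ∞ (fun y => B y i j) S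

variable {B C : F → Mat3}

theorem SmoothMat.add (hB : SmoothMat S B) (hC : SmoothMat S C) :
    SmoothMat S (fun y => B y + C y) := fun i j => (hB i j).add (hC i j)

theorem SmoothMat.sub (hB : SmoothMat S B) (hC : SmoothMat S C) :
    SmoothMat S (fun y => B y - C y) := fun i j => (hB i j).sub (hC i j)

theorem SmoothMat.smul {h : F → ℝ} (hh : ContDiffOn ℝ ∞ h S) (hB : SmoothMat S B) :
    SmoothMat S (fun y => h y • B y) := fun i j => hh.mul (hB i j)

theorem SmoothMat.transpose (hB : SmoothMat S B) : SmoothMat S (fun y => (B y)ᵀ) :=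
  fun i j => hB j i

theorem SmoothMat.mul (hB : SmoothMat S B) (hC : SmoothMat S C) :
    SmoothMat S (fun y => B y * C y) := fun i j => by
  simp only [Matrix.mul_apply]
  exact ContDiffOn.sum fun k _ => (hB i k).mul (hC k j)

theorem SmoothMat.trace (hB : SmoothMat S B) : ContDiffOn ℝ ∞ (fun y => (B y).trace) S := by
  simp only [Matrix.trace, diag_apply]
  exact ContDiffOn.sum fun k _ => hB k k

theorem SmoothMat.det (hB : SmoothMat S B) : ContDiffOn ℝ ∞ (fun y => (B y).det) S := by
  simp only [Matrix.det_fin_three]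
  have h := hB
  unfold SmoothMat at h
  exact ((((((h 0 0).mul (h 1 1)).mul (h 2 2)).sub (((h 0 0).mul (h 1 2)).mul (h 2 1))).sub
    (((h 0 1).mul (h 1 0)).mul (h 2 2))).add (((h 0 1).mul (h 1 2)).mul (h 2 0))).add
    (((h 0 2).mul (h 1 0)).mul (h 2 1)) |>.sub (((h 0 2).mul (h 1 1)).mul (h 2 0))

theorem SmoothMat.inv (hB : SmoothMat S B) (hu : ∀ y ∈ S, IsUnit (B y).det) :
    SmoothMat S (fun y => (B y)⁻¹) := by
  intro i j
  have h1 : ∀ y, (B y)⁻¹ i j = ((B y).det)⁻¹ * ((B y).adjugate i j) := by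
    intro y
    rw [Matrix.inv_def, Ring.inverse_eq_inv', Matrix.smul_apply, smul_eq_mul]
  simp only [h1]
  refine (hB.det.inv fun y hy => (hu y hy).ne_zero).mul ?_
  -- Cramer's rule: the entries of the adjugate are determinants of matrices with one row replaced
  -- by a constant one.
  simp only [adjugate_apply]
  refine SmoothMat.det fun k l => ?_
  by_cases hk : k = j
  · subst hk
    simp only [updateRow_self]
    exact contDiffOn_const
  · simp only [updateRow_ne hk]
    exact hB k l

theorem SmoothMat.pairing {G : F → Mat3} (hG : SmoothMat S G) (hu : ∀ y ∈ S, IsUnit (G y).det)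
    (hB : SmoothMat S B) (hC : SmoothMat S C) :
    ContDiffOn ℝ ∞ (fun y => pairing (G y) (B y) (C y)) S :=
  SmoothMat.trace (((hG.inv hu).mul hB).mul ((hG.inv hu).mul hC))

theorem SmoothMat.comp {F' : Type*} [NormedAddCommGroup F'] [NormedSpace ℝ F'] {S' : Set F'}
    {φ : F' → F} (hB : SmoothMat S B) (hφ : ContDiffOn ℝ ∞ φ S') (hm : MapsTo φ S' S) :
    SmoothMat S' (fun y => B (φ y)) := fun i j => (hB i j).comp hφ hm

end SmoothMatrices

/-! ### Lie derivatives of matrix-valued two-tensors -/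

section LieCalculus

/-- The derivative of a matrix function at `y` in the direction `v`. -/
def MatDer (v : E3) (y : E3) (B : E3 → Mat3) (B' : Mat3) : Prop :=
  ∀ i j, HasLineDerivAt ℝ (fun z => B z i j) (B' i j) y v

/-- The standard basis of `ℝ³`. -/
abbrev stdVec (i : Fin 3) : E3 := EuclideanSpace.single i 1

/-- The Jacobian matrix of a vector field. -/
def jac (X : E3 → E3) (y : E3) : Mat3 := of fun i j => fderiv ℝ (fun z => X z i) y (stdVec j)

/-- `L` is the Lie derivative at `y` of the covariant 2-tensor `B` along `X`. -/
def LieAt (X : E3 → E3) (y : E3) (B : E3 → Mat3) (L : Mat3) : Prop :=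
  MatDer (X y) y B (L - B y * jac X y - (jac X y)ᵀ * B y)

/-- `L` is the Lie derivative at `y` of the contravariant 2-tensor `S` along `X`. -/
def LieConAt (X : E3 → E3) (y : E3) (S : E3 → Mat3) (L : Mat3) : Prop :=
  MatDer (X y) y S (L + jac X y * S y + S y * (jac X y)ᵀ)

variable {X : E3 → E3} {v y : E3} {B C S : E3 → Mat3} {B' C' L L₁ L₂ L₃ : Mat3}

theorem MatDer.mul (hB : MatDer v y B B') (hC : MatDer v y C C') :
    MatDer v y (fun z => B z * C z) (B' * C y + B y * C') := by
  intro i j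
  unfold HasLineDerivAt
  have := HasDerivAt.fun_sum (u := Finset.univ) fun k _ => (hB i k).fun_mul (hC k j)
  simp only [Matrix.add_apply, Matrix.mul_apply]
  convert this using 1
  simp [Finset.sum_add_distrib]

theorem MatDer.add (hB : MatDer v y B B') (hC : MatDer v y C C') :
    MatDer v y (fun z => B z + C z) (B' + C') := fun i j => (hB i j).fun_add (hC i j)

theorem MatDer.smul {h : E3 → ℝ} {h' : ℝ} (hh : HasLineDerivAt ℝ h h' y v)
    (hB : MatDer v y B B') : MatDer v y (fun z => h z • B z) (h' • B y + h y • B') := by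
  intro i j
  have := HasDerivAt.fun_mul hh (hB i j)
  unfold HasLineDerivAt
  simpa using this

theorem MatDer.transpose (hB : MatDer v y B B') : MatDer v y (fun z => (B z)ᵀ) B'ᵀ :=
  fun i j => hB j i

theorem MatDer.trace (hB : MatDer v y B B') :
    HasLineDerivAt ℝ (fun z => (B z).trace) B'.trace y v := by
  unfold HasLineDerivAt
  simp only [Matrix.trace, diag_apply]
  exact HasDerivAt.fun_sum fun k _ => hB k k

theorem MatDer.unique (hB : MatDer v y B B') (hC : MatDer v y B C') : B' = C' := by
  ext i j
  exact HasDerivAt.unique (hB i j) (hC i j)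

theorem hasLineDerivAt_congr {f g : E3 → ℝ} {f' : ℝ} (h : f =ᶠ[𝓝 y] g)
    (hg : HasLineDerivAt ℝ g f' y v) : HasLineDerivAt ℝ f f' y v := by
  have hc : ContinuousAt (fun t : ℝ => y + t • v) 0 := by fun_prop
  refine HasDerivAt.congr_of_eventuallyEq hg ?_
  exact hc.eventually (p := fun z => f z = g z) (by
    simp only [zero_smul, add_zero]; exact h)

theorem MatDer.congr (hB : MatDer v y B B') (h : ∀ᶠ z in 𝓝 y, C z = B z) : MatDer v y C B' :=
  fun i j => hasLineDerivAt_congr (h.mono fun z hz => by simp only [hz]) (hB i j)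

/-- Jacobi's formula. -/
theorem MatDer.det (hB : MatDer v y B B') :
    HasLineDerivAt ℝ (fun z => (B z).det) ((B y).adjugate * B').trace y v := by
  unfold HasLineDerivAt
  simp only [Matrix.det_fin_three]
  have h := hB
  unfold MatDer HasLineDerivAt at h
  have := (((((((h 0 0).fun_mul (h 1 1)).fun_mul (h 2 2)).fun_sub
    (((h 0 0).fun_mul (h 1 2)).fun_mul (h 2 1))).fun_sub
    (((h 0 1).fun_mul (h 1 0)).fun_mul (h 2 2))).fun_add
    (((h 0 1).fun_mul (h 1 2)).fun_mul (h 2 0))).fun_add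
    (((h 0 2).fun_mul (h 1 0)).fun_mul (h 2 1))).fun_sub
    (((h 0 2).fun_mul (h 1 1)).fun_mul (h 2 0))
  convert this using 1
  simp [adjugate_fin_three, Matrix.trace_fin_three, Fin.sum_univ_three, vecMul, dotProduct]
  ring

theorem LieAt.add (hB : LieAt X y B L₁) (hC : LieAt X y C L₂) :
    LieAt X y (fun z => B z + C z) (L₁ + L₂) := by
  unfold LieAt
  convert MatDer.add hB hC using 1
  noncomm_ring

theorem LieAt.smul {h : E3 → ℝ} {h' : ℝ} (hh : HasLineDerivAt ℝ h h' y (X y))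
    (hB : LieAt X y B L) : LieAt X y (fun z => h z • B z) (h' • B y + h y • L) := by
  unfold LieAt
  convert MatDer.smul hh hB using 1
  simp only [smul_sub, Matrix.smul_mul, Matrix.mul_smul]
  abel

theorem hasLineDerivAt_const (c : ℝ) : HasLineDerivAt ℝ (fun _ : E3 => c) 0 y v :=
  hasDerivAt_const _ _

theorem LieAt.const_smul (c : ℝ) (hB : LieAt X y B L) : LieAt X y (fun z => c • B z) (c • L) := by
  have := LieAt.smul (hasLineDerivAt_const c) hB
  simpa using this

theorem LieAt.sub (hB : LieAt X y B L₁) (hC : LieAt X y C L₂) :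
    LieAt X y (fun z => B z - C z) (L₁ - L₂) := by
  simpa [sub_eq_add_neg] using hB.add (hC.const_smul (-1))

theorem LieAt.transpose (hB : LieAt X y B L) : LieAt X y (fun z => (B z)ᵀ) Lᵀ := by
  unfold LieAt
  convert MatDer.transpose hB using 1
  simp only [transpose_sub, transpose_mul, transpose_transpose]
  abel

/-- Together with `LieAt.congr`, this differentiates a tensor identity that holds on a
neighbourhood: both sides have the same Lie derivative. -/
theorem LieAt.unique (hB : LieAt X y B L₁) (hC : LieAt X y B L₂) : L₁ = L₂ := by
  have := MatDer.unique hB hC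
  simpa using this

theorem LieAt.congr (hB : LieAt X y B L) (h : ∀ᶠ z in 𝓝 y, C z = B z) : LieAt X y C L := by
  unfold LieAt
  rw [h.self_of_nhds]
  exact MatDer.congr hB h

/-- The Jacobian terms of the contravariant middle factor cancel against those of its covariant
neighbours, which leaves the Leibniz rule for expressions such as `dα g⁻¹ dα`. -/
theorem LieAt.triple (hB : LieAt X y B L₁) (hS : LieConAt X y S L₂) (hC : LieAt X y C L₃) :
    LieAt X y (fun z => B z * S z * C z) (L₁ * S y * C y + B y * L₂ * C y + B y * S y * L₃) := by
  unfold LieAt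
  convert (MatDer.mul hB hS).mul hC using 1
  noncomm_ring

theorem LieConAt.triple (hB : LieConAt X y B L₁) (hS : LieAt X y S L₂) (hC : LieConAt X y C L₃) :
    LieConAt X y (fun z => B z * S z * C z)
      (L₁ * S y * C y + B y * L₂ * C y + B y * S y * L₃) := by
  unfold LieConAt
  convert (MatDer.mul hB hS).mul hC using 1
  noncomm_ring

/-- A full contraction is a function, so its Lie derivative is the directional derivative. The
Jacobian terms cancel by cyclicity of the trace. -/
theorem LieConAt.trace (hS : LieConAt X y S L₁) (hB : LieAt X y B L₂) :
    HasLineDerivAt ℝ (fun z => (S z * B z).trace) (L₁ * B y + S y * L₂).trace y (X y) := by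
  have h := (MatDer.mul hS hB).trace
  convert h using 1
  have e : (jac X y * S y * B y).trace = (S y * B y * jac X y).trace := by
    rw [Matrix.mul_assoc, trace_mul_comm]
  simp only [Matrix.add_mul, Matrix.mul_sub, trace_add, trace_sub, ← Matrix.mul_assoc, e]
  ring

variable {Ω : Set E3}

/-- The Lie derivative of a covariant 2-tensor. -/
def lieM (X : E3 → E3) (B : E3 → Mat3) (y : E3) : Mat3 :=
  (of fun i j => fderiv ℝ (fun z => B z i j) y (X y)) + B y * jac X y + (jac X y)ᵀ * B y

theorem ContDiffOn.hasLineDerivAt {f : E3 → ℝ} (hΩ : IsOpen Ω) (hf : ContDiffOn ℝ ∞ f Ω)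
    (hy : y ∈ Ω) (v : E3) : HasLineDerivAt ℝ f (fderiv ℝ f y v) y v :=
  ((hf.contDiffAt (hΩ.mem_nhds hy)).differentiableAt (by simp)).hasFDerivAt.hasLineDerivAt v

theorem SmoothMat.matDer (hΩ : IsOpen Ω) (hB : SmoothMat Ω B) (hy : y ∈ Ω) (v : E3) :
    MatDer v y B (of fun i j => fderiv ℝ (fun z => B z i j) y v) :=
  fun i j => ContDiffOn.hasLineDerivAt hΩ (hB i j) hy v

theorem SmoothMat.lieAt (hΩ : IsOpen Ω) (hB : SmoothMat Ω B) (hy : y ∈ Ω) :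
    LieAt X y B (lieM X B y) := by
  unfold LieAt lieM
  convert hB.matDer hΩ hy (X y) using 1
  abel

theorem ContDiffOn.fderiv_apply_smooth {f : E3 → ℝ} {V : E3 → E3} (hΩ : IsOpen Ω)
    (hf : ContDiffOn ℝ ∞ f Ω) (hV : ContDiffOn ℝ ∞ V Ω) :
    ContDiffOn ℝ ∞ (fun y => fderiv ℝ f y (V y)) Ω :=
  (hf.fderiv_of_isOpen hΩ (m := ∞) (by simp)).clm_apply hV

theorem contDiffOn_coord {V : E3 → E3} (hV : ContDiffOn ℝ ∞ V Ω) (i : Fin 3) :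
    ContDiffOn ℝ ∞ (fun y => V y i) Ω := (contDiffOn_euclidean.mp hV) i

theorem smoothMat_jac (hΩ : IsOpen Ω) (hX : ContDiffOn ℝ ∞ X Ω) : SmoothMat Ω (jac X) :=
  fun i _ => ContDiffOn.fderiv_apply_smooth hΩ (contDiffOn_coord hX i) contDiffOn_const

theorem SmoothMat.lieM (hΩ : IsOpen Ω) (hX : ContDiffOn ℝ ∞ X Ω) (hB : SmoothMat Ω B) :
    SmoothMat Ω (lieM X B) := by
  have hJ := smoothMat_jac hΩ hX
  refine SmoothMat.add (SmoothMat.add ?_ (hB.mul hJ)) (hJ.transpose.mul hB)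
  exact fun i j => ContDiffOn.fderiv_apply_smooth hΩ (hB i j) hX

/-- Differentiate `G G⁻¹ = 1`. -/
theorem LieConAt.inv {G : E3 → Mat3} {T : Mat3} (hΩ : IsOpen Ω) (hG : SmoothMat Ω G)
    (hu : ∀ z ∈ Ω, IsUnit (G z).det) (hy : y ∈ Ω) (hT : LieAt X y G T) :
    LieConAt X y (fun z => (G z)⁻¹) (-((G y)⁻¹ * T * (G y)⁻¹)) := by
  have h1 := (hG.inv hu).matDer hΩ hy (X y)
  set Y : Mat3 := of fun i j => fderiv ℝ (fun z => (G z)⁻¹ i j) y (X y) with hY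
  have h2 := MatDer.mul hT h1
  have h3 : MatDer (X y) y (fun z => G z * (G z)⁻¹) 0 := by
    have h4 : MatDer (X y) y (fun _ => (1 : Mat3)) 0 := fun i j => hasLineDerivAt_const _
    exact h4.congr (by
      filter_upwards [hΩ.mem_nhds hy] with z hz using mul_nonsing_inv _ (hu z hz))
  have h5 := h2.unique h3
  have e1 : (G y)⁻¹ * G y = 1 := nonsing_inv_mul _ (hu y hy)
  have e2 : G y * (G y)⁻¹ = 1 := mul_nonsing_inv _ (hu y hy)
  unfold LieConAt
  convert h1 using 1
  have h6 := congrArg (fun Z => (G y)⁻¹ * Z) h5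
  simp only [Matrix.mul_add, Matrix.mul_zero, ← Matrix.mul_assoc, Matrix.mul_sub, Matrix.sub_mul,
    e1, Matrix.one_mul] at h6
  rw [Matrix.mul_assoc _ (G y), e2, Matrix.mul_one] at h6
  rw [eq_neg_of_add_eq_zero_right h6]
  abel

end LieCalculus

/-! ### Contact metrics on an open subset of `ℝ³`; invariance of `α` and `dα` -/

/-- The components of a 1-form. -/
def covec (β : E3 → E3 →L[ℝ] ℝ) (y : E3) : Fin 3 → ℝ := fun i => β y (stdVec i)

/-- The components of the exterior derivative of a 1-form. -/
def dmat (β : E3 → E3 →L[ℝ] ℝ) (y : E3) : Mat3 :=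
  of fun i j => fderiv ℝ (fun z => covec β z j) y (stdVec i) -
    fderiv ℝ (fun z => covec β z i) y (stdVec j)

/-- The square `α ⊗ α` of a 1-form. -/
def formSq (β : E3 → E3 →L[ℝ] ℝ) (y : E3) : Mat3 := vecMulVec (covec β y) (covec β y)

/-- A contact form `β` with Reeb field `X` and a contact metric `G` on an open subset of `ℝ³`. -/
structure LocalContactMetric (Ω : Set E3) (β : E3 → E3 →L[ℝ] ℝ) (X : E3 → E3) (G : E3 → Mat3) :
    Prop where
  isOpen : IsOpen Ω
  smooth_form : ∀ i, ContDiffOn ℝ ∞ (fun y => covec β y i) Ω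
  smooth_reeb : ContDiffOn ℝ ∞ X Ω
  smooth_metric : SmoothMat Ω G
  adapted : ∀ y ∈ Ω, Adapted (G y) (dmat β y) (covec β y)
  reeb : ∀ y ∈ Ω, ∀ i, X y i = ((G y)⁻¹ *ᵥ covec β y) i

section Basics

theorem fderiv_eq_sum (f : E3 → ℝ) (y v : E3) :
    fderiv ℝ f y v = ∑ i, v i * fderiv ℝ f y (stdVec i) := by
  conv_lhs => rw [← (EuclideanSpace.basisFun (Fin 3) ℝ).sum_repr v]
  simp [map_sum]

variable {Ω : Set E3} {β : E3 → E3 →L[ℝ] ℝ} {X : E3 → E3} {G : E3 → Mat3} {y : E3}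

namespace LocalContactMetric

variable (h : LocalContactMetric Ω β X G)
include h

theorem reeb_fun (hy : y ∈ Ω) : (fun i => X y i) = (G y)⁻¹ *ᵥ covec β y := funext (h.reeb y hy)

theorem form_reeb (hy : y ∈ Ω) : ∑ i, covec β y i * X y i = 1 := by
  have := (h.adapted y hy).norm
  rw [← h.reeb_fun hy] at this
  exact this

theorem dmat_reeb (hy : y ∈ Ω) (i : Fin 3) : ∑ j, dmat β y i j * X y j = 0 := by
  have := (h.adapted y hy).ker
  rw [← h.reeb_fun hy] at this
  exact congrFun this i

theorem smooth_reeb_coord (i : Fin 3) : ContDiffOn ℝ ∞ (fun y => X y i) Ω :=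
  contDiffOn_coord h.smooth_reeb i

/-- `L_X α = 0` in components. -/
theorem lie_form (hy : y ∈ Ω) (j : Fin 3) :
    fderiv ℝ (fun z => covec β z j) y (X y) = -∑ i, covec β y i * jac X y i j := by
  have hd := h.dmat_reeb hy j
  simp only [dmat, of_apply] at hd
  have h1 := ContDiffOn.hasLineDerivAt (v := stdVec j) h.isOpen (f := fun z => ∑ i, covec β z i * X z i)
    (ContDiffOn.sum fun i _ => (h.smooth_form i).mul (h.smooth_reeb_coord i)) hy
  -- Differentiating `α(X) = 1` trades derivatives of `α` for derivatives of `X`. Combined with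
  -- `dα(∂ⱼ, X) = 0`, this is Cartan's formula in components.
  have h2 : HasLineDerivAt ℝ (fun z => ∑ i, covec β z i * X z i) 0 y (stdVec j) :=
    hasLineDerivAt_congr (by
      filter_upwards [h.isOpen.mem_nhds hy] with z hz using h.form_reeb hz) (hasLineDerivAt_const 1)
  have h3 : HasLineDerivAt ℝ (fun z => ∑ i, covec β z i * X z i)
      (∑ i, (fderiv ℝ (fun z => covec β z i) y (stdVec j) * X y i + covec β y i * jac X y i j)) y
      (stdVec j) := by
    unfold HasLineDerivAt
    have := HasDerivAt.fun_sum (u := Finset.univ) fun i (_ : i ∈ Finset.univ) =>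
      (ContDiffOn.hasLineDerivAt h.isOpen (h.smooth_form i) hy (stdVec j)).fun_mul
        (ContDiffOn.hasLineDerivAt h.isOpen (h.smooth_reeb_coord i) hy (stdVec j))
    simpa [jac] using this
  have h4 := HasDerivAt.unique h3 h2
  rw [fderiv_eq_sum]
  rw [Finset.sum_add_distrib] at h4
  simp only [sub_mul, Finset.sum_sub_distrib] at hd
  have e : ∑ i, X y i * fderiv ℝ (fun z => covec β z j) y (stdVec i) =
      ∑ i, fderiv ℝ (fun z => covec β z j) y (stdVec i) * X y i :=
    Finset.sum_congr rfl fun i _ => mul_comm _ _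
  rw [e]
  linarith

theorem lie_formSq (hy : y ∈ Ω) : LieAt X y (formSq β) 0 := by
  intro i j
  have := (ContDiffOn.hasLineDerivAt h.isOpen (h.smooth_form i) hy (X y)).fun_mul
    (ContDiffOn.hasLineDerivAt h.isOpen (h.smooth_form j) hy (X y))
  rw [h.lie_form hy, h.lie_form hy] at this
  unfold HasLineDerivAt
  simp only [formSq, vecMulVec_apply]
  refine this.congr_deriv ?_
  simp [Matrix.mul_apply, vecMulVec_apply, Fin.sum_univ_three]
  ring

theorem smooth_partial {f : E3 → ℝ} (hf : ContDiffOn ℝ ∞ f Ω) (v : E3) :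
    ContDiffOn ℝ ∞ (fun y => fderiv ℝ f y v) Ω :=
  ContDiffOn.fderiv_apply_smooth h.isOpen hf contDiffOn_const

theorem smooth_dmat : SmoothMat Ω (dmat β) := fun i j =>
  (h.smooth_partial (h.smooth_form j) _).sub (h.smooth_partial (h.smooth_form i) _)

omit h in
theorem fderiv_fderiv_comm (hΩ : IsOpen Ω) {f : E3 → ℝ} (hf : ContDiffOn ℝ ∞ f Ω) (hy : y ∈ Ω)
    (u v : E3) :
    fderiv ℝ (fun z => fderiv ℝ f z u) y v = fderiv ℝ (fun z => fderiv ℝ f z v) y u := by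
  have hc := hf.contDiffAt (hΩ.mem_nhds hy)
  have hs : IsSymmSndFDerivAt ℝ f y :=
    hc.isSymmSndFDerivAt (by norm_num [minSmoothness]; norm_cast)
  have hd : DifferentiableAt ℝ (fderiv ℝ f) y :=
    (hc.fderiv_right (m := 1) (by norm_cast)).differentiableAt (by norm_num)
  have key (u v : E3) : fderiv ℝ (fun z => fderiv ℝ f z u) y v = fderiv ℝ (fderiv ℝ f) y v u := by
    rw [(hd.hasFDerivAt.clm_apply (hasFDerivAt_const u y)).fderiv]
    simp
  rw [key, key, hs]

omit h in
theorem dmat_antisymm (i j : Fin 3) : dmat β y i j = -dmat β y j i := by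
  simp only [dmat, of_apply]; ring

/-- `L_X dα = 0`. -/
theorem lie_dmat (hy : y ∈ Ω) : LieAt X y (dmat β) 0 := by
  -- differentiate `dα(∂ᵢ, X) = 0` in the direction `∂ₖ`
  have key (i k : Fin 3) : ∑ j, (fderiv ℝ (fun z => dmat β z i j) y (stdVec k) * X y j +
      dmat β y i j * jac X y j k) = 0 := by
    have h2 : HasLineDerivAt ℝ (fun z => ∑ j, dmat β z i j * X z j) 0 y (stdVec k) :=
      hasLineDerivAt_congr (by
        filter_upwards [h.isOpen.mem_nhds hy] with z hz using h.dmat_reeb hz i)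
        (hasLineDerivAt_const 0)
    refine HasDerivAt.unique ?_ h2
    have := HasDerivAt.fun_sum (u := Finset.univ) fun j (_ : j ∈ Finset.univ) =>
      (ContDiffOn.hasLineDerivAt h.isOpen (h.smooth_dmat i j) hy (stdVec k)).fun_mul
        (ContDiffOn.hasLineDerivAt h.isOpen (h.smooth_reeb_coord j) hy (stdVec k))
    simpa [jac] using this
  -- `d(dα) = 0`
  have closed (i j k : Fin 3) : fderiv ℝ (fun z => dmat β z i j) y (stdVec k) +
      fderiv ℝ (fun z => dmat β z j k) y (stdVec i) +
      fderiv ℝ (fun z => dmat β z k i) y (stdVec j) = 0 := by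
    have e (i j k : Fin 3) : fderiv ℝ (fun z => dmat β z i j) y (stdVec k) =
        fderiv ℝ (fun z => fderiv ℝ (fun z => covec β z j) z (stdVec i)) y (stdVec k) -
        fderiv ℝ (fun z => fderiv ℝ (fun z => covec β z i) z (stdVec j)) y (stdVec k) := by
      have h1 (i j : Fin 3) : DifferentiableAt ℝ
          (fun z => fderiv ℝ (fun z => covec β z j) z (stdVec i)) y :=
        ((h.smooth_partial (h.smooth_form j) (stdVec i)).contDiffAt
          (h.isOpen.mem_nhds hy)).differentiableAt (by simp)
      simp only [dmat, of_apply]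
      rw [fderiv_fun_sub (h1 i j) (h1 j i)]
      rfl
    rw [e, e, e]
    have c (i j k : Fin 3) := fderiv_fderiv_comm h.isOpen (h.smooth_form j) hy (stdVec i) (stdVec k)
    rw [c i j k, c j k i, c k i j]
    ring
  intro i j
  have h1 := ContDiffOn.hasLineDerivAt h.isOpen (h.smooth_dmat i j) hy (X y)
  convert h1 using 1
  rw [fderiv_eq_sum]
  have k1 := key i j
  have k2 := key j i
  -- Closedness replaces the derivative along `X` by derivatives in the two slot directions, which
  -- `key` evaluates.
  have e : ∑ k, X y k * fderiv ℝ (fun z => dmat β z i j) y (stdVec k) =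
      ∑ k, X y k * (-fderiv ℝ (fun z => dmat β z j k) y (stdVec i) +
        fderiv ℝ (fun z => dmat β z i k) y (stdVec j)) := by
    refine Finset.sum_congr rfl fun k _ => ?_
    have e2 : fderiv ℝ (fun z => dmat β z i k) y (stdVec j) =
        -fderiv ℝ (fun z => dmat β z k i) y (stdVec j) := by
      rw [show (fun z => dmat β z i k) = fun z => -dmat β z k i from
        funext fun z => dmat_antisymm i k, fderiv_fun_neg]
      rfl
    rw [e2]
    linear_combination X y k * closed i j k
  rw [e]
  simp only [Matrix.sub_apply, Matrix.zero_apply, Matrix.mul_apply, transpose_apply,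
    Fin.sum_univ_three] at k1 k2 ⊢
  rw [dmat_antisymm 0 j, dmat_antisymm 1 j, dmat_antisymm 2 j]
  linear_combination k2 - k1

end LocalContactMetric

end Basics

/-! ### Kernel conditions as identities between two-tensors -/

section Pointwise

variable {G W b : Mat3} {a : Fin 3 → ℝ}

/-- The condition `b(X, ·) = 0` becomes `b g⁻¹ (α ⊗ α) = 0`. In this form `LieAt.triple` can
differentiate it. -/
theorem mul_inv_mul_vecMulVec (G b : Mat3) (a : Fin 3 → ℝ) :
    b * G⁻¹ * vecMulVec a a = vecMulVec (b *ᵥ (G⁻¹ *ᵥ a)) a := by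
  rw [mul_vecMulVec, mulVec_mulVec]

theorem Adapted.form_mul_sq (h : Adapted G W a) : W * G⁻¹ * vecMulVec a a = 0 := by
  rw [mul_inv_mul_vecMulVec, h.ker]; simp

theorem Admissible.mul_sq (hb : Admissible G W a b) : b * G⁻¹ * vecMulVec a a = 0 := by
  rw [mul_inv_mul_vecMulVec, hb.ker]; simp

theorem Adapted.sq_mul_form (h : Adapted G W a) : vecMulVec a a * G⁻¹ * W = 0 := by
  have := congrArg Matrix.transpose h.form_mul_sq
  rw [transpose_mul, transpose_mul, transpose_vecMulVec, h.inv_symm, h.skew, ← Matrix.mul_assoc,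
    Matrix.mul_neg] at this
  simpa using this

theorem Adapted.sq_mul_sq (h : Adapted G W a) :
    vecMulVec a a * G⁻¹ * vecMulVec a a = vecMulVec a a := by
  rw [mul_inv_mul_vecMulVec, vecMulVec_mulVec, h.norm]
  simp

theorem Adapted.ker_of_mul_sq (h : Adapted G W a) (hb : b * G⁻¹ * vecMulVec a a = 0) :
    b *ᵥ (G⁻¹ *ᵥ a) = 0 := by
  rw [mul_inv_mul_vecMulVec] at hb
  have h2 := vecMulVec_mulVec (b *ᵥ (G⁻¹ *ᵥ a)) a (G⁻¹ *ᵥ a)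
  rw [hb, h.norm, zero_mulVec, MulOpposite.op_one, one_smul] at h2
  exact h2.symm

theorem Admissible.smul (hb : Admissible G W a b) (c : ℝ) : Admissible G W a (c • b) :=
  ⟨by rw [transpose_smul, hb.symm], by rw [smul_mulVec, hb.ker, smul_zero], by
    simp only [Matrix.smul_mul, Matrix.mul_smul, hb.anti, smul_comm c]⟩

end Pointwise

/-! ### Admissibility of the torsion and of the Euler–Lagrange tensor -/

section Torsion

variable {Ω : Set E3} {β : E3 → E3 →L[ℝ] ℝ} {X : E3 → E3} {G : E3 → Mat3} {y : E3}

/-- The squared scalar torsion in coordinates. -/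
def torsionSq (X : E3 → E3) (G : E3 → Mat3) (y : E3) : ℝ :=
  1 / 2 * pairing (G y) (lieM X G y) (lieM X G y)

/-- The Euler–Lagrange tensor `L_X L_X g - ‖τ‖² (g - α ⊗ α)`. -/
def eulerLagrange (β : E3 → E3 →L[ℝ] ℝ) (X : E3 → E3) (G : E3 → Mat3) (y : E3) : Mat3 :=
  lieM X (lieM X G) y - torsionSq X G y • (G y - formSq β y)

namespace LocalContactMetric

variable (h : LocalContactMetric Ω β X G)
include h

theorem unit_det : ∀ z ∈ Ω, IsUnit (G z).det := fun z hz => (h.adapted z hz).isUnit_det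

theorem smooth_torsion : SmoothMat Ω (lieM X G) := h.smooth_metric.lieM h.isOpen h.smooth_reeb

theorem smooth_formSq : SmoothMat Ω (formSq β) :=
  fun i j => (h.smooth_form i).mul (h.smooth_form j)

theorem smooth_torsionSq : ContDiffOn ℝ ∞ (torsionSq X G) Ω :=
  contDiffOn_const.mul
    (SmoothMat.pairing h.smooth_metric h.unit_det h.smooth_torsion h.smooth_torsion)

theorem smooth_eulerLagrange : SmoothMat Ω (eulerLagrange β X G) :=
  (h.smooth_torsion.lieM h.isOpen h.smooth_reeb).sub
    (SmoothMat.smul h.smooth_torsionSq (h.smooth_metric.sub h.smooth_formSq))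

theorem lie_metric (hy : y ∈ Ω) : LieAt X y G (lieM X G y) := h.smooth_metric.lieAt h.isOpen hy

theorem lie_torsion (hy : y ∈ Ω) : LieAt X y (lieM X G) (lieM X (lieM X G) y) :=
  h.smooth_torsion.lieAt h.isOpen hy

theorem lie_inv (hy : y ∈ Ω) :
    LieConAt X y (fun z => (G z)⁻¹) (-((G y)⁻¹ * lieM X G y * (G y)⁻¹)) :=
  LieConAt.inv h.isOpen h.smooth_metric h.unit_det hy (h.lie_metric hy)

theorem eventually_mem (hy : y ∈ Ω) : ∀ᶠ z in 𝓝 y, z ∈ Ω := h.isOpen.mem_nhds hy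

omit h in
theorem lie_zero : LieAt X y (fun _ => (0 : Mat3)) 0 := by
  intro i j
  simpa using hasLineDerivAt_const (v := X y) (y := y) 0

/-- The Reeb flow preserves `α` and `dα`, so it moves `g` through contact metrics and `L_X g` is
tangent to them. The proof Lie-differentiates the algebraic identities that characterise a contact
metric. -/
theorem admissible_torsion (hy : y ∈ Ω) :
    Admissible (G y) (dmat β y) (covec β y) (lieM X G y) := by
  have A := h.adapted y hy
  set T := lieM X G y with hT
  set g := G y with hg
  set W := dmat β y with hW
  set N := formSq β y with hN
  have hNN : vecMulVec (covec β y) (covec β y) = N := rfl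
  have hsymm : Tᵀ = T := by
    refine LieAt.unique (LieAt.transpose (h.lie_metric hy)) ((h.lie_metric hy).congr ?_)
    filter_upwards [h.eventually_mem hy] with z hz using (h.adapted z hz).symm
  have h1 : W * -(g⁻¹ * T * g⁻¹) * N = 0 := by
    have e := LieAt.triple (h.lie_dmat hy) (h.lie_inv hy) (h.lie_formSq hy)
    have e' := e.unique (lie_zero.congr (by
      filter_upwards [h.eventually_mem hy] with z hz using (h.adapted z hz).form_mul_sq))
    simpa using e'
  have h2 : N * -(g⁻¹ * T * g⁻¹) * N = 0 := by
    have e := LieAt.triple (h.lie_formSq hy) (h.lie_inv hy) (h.lie_formSq hy)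
    have e' := e.unique ((h.lie_formSq hy).congr (by
      filter_upwards [h.eventually_mem hy] with z hz using (h.adapted z hz).sq_mul_sq))
    simpa using e'
  have h3 : W * -(g⁻¹ * T * g⁻¹) * W = -(4 : ℝ) • T := by
    have e := LieAt.triple (h.lie_dmat hy) (h.lie_inv hy) (h.lie_dmat hy)
    have e' := e.unique ((((h.lie_metric hy).sub (h.lie_formSq hy)).const_smul (-4)).congr (by
      filter_upwards [h.eventually_mem hy] with z hz using (h.adapted z hz).compat))
    simpa using e'
  -- Multiplying `h1` by `W g⁻¹` and using `compat` kills the horizontal part of `T g⁻¹ N`; `h2`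
  -- kills its part along `α`.
  have hker : T * g⁻¹ * N = 0 := by
    have e1 : W * g⁻¹ * (W * (g⁻¹ * T * g⁻¹) * N) = 0 := by
      have : W * (g⁻¹ * T * g⁻¹) * N = 0 := by simpa using h1
      rw [this, Matrix.mul_zero]
    have e2 : (W * g⁻¹ * W) * (g⁻¹ * T * g⁻¹) * N = 0 := by
      simpa only [Matrix.mul_assoc] using e1
    rw [A.compat, hNN] at e2
    have e3 : N * (g⁻¹ * T * g⁻¹) * N = 0 := by simpa using h2
    have e4 : (g - N) * (g⁻¹ * T * g⁻¹) * N = 0 := by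
      rw [Matrix.smul_mul, Matrix.smul_mul] at e2
      exact (smul_eq_zero.mp e2).resolve_left (by norm_num)
    rw [Matrix.sub_mul, Matrix.sub_mul, e3, sub_zero] at e4
    simpa only [← Matrix.mul_assoc, A.mul_inv, Matrix.one_mul] using e4
  refine ⟨hsymm, A.ker_of_mul_sq hker, ?_⟩
  have : W * (g⁻¹ * T * g⁻¹) * W = (4 : ℝ) • T := by simpa using h3
  simpa only [Matrix.mul_assoc] using this

theorem torsion_mul_self (hy : y ∈ Ω) : lieM X G y * (G y)⁻¹ * lieM X G y =
    torsionSq X G y • (G y - formSq β y) :=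
  (h.admissible_torsion hy).mul_inv_mul_self (h.adapted y hy)

/-- Differentiating the admissibility of `τ` also hits the inverse metrics, so `L_X L_X g` satisfies
the equation `anti` only up to `-8f (g - α ⊗ α)`. Subtracting `f (g - α ⊗ α)` corrects exactly this,
since that tensor has the opposite sign in `anti`. -/
theorem admissible_eulerLagrange (hy : y ∈ Ω) :
    Admissible (G y) (dmat β y) (covec β y) (eulerLagrange β X G y) := by
  have A := h.adapted y hy
  have hTT := h.torsion_mul_self hy
  have hTadm := h.admissible_torsion hy
  have hsymm : (lieM X (lieM X G) y)ᵀ = lieM X (lieM X G) y := by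
    refine LieAt.unique (LieAt.transpose (h.lie_torsion hy)) ((h.lie_torsion hy).congr ?_)
    filter_upwards [h.eventually_mem hy] with z hz using (h.admissible_torsion hz).symm
  have hker := LieAt.triple (h.lie_torsion hy) (h.lie_inv hy) (h.lie_formSq hy)
  have hker := hker.unique (lie_zero.congr (by
      filter_upwards [h.eventually_mem hy] with z hz using (h.admissible_torsion hz).mul_sq))
  have hWT : LieAt X y (fun z => dmat β z * (G z)⁻¹ * lieM X G z) _ :=
    LieAt.triple (h.lie_dmat hy) (h.lie_inv hy) (h.lie_torsion hy)
  have hanti := LieAt.triple hWT (h.lie_inv hy) (h.lie_dmat hy)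
  have hanti := hanti.unique (((h.lie_torsion hy).const_smul 4).congr (by
      filter_upwards [h.eventually_mem hy] with z hz using (h.admissible_torsion hz).anti))
  have hNN : vecMulVec (covec β y) (covec β y) = formSq β y := rfl
  have hTN := hTadm.mul_sq
  have hWN := A.form_mul_sq
  have hNW := A.sq_mul_form
  have hN := A.sq_mul_sq
  have hC := A.compat
  rw [hNN] at hTN hWN hNW hN hC
  set T' := lieM X (lieM X G) y with hT'
  set T := lieM X G y with hT
  set g := G y with hg
  set W := dmat β y with hW
  set N := formSq β y with hNdef
  set f := torsionSq X G y with hf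
  have hNsymm : Nᵀ = N := by rw [← hNN, transpose_vecMulVec]
  have hE : eulerLagrange β X G y = T' - f • (g - N) := rfl
  rw [hE]
  have k1 : T' * g⁻¹ * N = 0 := by
    have : T * (g⁻¹ * T * g⁻¹) * N = T * g⁻¹ * (T * g⁻¹ * N) := by simp only [Matrix.mul_assoc]
    rw [hTN, Matrix.mul_zero] at this
    simpa [this] using hker
  have k2 : (g - N) * g⁻¹ * N = 0 := by
    rw [Matrix.sub_mul, Matrix.sub_mul, A.mul_inv, Matrix.one_mul, hN, sub_self]
  have k3 : W * g⁻¹ * (g - N) * g⁻¹ * W = -(4 : ℝ) • (g - N) := by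
    rw [Matrix.mul_sub, hWN, sub_zero, Matrix.mul_assoc _ g⁻¹ g, A.inv_mul, Matrix.mul_one, hC]
  have k4 : W * g⁻¹ * T' * g⁻¹ * W = (4 : ℝ) • T' - (8 * f) • (g - N) := by
    -- Each of the two differentiated inverse metrics brings in `T g⁻¹ T = f (g - N)`.
    have e1 : W * (g⁻¹ * T * g⁻¹) * T * g⁻¹ * W = -(4 * f) • (g - N) := by
      calc W * (g⁻¹ * T * g⁻¹) * T * g⁻¹ * W = W * g⁻¹ * (T * g⁻¹ * T) * g⁻¹ * W := by
            simp only [Matrix.mul_assoc]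
        _ = _ := by
          rw [hTT, Matrix.mul_smul, Matrix.smul_mul, Matrix.smul_mul, k3, smul_smul]
          congr 1; ring
    have e2 : W * g⁻¹ * T * (g⁻¹ * T * g⁻¹) * W = -(4 * f) • (g - N) := by
      rw [← e1]; simp only [Matrix.mul_assoc]
    simp only [Matrix.zero_mul, zero_add, Matrix.mul_zero, add_zero, Matrix.mul_neg,
      Matrix.neg_mul, Matrix.add_mul, e1, e2] at hanti
    have e3 : W * g⁻¹ * T' * g⁻¹ * W = (4 : ℝ) • T' + -(4 * f) • (g - N) + -(4 * f) • (g - N) := by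
      rw [← hanti]; abel
    rw [e3]; module
  refine ⟨?_, A.ker_of_mul_sq ?_, ?_⟩
  · rw [transpose_sub, transpose_smul, transpose_sub, hsymm, A.symm, hNsymm]
  · rw [hNN, Matrix.sub_mul, Matrix.sub_mul, k1, Matrix.smul_mul, Matrix.smul_mul, k2]; simp
  · rw [Matrix.mul_sub, Matrix.sub_mul, Matrix.sub_mul, Matrix.mul_smul, Matrix.smul_mul,
      Matrix.smul_mul, k4, k3]
    module

end LocalContactMetric

end Torsion

/-! ### The second Reeb derivative of `|d‖τ‖²|²` -/

section MaximumPrinciple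

variable {Ω : Set E3} {β : E3 → E3 →L[ℝ] ℝ} {X : E3 → E3} {G : E3 → Mat3} {y : E3}

/-- The differential of a function in components. -/
def grad (f : E3 → ℝ) (y : E3) : Fin 3 → ℝ := fun i => fderiv ℝ f y (stdVec i)

/-- The square of the differential of a function. -/
def gradMat (f : E3 → ℝ) (y : E3) : Mat3 := vecMulVec (grad f y) (grad f y)

/-- The squared norm of the differential of a function. -/
def gradSq (G : E3 → Mat3) (f : E3 → ℝ) (y : E3) : ℝ := ((G y)⁻¹ * gradMat f y).trace

theorem gradSq_eq (G : E3 → Mat3) (f : E3 → ℝ) (y : E3) :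
    gradSq G f y = grad f y ⬝ᵥ ((G y)⁻¹ *ᵥ grad f y) := by
  rw [gradSq, gradMat, mul_vecMulVec, trace_vecMulVec, dotProduct_comm]

theorem Adapted.dotProduct_inv {g W : Mat3} {a : Fin 3 → ℝ} (h : Adapted g W a) (v : Fin 3 → ℝ) :
    v ⬝ᵥ g⁻¹ *ᵥ v = (g⁻¹ *ᵥ v) ⬝ᵥ g *ᵥ (g⁻¹ *ᵥ v) := by
  rw [mulVec_mulVec, h.mul_inv, one_mulVec, dotProduct_comm]

theorem Adapted.dotProduct_inv_nonneg {g W : Mat3} {a : Fin 3 → ℝ} (h : Adapted g W a)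
    (v : Fin 3 → ℝ) : 0 ≤ v ⬝ᵥ g⁻¹ *ᵥ v := by
  rw [h.dotProduct_inv]
  by_cases h0 : g⁻¹ *ᵥ v = 0
  · simp [h0]
  · exact (h.pos _ h0).le

theorem Adapted.eq_zero_of_dotProduct_inv {g W : Mat3} {a : Fin 3 → ℝ} (h : Adapted g W a)
    {v : Fin 3 → ℝ} (h0 : v ⬝ᵥ g⁻¹ *ᵥ v = 0) : v = 0 := by
  rw [h.dotProduct_inv] at h0
  have : g⁻¹ *ᵥ v = 0 := by
    by_contra hne
    exact (h.pos _ hne).ne' h0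
  rw [← one_mulVec v, ← h.mul_inv, ← mulVec_mulVec, this, mulVec_zero]

/-- If `c` were positive, the second derivative test would make `0` a local minimum too. Then `u`
would be locally constant and `c` would be zero. -/
theorem second_deriv_nonpos {u : ℝ → ℝ} {u' : ℝ → ℝ} {c : ℝ} (hu : ∀ᶠ t in 𝓝 0, HasDerivAt u (u' t) t)
    (hu' : HasDerivAt u' c 0) (hmax : IsLocalMax u 0) : c ≤ 0 := by
  by_contra! hc
  have h0 : u' 0 = 0 := hmax.hasDerivAt_eq_zero hu.self_of_nhds
  have hd : deriv u =ᶠ[𝓝 0] u' := hu.mono fun t ht => ht.deriv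
  have hmin : IsLocalMin u 0 := by
    apply isLocalMin_of_deriv_deriv_pos
    · rw [hd.deriv_eq, hu'.deriv]; exact hc
    · rw [hd.self_of_nhds, h0]
    · exact hu.self_of_nhds.continuousAt
  have hconst : u =ᶠ[𝓝 0] fun _ => u 0 := by
    filter_upwards [hmax, hmin] with t h1 h2 using le_antisymm h1 h2
  have h1 : ∀ᶠ t in 𝓝 (0 : ℝ), u =ᶠ[𝓝 t] fun _ => u 0 := hconst.eventually_nhds
  have h2 : u' =ᶠ[𝓝 0] fun _ => 0 := by
    filter_upwards [hu, h1] with t h3 h4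
    rw [← h3.deriv, h4.deriv_eq, deriv_const]
  have := hu'.unique ((hasDerivAt_const (0 : ℝ) (0 : ℝ)).congr_of_eventuallyEq h2)
  linarith

/-- The differential of `u` vanishes at the maximum, so the derivative of `X` does not contribute.
What remains is the Hessian along a straight line. -/
theorem second_lineDeriv_nonpos (hΩ : IsOpen Ω) (hX : ContDiffOn ℝ ∞ X Ω) {u : E3 → ℝ}
    (hu : ContDiffOn ℝ ∞ u Ω) (hy : y ∈ Ω) (hmax : IsLocalMax u y) :
    fderiv ℝ (fun z => fderiv ℝ u z (X z)) y (X y) ≤ 0 := by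
  have hc := hu.contDiffAt (hΩ.mem_nhds hy)
  have hXd : DifferentiableAt ℝ X y := (hX.contDiffAt (hΩ.mem_nhds hy)).differentiableAt (by simp)
  have hd : DifferentiableAt ℝ (fderiv ℝ u) y :=
    (hc.fderiv_right (m := 1) (by norm_cast)).differentiableAt (by norm_num)
  have h0 : fderiv ℝ u y = 0 := hmax.fderiv_eq_zero
  have e : fderiv ℝ (fun z => fderiv ℝ u z (X z)) y (X y) =
      fderiv ℝ (fderiv ℝ u) y (X y) (X y) := by
    rw [(hd.hasFDerivAt.clm_apply hXd.hasFDerivAt).fderiv]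
    simp [h0]
  rw [e]
  set v := X y
  have hl : HasDerivAt (fun t : ℝ => y + t • v) v 0 := by
    simpa using ((hasDerivAt_id (0 : ℝ)).smul_const v).const_add y
  have hcont : ContinuousAt (fun t : ℝ => y + t • v) 0 := hl.continuousAt
  have hy0 : y + (0 : ℝ) • v = y := by simp
  have hmem : ∀ᶠ t : ℝ in 𝓝 0, y + t • v ∈ Ω :=
    hcont.eventually (p := fun z => z ∈ Ω) (by simp only [hy0]; exact hΩ.mem_nhds hy)
  refine second_deriv_nonpos (u := fun t => u (y + t • v)) (u' := fun t => fderiv ℝ u (y + t • v) v)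
    ?_ ?_ ?_
  · filter_upwards [hmem] with t ht
    have h1 := ((hu.contDiffAt (hΩ.mem_nhds ht)).differentiableAt (by simp)).hasFDerivAt
    have h2 : HasDerivAt (fun t : ℝ => y + t • v) v t := by
      simpa using ((hasDerivAt_id t).smul_const v).const_add y
    exact h1.comp_hasDerivAt t h2
  · have h1 : HasFDerivAt (fun z => fderiv ℝ u z v)
        ((fderiv ℝ (fderiv ℝ u) y).flip v) (y + (0 : ℝ) • v) := by
      rw [hy0]
      have := hd.hasFDerivAt.clm_apply (hasFDerivAt_const v y)
      rwa [ContinuousLinearMap.comp_zero, zero_add] at this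
    exact h1.comp_hasDerivAt (0 : ℝ) hl
  · have h1 : ∀ᶠ z in 𝓝 (y + (0 : ℝ) • v), u z ≤ u y := by rw [hy0]; exact hmax
    have := hcont.eventually (p := fun z => u z ≤ u y) h1
    filter_upwards [this] with t ht
    simpa using ht

namespace LocalContactMetric

variable (h : LocalContactMetric Ω β X G)
include h

/-- Raising both indices adds `-2 τ g⁻¹ τ = -2f (g - α ⊗ α)`, which turns the coefficient `+f` in
`L_X τ` into `-f`. This sign is what makes the maximum principle work. -/
theorem lie_dualTorsion (hy : y ∈ Ω) :
    LieConAt X y (fun z => (G z)⁻¹ * lieM X G z * (G z)⁻¹)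
      ((G y)⁻¹ * (eulerLagrange β X G y - torsionSq X G y • (G y - formSq β y)) * (G y)⁻¹) := by
  have e := LieConAt.triple (h.lie_inv hy) (h.lie_torsion hy) (h.lie_inv hy)
  have hTT := h.torsion_mul_self hy
  convert e using 1
  rw [eulerLagrange]
  set T := lieM X G y
  set g := G y
  have e1 : g⁻¹ * T * (g⁻¹ * T * g⁻¹) = g⁻¹ * (T * g⁻¹ * T) * g⁻¹ := by simp only [Matrix.mul_assoc]
  have e2 : g⁻¹ * T * g⁻¹ * T * g⁻¹ = g⁻¹ * (T * g⁻¹ * T) * g⁻¹ := by simp only [Matrix.mul_assoc]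
  rw [Matrix.neg_mul, Matrix.neg_mul, Matrix.mul_neg, e1, e2, hTT]
  simp only [Matrix.mul_sub, Matrix.sub_mul, Matrix.mul_smul, Matrix.smul_mul]
  module

variable (hEL : ∀ z ∈ Ω, eulerLagrange β X G z = 0)
include hEL

/-- When `E = 0`, the torsion has Lie derivative `f (g - α ⊗ α)` and its dual has minus the dual of
that. The two contributions to the derivative of the trace cancel. -/
theorem reeb_torsionSq (hy : y ∈ Ω) : fderiv ℝ (torsionSq X G) y (X y) = 0 := by
  have h1 := ContDiffOn.hasLineDerivAt h.isOpen h.smooth_torsionSq hy (X y)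
  have h2 := LieConAt.trace (h.lie_dualTorsion hy) (h.lie_torsion hy)
  have h3 := HasDerivAt.const_mul (1 / 2 : ℝ) h2
  have hfun : torsionSq X G = fun z =>
      1 / 2 * ((G z)⁻¹ * lieM X G z * (G z)⁻¹ * lieM X G z).trace := by
    ext z
    rw [torsionSq, pairing]
    simp only [Matrix.mul_assoc]
  have h4 := HasDerivAt.unique h1 (by rw [hfun]; exact h3)
  rw [h4, hEL y hy]
  have hE : lieM X (lieM X G) y = torsionSq X G y • (G y - formSq β y) := by
    have := hEL y hy
    rwa [eulerLagrange, sub_eq_zero] at this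
  rw [hE]
  set T := lieM X G y
  set g := G y
  set N := formSq β y
  have e : (g⁻¹ * (g - N) * g⁻¹ * T).trace = (g⁻¹ * T * g⁻¹ * (g - N)).trace := by
    rw [Matrix.mul_assoc, trace_mul_comm, ← Matrix.mul_assoc]
  simp only [zero_sub, Matrix.mul_neg, Matrix.neg_mul, Matrix.mul_smul, Matrix.smul_mul, trace_add,
    trace_neg, trace_smul, e]
  simp

theorem sum_grad_reeb (hy : y ∈ Ω) : ∑ i, grad (torsionSq X G) y i * X y i = 0 := by
  have := h.reeb_torsionSq hEL hy
  rw [fderiv_eq_sum] at this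
  rw [← this]
  exact Finset.sum_congr rfl fun i _ => mul_comm _ _

omit hEL in
theorem smooth_grad (i : Fin 3) : ContDiffOn ℝ ∞ (fun y => grad (torsionSq X G) y i) Ω :=
  h.smooth_partial h.smooth_torsionSq _

/-- The reason is `L_X df = d(X f) = 0`. -/
theorem lie_gradMat (hy : y ∈ Ω) : LieAt X y (gradMat (torsionSq X G)) 0 := by
  set f := torsionSq X G with hf
  have key (j : Fin 3) : fderiv ℝ (fun z => grad f z j) y (X y) = -∑ i, grad f y i * jac X y i j := by
    have h2 : HasLineDerivAt ℝ (fun z => ∑ i, grad f z i * X z i) 0 y (stdVec j) :=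
      hasLineDerivAt_congr (by
        filter_upwards [h.eventually_mem hy] with z hz using h.sum_grad_reeb hEL hz)
        (hasLineDerivAt_const 0)
    have h3 := HasDerivAt.fun_sum (u := Finset.univ) fun i (_ : i ∈ Finset.univ) =>
      (ContDiffOn.hasLineDerivAt h.isOpen (h.smooth_grad i) hy (stdVec j)).fun_mul
        (ContDiffOn.hasLineDerivAt h.isOpen (h.smooth_reeb_coord i) hy (stdVec j))
    have h4 := HasDerivAt.unique h3 h2
    simp only [zero_smul, add_zero] at h4
    rw [Finset.sum_add_distrib] at h4
    rw [fderiv_eq_sum, eq_neg_iff_add_eq_zero, ← h4]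
    congr 1
    refine Finset.sum_congr rfl fun i _ => ?_
    rw [mul_comm]
    congr 1
    exact fderiv_fderiv_comm h.isOpen h.smooth_torsionSq hy _ _
  intro i j
  have := (ContDiffOn.hasLineDerivAt h.isOpen (h.smooth_grad i) hy (X y)).fun_mul
    (ContDiffOn.hasLineDerivAt h.isOpen (h.smooth_grad j) hy (X y))
  rw [← hf, key, key] at this
  unfold HasLineDerivAt
  simp only [gradMat, vecMulVec_apply]
  refine this.congr_deriv ?_
  simp [Matrix.mul_apply, vecMulVec_apply, Fin.sum_univ_three]
  ring

omit hEL in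
theorem smooth_gradMat : SmoothMat Ω (gradMat (torsionSq X G)) :=
  fun i j => (h.smooth_grad i).mul (h.smooth_grad j)

omit hEL in
theorem smooth_gradSq : ContDiffOn ℝ ∞ (gradSq G (torsionSq X G)) Ω :=
  ((h.smooth_metric.inv h.unit_det).mul (h.smooth_gradMat)).trace

theorem reeb_gradSq (hy : y ∈ Ω) : fderiv ℝ (gradSq G (torsionSq X G)) y (X y) =
    -((G y)⁻¹ * lieM X G y * (G y)⁻¹ * gradMat (torsionSq X G) y).trace := by
  have h1 := ContDiffOn.hasLineDerivAt h.isOpen (h.smooth_gradSq) hy (X y)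
  have h2 := LieConAt.trace (h.lie_inv hy) (h.lie_gradMat hEL hy)
  rw [HasDerivAt.unique h1 h2]
  simp

/-- As `df` is invariant, only the inverse metric varies: its first Lie derivative is minus the dual
torsion, its second is `f` times the horizontal part of `g⁻¹`. The missing part along `X` does not
matter because `df(X) = 0`. -/
theorem reeb_reeb_gradSq (hy : y ∈ Ω) :
    fderiv ℝ (fun z => fderiv ℝ (gradSq G (torsionSq X G)) z (X z)) y (X y) =
      torsionSq X G y * gradSq G (torsionSq X G) y := by
  have h1 := ContDiffOn.hasLineDerivAt h.isOpen
    (ContDiffOn.fderiv_apply_smooth h.isOpen (h.smooth_gradSq) h.smooth_reeb) hy (X y)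
  have hd := h.lie_dualTorsion hy
  rw [hEL y hy] at hd
  have h2 := LieConAt.trace hd (h.lie_gradMat hEL hy)
  have h3 := hasLineDerivAt_congr (v := X y)
    (f := fun z => -fderiv ℝ (gradSq G (torsionSq X G)) z (X z)) (by
      filter_upwards [h.eventually_mem hy] with z hz
      rw [h.reeb_gradSq hEL hz, neg_neg]) h2
  have h4 := HasDerivAt.unique h3 (HasDerivAt.fun_neg h1)
  rw [eq_comm, neg_eq_iff_eq_neg] at h4
  rw [h4]
  have hN : ((G y)⁻¹ * formSq β y * (G y)⁻¹ * gradMat (torsionSq X G) y).trace = 0 := by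
    have hXg : grad (torsionSq X G) y ⬝ᵥ ((G y)⁻¹ *ᵥ covec β y) = 0 := by
      rw [← h.reeb_fun hy]
      exact h.sum_grad_reeb hEL hy
    have e : formSq β y * (G y)⁻¹ * gradMat (torsionSq X G) y = 0 := by
      have h5 : (covec β y ᵥ* (G y)⁻¹) ⬝ᵥ grad (torsionSq X G) y = 0 := by
        rw [← hXg, ← mulVec_transpose, (h.adapted y hy).inv_symm, dotProduct_comm]
      rw [formSq, gradMat, vecMulVec_mul, vecMulVec_mul_vecMulVec, h5, zero_smul, vecMulVec_zero]
    rw [Matrix.mul_assoc, Matrix.mul_assoc, ← Matrix.mul_assoc (formSq β y), e]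
    simp
  have hI := (h.adapted y hy).inv_mul
  simp only [zero_sub, Matrix.mul_neg, Matrix.neg_mul, Matrix.mul_smul, Matrix.smul_mul,
    Matrix.mul_zero, add_zero, trace_neg, trace_smul, Matrix.mul_sub, Matrix.sub_mul, trace_sub, hN,
    hI, Matrix.one_mul]
  simp [gradSq]

/-- At a local maximum of `|d‖τ‖²|²`, either the torsion or its differential vanishes. -/
theorem torsionSq_mul_gradSq_nonpos (hy : y ∈ Ω)
    (hmax : IsLocalMax (gradSq G (torsionSq X G)) y) :
    torsionSq X G y * gradSq G (torsionSq X G) y ≤ 0 := by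
  rw [← h.reeb_reeb_gradSq hEL hy]
  exact second_lineDeriv_nonpos h.isOpen h.smooth_reeb (h.smooth_gradSq) hy hmax

end LocalContactMetric

end MaximumPrinciple

/-! ### Derivatives of curves of matrices -/

section CurveDerivative

/-- The entrywise derivative of a curve of matrices. -/
def CurveDer (A : ℝ → Mat3) (A' : Mat3) (t : ℝ) : Prop :=
  ∀ i j, HasDerivAt (fun t => A t i j) (A' i j) t

variable {A B : ℝ → Mat3} {A' B' : Mat3} {t : ℝ}

theorem CurveDer.mul (hA : CurveDer A A' t) (hB : CurveDer B B' t) :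
    CurveDer (fun t => A t * B t) (A' * B t + A t * B') t := by
  intro i j
  have := HasDerivAt.fun_sum (u := Finset.univ) fun k _ => (hA i k).fun_mul (hB k j)
  simp only [Matrix.add_apply, Matrix.mul_apply]
  refine this.congr_deriv ?_
  simp [Finset.sum_add_distrib]

theorem CurveDer.add (hA : CurveDer A A' t) (hB : CurveDer B B' t) :
    CurveDer (fun t => A t + B t) (A' + B') t := fun i j => (hA i j).fun_add (hB i j)

theorem CurveDer.const (C : Mat3) : CurveDer (fun _ => C) 0 t := fun _ _ => hasDerivAt_const _ _

theorem CurveDer.smul_const {s : ℝ → ℝ} {s' : ℝ} (hs : HasDerivAt s s' t) (C : Mat3) :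
    CurveDer (fun t => s t • C) (s' • C) t := fun i j => hs.mul_const (C i j)

theorem CurveDer.trace (hA : CurveDer A A' t) :
    HasDerivAt (fun t => (A t).trace) A'.trace t := by
  simp only [Matrix.trace, diag_apply]
  exact HasDerivAt.fun_sum fun k _ => hA k k

end CurveDerivative

theorem Adapted.det_pos {g W : Mat3} {a : Fin 3 → ℝ} (h : Adapted g W a) : 0 < g.det := by
  obtain ⟨P, Q, f⟩ := h.exists_frame
  have h0 := h.isUnit_det.ne_zero
  rw [f.metric, det_mul, det_transpose] at h0 ⊢
  have : Q.det ≠ 0 := fun hz => h0 (by rw [hz, mul_zero])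
  exact mul_self_pos.mpr this

/-! ### Deformations in an admissible direction and their torsion -/

section Deformation

variable {Ω : Set E3} {β : E3 → E3 →L[ℝ] ℝ} {X : E3 → E3} {G b : E3 → Mat3} {y : E3}

/-- The Riemannian volume density. -/
def density (G : E3 → Mat3) (y : E3) : ℝ := Real.sqrt (G y).det

/-- The squared norm of a bilinear form, with the normalisation of the scalar torsion. -/
def halfNormSq (G b : E3 → Mat3) (y : E3) : ℝ := 1 / 2 * pairing (G y) (b y) (b y)

/-- The conformal factor of a deformation on the contact planes. -/
def defScale (G b : E3 → Mat3) (t : ℝ) (y : E3) : ℝ := Real.sqrt (1 + t * t * halfNormSq G b y)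

/-- The deformation of the contact metric `G` in the direction `b`. -/
def defMetric (β : E3 → E3 →L[ℝ] ℝ) (G b : E3 → Mat3) (t : ℝ) (y : E3) : Mat3 :=
  deform (G y) (b y) (covec β y) (defScale G b t y) t

theorem defMetric_zero : defMetric β G b 0 y = G y := by
  simp [defMetric, deform, defScale]

/-- The inverse of the deformed metric. -/
def defInv (β : E3 → E3 →L[ℝ] ℝ) (G b : E3 → Mat3) (t : ℝ) (y : E3) : Mat3 :=
  (G y)⁻¹ * deform (G y) (b y) (covec β y) (defScale G b t y) (-t) * (G y)⁻¹

/-- The torsion of the deformed metric. -/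
def defTorsion (β : E3 → E3 →L[ℝ] ℝ) (X : E3 → E3) (G b : E3 → Mat3) (t : ℝ) (y : E3) : Mat3 :=
  (t * t * fderiv ℝ (halfNormSq G b) y (X y) / (2 * defScale G b t y)) • (G y - formSq β y) +
    defScale G b t y • lieM X G y + t • lieM X b y

namespace LocalContactMetric

theorem smooth_density (h : LocalContactMetric Ω β X G) : ContDiffOn ℝ ∞ (density G) Ω :=
  h.smooth_metric.det.sqrt fun y hy => (h.adapted y hy).det_pos.ne'

/-- The formula says `div(ρ X) = 0`. By `Adapted.det_eq` the density is the square root of `det(dα /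
2 + α ⊗ α)`, and this tensor has zero Lie derivative; Jacobi's formula leaves only the trace of the
Jacobian. -/
theorem lie_density (h : LocalContactMetric Ω β X G) (hy : y ∈ Ω) :
    HasLineDerivAt ℝ (density G) (-(density G y * (jac X y).trace)) y (X y) := by
  set K : E3 → Mat3 := fun z => (1 / 2 : ℝ) • dmat β z + formSq β z with hK
  have h1 : LieAt X y K 0 := by
    have := ((h.lie_dmat hy).const_smul (1 / 2)).add (h.lie_formSq hy)
    rw [smul_zero, add_zero] at this
    exact this
  have h2 := MatDer.det h1
  have h3 : HasLineDerivAt ℝ (fun z => (G z).det) _ y (X y) :=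
    hasLineDerivAt_congr (by
      filter_upwards [h.eventually_mem hy] with z hz using (h.adapted z hz).det_eq) h2
  have hpos := (h.adapted y hy).det_pos
  have hdet : (G y).det = (K y).det := (h.adapted y hy).det_eq
  have h4 := HasDerivAt.sqrt h3 (by simpa using hpos.ne')
  refine HasDerivAt.congr_deriv h4 ?_
  simp only [zero_smul, add_zero]
  have e : ((K y).adjugate * (0 - K y * jac X y - (jac X y)ᵀ * K y)).trace =
      -(2 * (G y).det * (jac X y).trace) := by
    rw [zero_sub, sub_eq_add_neg, Matrix.mul_add, Matrix.mul_neg, Matrix.mul_neg, trace_add,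
      trace_neg, trace_neg, ← Matrix.mul_assoc, adjugate_mul, trace_mul_comm _ ((jac X y)ᵀ * K y),
      Matrix.mul_assoc, mul_adjugate, Matrix.smul_mul, Matrix.mul_smul, trace_smul, trace_smul,
      Matrix.one_mul, Matrix.mul_one, trace_transpose, hdet]
    simp only [smul_eq_mul]
    ring
  rw [e, density]
  have hs : Real.sqrt (G y).det * Real.sqrt (G y).det = (G y).det := Real.mul_self_sqrt hpos.le
  have hs0 : Real.sqrt (G y).det ≠ 0 := (Real.sqrt_pos.mpr hpos).ne'
  field_simp
  rw [pow_two, hs]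
  ring

variable (h : LocalContactMetric Ω β X G) (hb : SmoothMat Ω b)
  (hadm : ∀ y ∈ Ω, Admissible (G y) (dmat β y) (covec β y) (b y))

include h hb in
theorem smooth_halfNormSq : ContDiffOn ℝ ∞ (halfNormSq G b) Ω :=
  contDiffOn_const.mul (SmoothMat.pairing h.smooth_metric h.unit_det hb hb)

include h hadm in
theorem halfNormSq_nonneg (hy : y ∈ Ω) : 0 ≤ halfNormSq G b y :=
  mul_nonneg (by norm_num) ((hadm y hy).pairing_nonneg (h.adapted y hy))

include h hadm in
theorem one_add_pos (t : ℝ) (hy : y ∈ Ω) : 0 < 1 + t * t * halfNormSq G b y := by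
  have := h.halfNormSq_nonneg hadm hy
  have := mul_nonneg (mul_self_nonneg t) this
  linarith

include h hadm in
theorem defScale_pos (t : ℝ) (hy : y ∈ Ω) : 0 < defScale G b t y :=
  Real.sqrt_pos.mpr (h.one_add_pos hadm t hy)

include h hadm in
theorem defScale_mul_self (t : ℝ) (hy : y ∈ Ω) : defScale G b t y * defScale G b t y =
    1 + t * t * (1 / 2 * pairing (G y) (b y) (b y)) :=
  Real.mul_self_sqrt (h.one_add_pos hadm t hy).le

/-- The open set `ℝ × Ω`. -/
abbrev prodSet (Ω : Set E3) : Set (ℝ × E3) := univ ×ˢ Ω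

omit h hb hadm in
theorem mapsTo_snd : MapsTo (fun r : ℝ × E3 => r.2) (prodSet Ω) Ω := fun _ hr => hr.2

include h hb hadm in
theorem smooth_defScale : ContDiffOn ℝ ∞ (fun r : ℝ × E3 => defScale G b r.1 r.2) (prodSet Ω) := by
  refine ContDiffOn.sqrt ?_ fun r hr => (h.one_add_pos hadm r.1 hr.2).ne'
  exact contDiffOn_const.add ((contDiffOn_fst.mul contDiffOn_fst).mul
    ((h.smooth_halfNormSq hb).comp contDiffOn_snd mapsTo_snd))

omit h hb hadm in
theorem smooth_snd {B : E3 → Mat3} (hB : SmoothMat Ω B) :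
    SmoothMat (prodSet Ω) (fun r : ℝ × E3 => B r.2) := hB.comp contDiffOn_snd mapsTo_snd

include h hb hadm in
theorem smooth_deform {τ : ℝ × E3 → ℝ} (hτ : ContDiffOn ℝ ∞ τ (prodSet Ω)) :
    SmoothMat (prodSet Ω) (fun r : ℝ × E3 =>
      deform (G r.2) (b r.2) (covec β r.2) (defScale G b r.1 r.2) (τ r)) :=
  ((smooth_snd h.smooth_formSq).add (SmoothMat.smul (h.smooth_defScale hb hadm)
    ((smooth_snd h.smooth_metric).sub (smooth_snd h.smooth_formSq)))).add
    (SmoothMat.smul hτ (smooth_snd hb))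

include h hb hadm in
theorem smooth_defMetric : SmoothMat (prodSet Ω) (fun r : ℝ × E3 => defMetric β G b r.1 r.2) :=
  h.smooth_deform hb hadm contDiffOn_fst

include h hb hadm in
theorem smooth_defInv : SmoothMat (prodSet Ω) (fun r : ℝ × E3 => defInv β G b r.1 r.2) :=
  have hi := smooth_snd (h.smooth_metric.inv h.unit_det)
  (hi.mul (h.smooth_deform hb hadm contDiffOn_fst.neg)).mul hi

include h hb hadm in
theorem smooth_defTorsion : SmoothMat (prodSet Ω) (fun r : ℝ × E3 => defTorsion β X G b r.1 r.2) := by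
  have hs := h.smooth_defScale hb hadm
  refine ((SmoothMat.smul ?_ ((smooth_snd h.smooth_metric).sub (smooth_snd h.smooth_formSq))).add
    (SmoothMat.smul hs (smooth_snd h.smooth_torsion))).add
    (SmoothMat.smul contDiffOn_fst (smooth_snd (hb.lieM h.isOpen h.smooth_reeb)))
  refine ((contDiffOn_fst.mul contDiffOn_fst).mul ?_).div (contDiffOn_const.mul hs) fun r hr =>
    mul_ne_zero two_ne_zero (h.defScale_pos hadm r.1 hr.2).ne'
  exact (ContDiffOn.fderiv_apply_smooth h.isOpen (h.smooth_halfNormSq hb) h.smooth_reeb).comp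
    contDiffOn_snd mapsTo_snd

include h hb hadm in
theorem smooth_defMetric_slice (t : ℝ) : SmoothMat Ω (defMetric β G b t) :=
  (h.smooth_defMetric hb hadm).comp (φ := fun y => (t, y))
    (contDiffOn_const.prodMk contDiffOn_id) fun _ hy => ⟨mem_univ _, hy⟩

include h hb hadm in
/-- The deformation consists of contact metrics. -/
theorem deformation (t : ℝ) : LocalContactMetric Ω β X (defMetric β G b t) where
  isOpen := h.isOpen
  smooth_form := h.smooth_form
  smooth_reeb := h.smooth_reeb
  smooth_metric := h.smooth_defMetric_slice hb hadm t
  adapted y hy := (h.adapted y hy).deform (hadm y hy) (h.defScale_pos hadm t hy)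
    (h.defScale_mul_self hadm t hy)
  reeb y hy i := by
    have A := h.adapted y hy
    rw [h.reeb y hy i, defMetric, A.deform_inv (hadm y hy) (h.defScale_mul_self hadm t hy),
      ← mulVec_mulVec, ← mulVec_mulVec]
    have e : deform (G y) (b y) (covec β y) (defScale G b t y) (-t) *ᵥ ((G y)⁻¹ *ᵥ covec β y) =
        covec β y := by
      have h1 : G y *ᵥ ((G y)⁻¹ *ᵥ covec β y) = covec β y := by
        rw [mulVec_mulVec, A.mul_inv, one_mulVec]
      have h2 : vecMulVec (covec β y) (covec β y) *ᵥ ((G y)⁻¹ *ᵥ covec β y) = covec β y := by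
        rw [vecMulVec_mulVec, A.norm]; simp
      rw [deform, add_mulVec, add_mulVec, smul_mulVec, smul_mulVec, sub_mulVec, h1, h2,
        (hadm y hy).ker]
      simp
    rw [e]

include h hb hadm in
theorem lieM_defMetric (t : ℝ) (hy : y ∈ Ω) :
    lieM X (defMetric β G b t) y = defTorsion β X G b t y := by
  have hκ := ContDiffOn.hasLineDerivAt h.isOpen (h.smooth_halfNormSq hb) hy (X y)
  have hpos := h.one_add_pos hadm t hy
  have hs : HasLineDerivAt ℝ (defScale G b t)
      (t * t * fderiv ℝ (halfNormSq G b) y (X y) / (2 * defScale G b t y)) y (X y) := by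
    have := HasDerivAt.sqrt ((HasDerivAt.const_mul (t * t) hκ).const_add 1)
      (by simpa using hpos.ne')
    simpa [defScale, HasLineDerivAt] using this
  have h1 := ((h.lie_formSq hy).add (LieAt.smul hs ((h.lie_metric hy).sub (h.lie_formSq hy)))).add
    ((hb.lieAt h.isOpen hy (X := X)).const_smul t)
  have h2 := LieAt.unique ((h.smooth_defMetric_slice hb hadm t).lieAt h.isOpen hy (X := X)) h1
  rw [h2, defTorsion]
  simp

include h hb hadm in
theorem torsionSq_defMetric (t : ℝ) (hy : y ∈ Ω) : torsionSq X (defMetric β G b t) y =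
    1 / 2 * (defInv β G b t y * defTorsion β X G b t y *
      (defInv β G b t y * defTorsion β X G b t y)).trace := by
  rw [torsionSq, h.lieM_defMetric hb hadm t hy, pairing, defMetric,
    (h.adapted y hy).deform_inv (hadm y hy) (h.defScale_mul_self hadm t hy)]
  rfl

include h hb hadm in
theorem smooth_torsionSq_defMetric :
    ContDiffOn ℝ ∞ (fun r : ℝ × E3 => torsionSq X (defMetric β G b r.1) r.2) (prodSet Ω) := by
  have hm := (h.smooth_defInv hb hadm).mul (h.smooth_defTorsion hb hadm)
  exact (contDiffOn_const.mul (hm.mul hm).trace).congr fun r hr =>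
    h.torsionSq_defMetric hb hadm r.1 hr.2

include h hb hadm in
/-- The first variation of the squared scalar torsion. -/
theorem hasDerivAt_torsionSq (hy : y ∈ Ω) :
    HasDerivAt (fun t => torsionSq X (defMetric β G b t) y)
      (pairing (G y) (lieM X G y) (lieM X b y)) 0 := by
  have A := h.adapted y hy
  have hs0 : defScale G b 0 y = 1 := by simp [defScale]
  -- The scale is `1 + O(t²)`, so it does not contribute to the first variation.
  have hs : HasDerivAt (fun t => defScale G b t y) 0 0 := by
    have h1 : HasDerivAt (fun t : ℝ => 1 + t * t * halfNormSq G b y) 0 0 := by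
      have := (((hasDerivAt_id (0 : ℝ)).mul (hasDerivAt_id 0)).mul_const
        (halfNormSq G b y)).const_add 1
      simpa using this
    have := h1.sqrt (by simp)
    simpa [defScale] using this
  have hσ : HasDerivAt (fun t => t * t * fderiv ℝ (halfNormSq G b) y (X y) /
      (2 * defScale G b t y)) 0 0 := by
    have h1 : HasDerivAt (fun t : ℝ => t * t * fderiv ℝ (halfNormSq G b) y (X y)) 0 0 := by
      have := ((hasDerivAt_id (0 : ℝ)).mul (hasDerivAt_id 0)).mul_const
        (fderiv ℝ (halfNormSq G b) y (X y))
      simpa using this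
    have := h1.fun_div (hs.const_mul 2) (by rw [hs0]; norm_num)
    simpa using this
  have hI : CurveDer (fun t => defInv β G b t y) (-((G y)⁻¹ * b y * (G y)⁻¹)) 0 := by
    have h1 : CurveDer (fun t => deform (G y) (b y) (covec β y) (defScale G b t y) (-t)) (-b y) 0 := by
      have := ((CurveDer.const (t := 0) (vecMulVec (covec β y) (covec β y))).add
        (CurveDer.smul_const hs (G y - vecMulVec (covec β y) (covec β y)))).add
        (CurveDer.smul_const (hasDerivAt_neg (0 : ℝ)) (b y))
      simpa [deform] using this
    have := ((CurveDer.const (t := 0) (G y)⁻¹).mul h1).mul (CurveDer.const (G y)⁻¹)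
    simpa [defInv] using this
  have hT : CurveDer (fun t => defTorsion β X G b t y) (lieM X b y) 0 := by
    have := ((CurveDer.smul_const hσ (G y - formSq β y)).add
      (CurveDer.smul_const hs (lieM X G y))).add
      (CurveDer.smul_const (hasDerivAt_id (0 : ℝ)) (lieM X b y))
    simpa [defTorsion] using this
  have h1 := ((hI.mul hT).mul (hI.mul hT)).trace.const_mul (1 / 2)
  have hI0 : defInv β G b 0 y = (G y)⁻¹ := by
    have := A.inv_mul
    simp [defInv, deform, hs0, this]
  have hT0 : defTorsion β X G b 0 y = lieM X G y := by simp [defTorsion, hs0]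
  have h2 : (fun t => torsionSq X (defMetric β G b t) y) = fun t =>
      1 / 2 * (defInv β G b t y * defTorsion β X G b t y *
      (defInv β G b t y * defTorsion β X G b t y)).trace :=
    funext fun t => h.torsionSq_defMetric hb hadm t hy
  rw [h2]
  refine h1.congr_deriv ?_
  rw [hI0, hT0]
  -- Varying the inverse metric pairs `b` with `τ g⁻¹ τ`, a multiple of `g - α ⊗ α`, and `b` is
  -- trace-free there.
  have hz : ((G y)⁻¹ * b y * (G y)⁻¹ * lieM X G y * ((G y)⁻¹ * lieM X G y)).trace = 0 := by
    have e : (G y)⁻¹ * b y * (G y)⁻¹ * lieM X G y * ((G y)⁻¹ * lieM X G y) =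
        (G y)⁻¹ * b y * ((G y)⁻¹ * (lieM X G y * (G y)⁻¹ * lieM X G y)) := by
      simp only [Matrix.mul_assoc]
    rw [e, h.torsion_mul_self hy, Matrix.mul_smul, Matrix.mul_smul, trace_smul]
    have := A.pairing_horizontal (hadm y hy)
    rw [pairing] at this
    rw [formSq, this, smul_zero]
  rw [trace_add, trace_mul_comm ((G y)⁻¹ * lieM X G y) _, Matrix.add_mul, trace_add, Matrix.neg_mul,
    Matrix.neg_mul, trace_neg, hz, pairing, trace_mul_comm ((G y)⁻¹ * lieM X G y)]
  ring

-- This is the integration by parts before integrating: up to a derivative along `X`, `⟨τ, L_X b⟩`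
-- equals `-⟨E, b⟩`. The further term with `f ⟨g - α ⊗ α, b⟩` vanishes.
include h hb hadm in
theorem fderiv_pairing_torsion (hy : y ∈ Ω) :
    fderiv ℝ (fun z => pairing (G z) (lieM X G z) (b z)) y (X y) =
      pairing (G y) (lieM X G y) (lieM X b y) + pairing (G y) (eulerLagrange β X G y) (b y) := by
  have h1 := ContDiffOn.hasLineDerivAt h.isOpen
    (SmoothMat.pairing h.smooth_metric h.unit_det h.smooth_torsion hb) hy (X y)
  have h2 := LieConAt.trace (h.lie_dualTorsion hy) (hb.lieAt h.isOpen hy (X := X))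
  have hfun : (fun z => pairing (G z) (lieM X G z) (b z)) = fun z =>
      ((G z)⁻¹ * lieM X G z * (G z)⁻¹ * b z).trace := by
    ext z
    rw [pairing]
    simp only [Matrix.mul_assoc]
  rw [HasDerivAt.unique h1 (by rw [hfun]; exact h2), trace_add, add_comm]
  have hz := (h.adapted y hy).pairing_horizontal (hadm y hy)
  rw [pairing_comm, pairing] at hz
  congr 1
  · rw [pairing]; simp only [Matrix.mul_assoc]
  · have hz' : ((G y)⁻¹ * (G y - formSq β y) * (G y)⁻¹ * b y).trace = 0 := by
      rw [← hz, formSq]; simp only [Matrix.mul_assoc]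
    rw [Matrix.mul_sub, Matrix.sub_mul, Matrix.sub_mul, trace_sub, Matrix.mul_smul, Matrix.smul_mul,
      Matrix.smul_mul, trace_smul, hz', pairing]
    simp only [Matrix.mul_assoc, smul_zero, sub_zero]

end LocalContactMetric

end Deformation

/-! ### Compactly supported integrals on `ℝ³` -/

section Integrals

theorem integral_fderiv_eq_zero {w : E3 → ℝ} (hw : ContDiff ℝ 1 w) (hc : HasCompactSupport w)
    (v : E3) : ∫ y, fderiv ℝ w y v = 0 := by
  have h1 : Continuous fun y => fderiv ℝ w y v :=
    (hw.continuous_fderiv (by norm_num)).clm_apply continuous_const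
  have h2 : HasCompactSupport fun y => fderiv ℝ w y v := hc.fderiv_apply ℝ v
  have h3 : Differentiable ℝ w := hw.differentiable (by norm_num)
  -- Integration by parts against the constant function `1`.
  have := integral_mul_fderiv_eq_neg_fderiv_mul_of_integrable (μ := volume) (f := fun _ : E3 => (1 : ℝ))
    (g := w) (v := v) (by simp) (by simpa using h1.integrable_of_hasCompactSupport h2)
    (by simpa using hw.continuous.integrable_of_hasCompactSupport hc)
    (fun x _ => differentiableAt_const _) (fun x _ => h3 x)
  simpa using this

theorem eventually_eq_zero_off {F E : Type*} [TopologicalSpace F] [Zero E] {K : Set F}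
    (hK : IsClosed K) {f : F → E} (h0 : ∀ y, y ∉ K → f y = 0) {y : F} (hy : y ∉ K) :
    f =ᶠ[𝓝 y] fun _ => 0 := by
  filter_upwards [hK.isOpen_compl.mem_nhds hy] with z hz using h0 z hz

/-- A function that is smooth on an open set and vanishes off a closed subset is smooth. -/
theorem contDiff_of_zero_off {F : Type*} [NormedAddCommGroup F] [NormedSpace ℝ F] {S K : Set F}
    (hS : IsOpen S) (hK : IsClosed K) (hKS : K ⊆ S) {f : F → ℝ} (hf : ContDiffOn ℝ ∞ f S)
    (h0 : ∀ y, y ∉ K → f y = 0) : ContDiff ℝ ∞ f := by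
  rw [contDiff_iff_contDiffAt]
  intro y
  by_cases hy : y ∈ K
  · exact hf.contDiffAt (hS.mem_nhds (hKS hy))
  · exact contDiffAt_const.congr_of_eventuallyEq (eventually_eq_zero_off hK h0 hy)

theorem hasDerivAt_integral_param {K : Set E3} (hK : IsCompact K) {h : ℝ × E3 → ℝ}
    (hh : ContDiff ℝ ∞ h) (h0 : ∀ t, ∀ y, y ∉ K → h (t, y) = 0) {D : E3 → ℝ}
    (hD : ∀ y, HasDerivAt (fun t => h (t, y)) (D y) 0) :
    HasDerivAt (fun t => ∫ y, h (t, y)) (∫ y, D y) 0 := by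
  set d : ℝ → E3 → ℝ := fun t y => fderiv ℝ h (t, y) (1, 0) with hd
  have hdc : Continuous fun r : ℝ × E3 => d r.1 r.2 :=
    (hh.continuous_fderiv (by norm_num)).clm_apply continuous_const
  have hder : ∀ t y, HasDerivAt (fun t => h (t, y)) (d t y) t := by
    intro t y
    have h1 : HasFDerivAt h (fderiv ℝ h (t, y)) (t, y) :=
      (hh.differentiable (by norm_num) _).hasFDerivAt
    exact h1.comp_hasDerivAt t ((hasDerivAt_id t).prodMk (hasDerivAt_const t y))
  have hsupp : ∀ t, HasCompactSupport fun y => h (t, y) := fun t =>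
    HasCompactSupport.intro hK fun y hy => h0 t y hy
  have hd0 : ∀ t, ∀ y, y ∉ K → d t y = 0 := by
    intro t y hy
    have e : (fun t => h (t, y)) = fun _ => 0 := funext fun s => h0 s y hy
    have := hder t y
    rw [e] at this
    exact this.unique (hasDerivAt_const t (0 : ℝ))
  -- The dominating function is the maximum of `|∂ₜh|` over `[-1, 1] × K`, extended by zero outside
  -- `K`.
  obtain ⟨C, hC⟩ := ((isCompact_Icc (a := (-1 : ℝ)) (b := 1)).prod hK).exists_bound_of_continuousOn
    hdc.continuousOn
  have hDd : D = d 0 := funext fun y => (hD y).unique (hder 0 y)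
  rw [hDd]
  refine (hasDerivAt_integral_of_dominated_loc_of_deriv_le (s := Icc (-1) 1)
    (bound := K.indicator fun _ => C) (F' := d) (Icc_mem_nhds (by norm_num) (by norm_num)) ?_ ?_ ?_ ?_
    ?_ ?_).2
  · exact Filter.Eventually.of_forall fun t => Continuous.aestronglyMeasurable
      (hh.continuous.comp (by fun_prop : Continuous fun y : E3 => (t, y)))
  · exact (hh.continuous.comp (by fun_prop : Continuous fun y : E3 => ((0 : ℝ), y)))
      |>.integrable_of_hasCompactSupport (hsupp 0)
  · exact (hdc.comp (by fun_prop : Continuous fun y : E3 => ((0 : ℝ), y))).aestronglyMeasurable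
  · refine Filter.Eventually.of_forall fun y t ht => ?_
    by_cases hy : y ∈ K
    · rw [indicator_of_mem hy]
      exact hC (t, y) ⟨ht, hy⟩
    · rw [indicator_of_notMem hy, hd0 t y hy, norm_zero]
  · exact (integrable_indicator_iff hK.measurableSet).mpr (integrableOn_const hK.measure_lt_top.ne)
  · exact Filter.Eventually.of_forall fun y t _ => hder t y

end Integrals

/-! ### First variation and Euler–Lagrange equation on an open subset of `ℝ³` -/

section FirstVariation

variable {Ω : Set E3} {β : E3 → E3 →L[ℝ] ℝ} {X : E3 → E3} {G b : E3 → Mat3} {y : E3}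

namespace LocalContactMetric

variable (h : LocalContactMetric Ω β X G)

include h in
/-- The Reeb field preserves the volume. -/
theorem integral_density_mul_fderiv {K : Set E3} (hK : IsCompact K) (hKΩ : K ⊆ Ω) {F : E3 → ℝ}
    (hF : ContDiffOn ℝ ∞ F Ω) (h0 : ∀ y, y ∉ K → F y = 0) :
    ∫ y, density G y * fderiv ℝ F y (X y) = 0 := by
  -- The components of `F ρ X`. Their divergence is `ρ X(F)`, because `ρ X` is divergence-free.
  set w : Fin 3 → E3 → ℝ := fun i y => density G y * X y i * F y with hw
  have hws : ∀ i, ContDiff ℝ ∞ (w i) := fun i =>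
    contDiff_of_zero_off h.isOpen hK.isClosed hKΩ
      ((h.smooth_density.mul (h.smooth_reeb_coord i)).mul hF) fun y hy => by simp [hw, h0 y hy]
  have hwc : ∀ i, HasCompactSupport (w i) := fun i =>
    HasCompactSupport.intro hK fun y hy => by simp [hw, h0 y hy]
  have key : ∀ y, density G y * fderiv ℝ F y (X y) = ∑ i, fderiv ℝ (w i) y (stdVec i) := by
    intro y
    by_cases hy : y ∈ K
    · have hyΩ := hKΩ hy
      have hn := h.isOpen.mem_nhds hyΩ
      have hρ := (h.smooth_density.contDiffAt hn).differentiableAt (by simp)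
      have hX := fun i => ((h.smooth_reeb_coord i).contDiffAt hn).differentiableAt (by simp)
      have hF' := (hF.contDiffAt hn).differentiableAt (by simp)
      have e : ∀ i, fderiv ℝ (w i) y (stdVec i) =
          density G y * (X y i * fderiv ℝ F y (stdVec i)) +
          F y * (density G y * fderiv ℝ (fun z => X z i) y (stdVec i)) +
          F y * (X y i * fderiv ℝ (density G) y (stdVec i)) := by
        intro i
        have := (hρ.hasFDerivAt.mul (hX i).hasFDerivAt).mul hF'.hasFDerivAt
        have e' : HasFDerivAt (w i) _ y := this
        rw [e'.fderiv]
        simp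
        ring
      have h1 := (ContDiffOn.hasLineDerivAt h.isOpen h.smooth_density hyΩ (X y)).unique
        (h.lie_density hyΩ)
      rw [fderiv_eq_sum] at h1
      have h2 : (jac X y).trace = ∑ i, fderiv ℝ (fun z => X z i) y (stdVec i) := rfl
      simp only [e, Finset.sum_add_distrib, ← Finset.mul_sum]
      rw [h1, ← h2, ← fderiv_eq_sum F]
      ring
    · have e1 := (eventually_eq_zero_off hK.isClosed h0 hy).fderiv_eq (𝕜 := ℝ)
      have e2 : ∀ i, fderiv ℝ (w i) y = 0 := fun i => by
        rw [(eventually_eq_zero_off (f := w i) hK.isClosed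
          (fun y hy => by simp [hw, h0 y hy]) hy).fderiv_eq (𝕜 := ℝ)]
        simp
      simp [e1, e2]
  simp only [key]
  rw [integral_finsetSum _ fun i _ => ?_]
  · exact Finset.sum_eq_zero fun i _ =>
      integral_fderiv_eq_zero ((hws i).of_le (by norm_cast)) (hwc i) _
  · exact (((hws i).continuous_fderiv (by norm_num)).clm_apply
      continuous_const).integrable_of_hasCompactSupport ((hwc i).fderiv_apply ℝ _)

theorem defMetric_of_zero (t : ℝ) (hb : b y = 0) : defMetric β G b t y = G y := by
  simp [defMetric, deform, defScale, halfNormSq, pairing, hb]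

theorem lieM_congr {B C : E3 → Mat3} (hBC : B =ᶠ[𝓝 y] C) : lieM X B y = lieM X C y := by
  have e : ∀ i j, (fun z => B z i j) =ᶠ[𝓝 y] fun z => C z i j := fun i j =>
    hBC.mono fun z hz => by simp only [hz]
  simp only [lieM, hBC.self_of_nhds, (e _ _).fderiv_eq]

theorem torsionSq_congr {B C : E3 → Mat3} (hBC : B =ᶠ[𝓝 y] C) :
    torsionSq X B y = torsionSq X C y := by
  rw [torsionSq, torsionSq, lieM_congr hBC, hBC.self_of_nhds]

theorem torsionSq_defMetric_of_zero {K : Set E3} (hK : IsClosed K) (h0 : ∀ y, y ∉ K → b y = 0)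
    (hy : y ∉ K) (t : ℝ) : torsionSq X (defMetric β G b t) y = torsionSq X G y :=
  torsionSq_congr (by
    filter_upwards [hK.isOpen_compl.mem_nhds hy] with z hz using defMetric_of_zero t (h0 z hz))

include h in
/-- The first variation formula. -/
theorem hasDerivAt_integral_torsionSq (hb : SmoothMat Ω b)
    (hadm : ∀ y ∈ Ω, Admissible (G y) (dmat β y) (covec β y) (b y)) {K : Set E3}
    (hK : IsCompact K) (hKΩ : K ⊆ Ω) (h0 : ∀ y, y ∉ K → b y = 0) :
    HasDerivAt (fun t => ∫ y, density G y *
      (torsionSq X (defMetric β G b t) y - torsionSq X G y))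
      (-∫ y, density G y * pairing (G y) (eulerLagrange β X G y) (b y)) 0 := by
  -- Subtracting the undeformed torsion gives the integrand compact support.
  set H : ℝ × E3 → ℝ := fun r => density G r.2 *
    (torsionSq X (defMetric β G b r.1) r.2 - torsionSq X G r.2) with hH
  have hH0 : ∀ t, ∀ y, y ∉ K → H (t, y) = 0 := fun t y hy => by
    simp only [hH]
    rw [torsionSq_defMetric_of_zero hK.isClosed h0 hy, sub_self, mul_zero]
  have hHs : ContDiff ℝ ∞ H := by
    refine contDiff_of_zero_off (S := prodSet Ω) (K := univ ×ˢ K) (isOpen_univ.prod h.isOpen)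
      (isClosed_univ.prod hK.isClosed) (prod_mono_right hKΩ) ?_ fun r hr => hH0 r.1 r.2 fun hm =>
      hr ⟨mem_univ _, hm⟩
    exact (h.smooth_density.comp contDiffOn_snd mapsTo_snd).mul
      ((h.smooth_torsionSq_defMetric hb hadm).sub
        (h.smooth_torsionSq.comp contDiffOn_snd mapsTo_snd))
  set P : E3 → ℝ := fun z => pairing (G z) (lieM X G z) (b z) with hP
  have hPs : ContDiffOn ℝ ∞ P Ω :=
    SmoothMat.pairing h.smooth_metric h.unit_det h.smooth_torsion hb
  have hP0 : ∀ y, y ∉ K → P y = 0 := fun y hy => by simp [hP, pairing, h0 y hy]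
  set Q : E3 → ℝ := fun y => density G y * pairing (G y) (eulerLagrange β X G y) (b y) with hQ
  have hQ0 : ∀ y, y ∉ K → Q y = 0 := fun y hy => by simp [hQ, pairing, h0 y hy]
  have hQs : ContDiff ℝ ∞ Q := contDiff_of_zero_off h.isOpen hK.isClosed hKΩ
    (h.smooth_density.mul (SmoothMat.pairing h.smooth_metric h.unit_det h.smooth_eulerLagrange hb))
    hQ0
  have hQi : Integrable Q :=
    hQs.continuous.integrable_of_hasCompactSupport (HasCompactSupport.intro hK hQ0)
  have hR : ∀ y, y ∉ K → density G y * fderiv ℝ P y (X y) = 0 := fun y hy => by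
    rw [(eventually_eq_zero_off hK.isClosed hP0 hy).fderiv_eq]; simp
  have hRs : ContDiff ℝ ∞ fun y => density G y * fderiv ℝ P y (X y) :=
    contDiff_of_zero_off h.isOpen hK.isClosed hKΩ
      (h.smooth_density.mul (ContDiffOn.fderiv_apply_smooth h.isOpen hPs h.smooth_reeb)) hR
  have hRi := hRs.continuous.integrable_of_hasCompactSupport (μ := volume)
    (HasCompactSupport.intro hK hR)
  have := hasDerivAt_integral_param (D := fun y => density G y * fderiv ℝ P y (X y) - Q y) hK hHs hH0
    (fun y => by
      by_cases hy : y ∈ K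
      · have e := ((h.hasDerivAt_torsionSq hb hadm (hKΩ hy)).sub_const
          (torsionSq X G y)).const_mul (density G y)
        refine e.congr_deriv ?_
        rw [hP, h.fderiv_pairing_torsion hb hadm (hKΩ hy), hQ]
        ring
      · rw [hR y hy, hQ0 y hy, sub_zero]
        exact (hasDerivAt_const (0 : ℝ) (0 : ℝ)).congr_of_eventuallyEq
          (Filter.Eventually.of_forall fun t => hH0 t y hy))
  refine this.congr_deriv ?_
  rw [integral_sub hRi hQi, h.integral_density_mul_fderiv hK hKΩ hPs hP0, zero_sub]

include h in
/-- The Euler–Lagrange equation. -/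
theorem eulerLagrange_eq_zero (hy : y ∈ Ω)
    (hcrit : ∀ (b : E3 → Mat3) (K : Set E3), SmoothMat Ω b →
      (∀ y ∈ Ω, Admissible (G y) (dmat β y) (covec β y) (b y)) → IsCompact K → K ⊆ Ω →
      (∀ y, y ∉ K → b y = 0) →
      HasDerivAt (fun t => ∫ y, density G y *
        (torsionSq X (defMetric β G b t) y - torsionSq X G y)) 0 0) :
    eulerLagrange β X G y = 0 := by
  obtain ⟨r, hr, hball⟩ := Metric.isOpen_iff.mp h.isOpen y hy
  set ψ : ContDiffBump y := ⟨r / 4, r / 2, by positivity, by linarith⟩ with hψ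
  have hKΩ : Metric.closedBall y (r / 2) ⊆ Ω :=
    (Metric.closedBall_subset_ball (by linarith)).trans hball
  have hψ0 : ∀ z, z ∉ Metric.closedBall y (r / 2) → ψ z = 0 := fun z hz =>
    ψ.zero_of_le_dist (by
      rw [Metric.mem_closedBall, not_le] at hz; exact hz.le)
  -- With this direction the first variation is `-∫ ρ ψ |E|²`, whose integrand is continuous and of
  -- one sign.
  set b : E3 → Mat3 := fun z => ψ z • eulerLagrange β X G z with hb
  have hK : IsCompact (Metric.closedBall y (r / 2)) := isCompact_closedBall _ _
  have hbs : SmoothMat Ω b := SmoothMat.smul ψ.contDiff.contDiffOn h.smooth_eulerLagrange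
  have hadm : ∀ y ∈ Ω, Admissible (G y) (dmat β y) (covec β y) (b y) := fun z hz =>
    (h.admissible_eulerLagrange hz).smul _
  have hb0 : ∀ z, z ∉ Metric.closedBall y (r / 2) → b z = 0 := fun z hz => by
    simp [hb, hψ0 z hz]
  have h1 := (h.hasDerivAt_integral_torsionSq hbs hadm hK hKΩ hb0).unique
    (hcrit b _ hbs hadm hK hKΩ hb0)
  set q : E3 → ℝ := fun z => density G z * pairing (G z) (eulerLagrange β X G z) (b z) with hq
  have hqe : ∀ z, q z = density G z * ψ z *
      pairing (G z) (eulerLagrange β X G z) (eulerLagrange β X G z) := fun z => by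
    simp only [hq, hb, pairing, Matrix.mul_smul, trace_smul, smul_eq_mul]
    ring
  have hq0 : ∀ z, z ∉ Metric.closedBall y (r / 2) → q z = 0 := fun z hz => by
    rw [hqe, hψ0 z hz]; ring
  have hqs : ContDiff ℝ ∞ q := contDiff_of_zero_off h.isOpen hK.isClosed hKΩ
    (h.smooth_density.mul (SmoothMat.pairing h.smooth_metric h.unit_det h.smooth_eulerLagrange hbs))
    hq0
  have hqn : 0 ≤ q := fun z => by
    by_cases hz : z ∈ Metric.closedBall y (r / 2)
    · rw [Pi.zero_apply, hqe]
      exact mul_nonneg (mul_nonneg (Real.sqrt_nonneg _) ψ.nonneg)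
        ((h.admissible_eulerLagrange (hKΩ hz)).pairing_nonneg (h.adapted z (hKΩ hz)))
    · rw [hq0 z hz, Pi.zero_apply]
  have hqy : q y = 0 := by
    by_contra hne
    have := hqs.continuous.integral_pos_of_hasCompactSupport_nonneg_nonzero (μ := volume)
      (HasCompactSupport.intro hK hq0) hqn hne
    linarith
  rw [hqe, ψ.one_of_mem_closedBall (Metric.mem_closedBall_self ψ.rIn_pos.le), mul_one] at hqy
  have hpos : density G y ≠ 0 := (Real.sqrt_pos.mpr (h.adapted y hy).det_pos).ne'
  exact (h.admissible_eulerLagrange hy).eq_zero_of_pairing (h.adapted y hy)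
    ((mul_eq_zero.mp hqy).resolve_left hpos)

end LocalContactMetric

end FirstVariation

/-! ### From bilinear forms and endomorphisms to matrices -/

section LinearAlgebra

/-- The matrix of an endomorphism of `ℝ³` in the standard basis. -/
def endMatrix (D : E3 →L[ℝ] E3) : Mat3 := of fun i j => D (stdVec j) i

/-- The components of a linear form. -/
def formVec (a : E3 →L[ℝ] ℝ) : Fin 3 → ℝ := fun i => a (stdVec i)

theorem eq_sum_stdVec (v : E3) : v = ∑ i, v i • stdVec i := by
  conv_lhs => rw [← (EuclideanSpace.basisFun (Fin 3) ℝ).sum_repr v]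
  simp

theorem form_apply (a : E3 →L[ℝ] ℝ) (v : E3) : a v = formVec a ⬝ᵥ v.ofLp := by
  conv_lhs => rw [eq_sum_stdVec v]
  simp [formVec, dotProduct, mul_comm]

theorem endMatrix_mulVec (D : E3 →L[ℝ] E3) (v : E3) : endMatrix D *ᵥ v.ofLp = (D v).ofLp := by
  ext i
  conv_rhs => rw [eq_sum_stdVec v]
  simp [endMatrix, mulVec, dotProduct, mul_comm]

theorem bilin_apply (b : E3 →L[ℝ] E3 →L[ℝ] ℝ) (u v : E3) :
    b u v = u.ofLp ⬝ᵥ bilinMatrix b *ᵥ v.ofLp := by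
  conv_lhs => rw [eq_sum_stdVec u, eq_sum_stdVec v]
  simp only [map_sum, map_smul, _root_.sum_apply, _root_.smul_apply, smul_eq_mul, bilinMatrix, mulVec,
    dotProduct, Finset.mul_sum, of_apply]
  rw [Finset.sum_comm]
  exact Finset.sum_congr rfl fun i _ => Finset.sum_congr rfl fun j _ => by ring

theorem bilinMatrix_apply (b : E3 →L[ℝ] E3 →L[ℝ] ℝ) (i j : Fin 3) :
    bilinMatrix b i j = b (stdVec i) (stdVec j) := rfl

theorem endMatrix_col (D : E3 →L[ℝ] E3) (j : Fin 3) : (D (stdVec j)).ofLp = (endMatrix D).col j :=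
  rfl

theorem bilinMatrix_comp {b c : E3 →L[ℝ] E3 →L[ℝ] ℝ} {D : E3 →L[ℝ] E3}
    (h : ∀ u v, c u v = b (D u) (D v)) :
    bilinMatrix c = (endMatrix D)ᵀ * bilinMatrix b * endMatrix D := by
  ext i j
  rw [bilinMatrix_apply, h, bilin_apply, Matrix.mul_assoc, Matrix.mul_apply]
  rfl

theorem formVec_comp {a c : E3 →L[ℝ] ℝ} {D : E3 →L[ℝ] E3} (h : ∀ u, c u = a (D u)) :
    formVec c = (endMatrix D)ᵀ *ᵥ formVec a := by
  ext i
  rw [formVec, h, form_apply, dotProduct_comm]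
  rfl

theorem isUnit_det_endMatrix {D : E3 →L[ℝ] E3} (h : Function.Injective D) :
    IsUnit (endMatrix D).det := by
  rw [isUnit_iff_ne_zero]
  intro h0
  obtain ⟨v, hv, hv'⟩ := exists_mulVec_eq_zero_iff.mpr h0
  refine hv ?_
  have h1 := endMatrix_mulVec D (WithLp.toLp 2 v)
  have h2 : D (WithLp.toLp 2 v) = 0 := by
    ext i
    rw [← h1]
    exact congrFun hv' i
  have h3 := h (h2.trans (map_zero D).symm)
  simpa using congrArg WithLp.ofLp h3

theorem bilin_symm_iff {b : E3 →L[ℝ] E3 →L[ℝ] ℝ} :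
    (bilinMatrix b)ᵀ = bilinMatrix b ↔ ∀ u v, b u v = b v u := by
  constructor
  · intro h u v
    rw [bilin_apply, bilin_apply, transpose_mulVec_dotProduct, h, dotProduct_comm]
  · intro h
    ext i j
    exact h _ _

theorem bilin_pos_iff {b : E3 →L[ℝ] E3 →L[ℝ] ℝ} :
    (∀ v : Fin 3 → ℝ, v ≠ 0 → 0 < v ⬝ᵥ bilinMatrix b *ᵥ v) ↔ ∀ v, v ≠ 0 → 0 < b v v := by
  constructor
  · intro h v hv
    rw [bilin_apply]
    exact h _ (by simpa using hv)
  · intro h v hv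
    have := h (WithLp.toLp 2 v) (by simpa using hv)
    rwa [bilin_apply] at this

variable {g W : E3 →L[ℝ] E3 →L[ℝ] ℝ} {a : E3 →L[ℝ] ℝ} {X : E3}

/-- The second equation gives `W = 2 G φ`. Substituting this eliminates `φ`, and `φ² = -1 + α ⊗ X`
becomes `compat`. -/
theorem adapted_of_endomorphism (hs : ∀ u v, g u v = g v u) (hp : ∀ v, v ≠ 0 → 0 < g v v)
    (hW : ∀ u v, W u v = -W v u) (ha : a X = 1) (hX : ∀ v, W X v = 0) {φ : E3 →L[ℝ] E3}
    (h1 : ∀ v, g X v = a v) (h2 : ∀ u v, g u (φ v) = 1 / 2 * W u v)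
    (h3 : ∀ v, φ (φ v) = -v + a v • X) :
    Adapted (bilinMatrix g) (bilinMatrix W) (formVec a) := by
  have hpos := bilin_pos_iff.mpr hp
  have hu := isUnit_det_of_pos hpos
  have e1 : bilinMatrix g *ᵥ X.ofLp = formVec a := by
    ext i
    rw [formVec, ← h1, hs, bilin_apply]
    simp
  have e2 : (bilinMatrix g)⁻¹ *ᵥ formVec a = X.ofLp := by
    rw [← e1, mulVec_mulVec, nonsing_inv_mul _ hu, one_mulVec]
  have e3 : bilinMatrix W = (2 : ℝ) • (bilinMatrix g * endMatrix φ) := by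
    ext i j
    have := h2 (stdVec i) (stdVec j)
    rw [bilin_apply g, ← endMatrix_mulVec, mulVec_mulVec] at this
    simp only [Matrix.smul_apply, smul_eq_mul, bilinMatrix_apply W]
    have h' : (stdVec i).ofLp ⬝ᵥ (bilinMatrix g * endMatrix φ) *ᵥ (stdVec j).ofLp =
        (bilinMatrix g * endMatrix φ) i j := by simp
    rw [h'] at this
    linarith
  have e4 : endMatrix φ * endMatrix φ = -1 + vecMulVec X.ofLp (formVec a) := by
    ext i j
    have h' : (endMatrix φ * endMatrix φ) i j = (φ (φ (stdVec j))) i := by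
      rw [← endMatrix_mulVec, endMatrix_col]
      rfl
    rw [h', h3]
    simp [vecMulVec_apply, formVec, Matrix.one_apply, mul_comm]
  refine ⟨bilin_symm_iff.mpr hs, hpos, ?_, ?_, ?_, ?_⟩
  · ext i j
    exact hW _ _
  · rw [e2]
    ext i
    have := hX (stdVec i)
    rw [hW, neg_eq_zero, bilin_apply] at this
    simpa using this
  · rw [e2, ← form_apply, ha]
  · rw [e3, Matrix.smul_mul, Matrix.smul_mul, Matrix.mul_smul, smul_smul]
    have : bilinMatrix g * endMatrix φ * (bilinMatrix g)⁻¹ * (bilinMatrix g * endMatrix φ) =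
        bilinMatrix g * (endMatrix φ * endMatrix φ) := by
      calc _ = bilinMatrix g * endMatrix φ * ((bilinMatrix g)⁻¹ * bilinMatrix g) * endMatrix φ := by
            simp only [Matrix.mul_assoc]
        _ = _ := by rw [nonsing_inv_mul _ hu, Matrix.mul_one, Matrix.mul_assoc]
    rw [this, e4, Matrix.mul_add, mul_vecMulVec, e1]
    simp only [Matrix.mul_neg, Matrix.mul_one]
    module

theorem reeb_of_adapted {G : Mat3} (hW : ∀ u v, W u v = -W v u)
    (h : Adapted G (bilinMatrix W) (formVec a)) :
    a (WithLp.toLp 2 (G⁻¹ *ᵥ formVec a)) = 1 ∧ ∀ v, W (WithLp.toLp 2 (G⁻¹ *ᵥ formVec a)) v = 0 := by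
  refine ⟨by rw [form_apply]; exact h.norm, fun v => ?_⟩
  rw [hW, bilin_apply, h.ker, dotProduct_zero, neg_zero]

/-- The endomorphism with a given matrix. -/
def matrixEnd (A : Mat3) : E3 →L[ℝ] E3 := Matrix.toEuclideanCLM (𝕜 := ℝ) A

theorem matrixEnd_apply (A : Mat3) (v : E3) : (matrixEnd A v).ofLp = A *ᵥ v.ofLp := by
  simp [matrixEnd]

/-- The converse elimination, with `φ = G⁻¹ W / 2`. -/
theorem exists_endomorphism (h : Adapted (bilinMatrix g) (bilinMatrix W) (formVec a))
    (hX : X.ofLp = (bilinMatrix g)⁻¹ *ᵥ formVec a) :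
    ∃ φ : E3 →L[ℝ] E3, (∀ v, g X v = a v) ∧ (∀ u v, g u (φ v) = 1 / 2 * W u v) ∧
      ∀ v, φ (φ v) = -v + a v • X := by
  refine ⟨matrixEnd ((1 / 2 : ℝ) • ((bilinMatrix g)⁻¹ * bilinMatrix W)), fun v => ?_, fun u v => ?_,
    fun v => ?_⟩
  · rw [bilin_apply, hX, transpose_mulVec_dotProduct, h.symm, mulVec_mulVec, h.mul_inv, one_mulVec,
      ← form_apply]
  · rw [bilin_apply, matrixEnd_apply, mulVec_mulVec, Matrix.mul_smul, ← Matrix.mul_assoc, h.mul_inv,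
      Matrix.one_mul, smul_mulVec, dotProduct_smul, bilin_apply W, smul_eq_mul]
  · apply WithLp.ofLp_injective 2
    rw [matrixEnd_apply, matrixEnd_apply, mulVec_mulVec]
    have : ((1 / 2 : ℝ) • ((bilinMatrix g)⁻¹ * bilinMatrix W)) *
        ((1 / 2 : ℝ) • ((bilinMatrix g)⁻¹ * bilinMatrix W)) =
        -1 + vecMulVec X.ofLp (formVec a) := by
      rw [Matrix.smul_mul, Matrix.mul_smul, smul_smul, Matrix.mul_assoc, ← Matrix.mul_assoc _ _ (bilinMatrix W),
        h.compat, Matrix.mul_smul, Matrix.mul_sub, h.inv_mul, mul_vecMulVec, ← hX]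
      module
    rw [this, add_mulVec, neg_mulVec, one_mulVec, vecMulVec_mulVec, ← form_apply]
    ext i
    simp [mul_comm]

end LinearAlgebra

/-! ### A contact metric on `M` in a chart -/

section ContactMetrics

variable {M : Type*} [TopologicalSpace M] [ChartedSpace E3 M] [IsManifold (𝓡 3) ∞ M]

/-- The matrix of a metric on the tangent space at `p`. -/
def metricMat (g : Metric M) (p : M) : Mat3 := bilinMatrix (g.inner p)

/-- The matrix of `dα` at `p`. -/
def formMat (α : ContactForm M) (p : M) : Mat3 := bilinMatrix (extDerivOneForm α.form p)

/-- The components of `α` at `p`. -/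
def formCov (α : ContactForm M) (p : M) : Fin 3 → ℝ := formVec (α.form p)

omit [IsManifold (𝓡 3) ∞ M] in
theorem extDerivOneForm_antisymm (a : ∀ p : M, TangentSpace (𝓡 3) p →L[ℝ] ℝ) (p : M) (u v : E3) :
    (extDerivOneForm a p : E3 →L[ℝ] E3 →L[ℝ] ℝ) u v =
      -(extDerivOneForm a p : E3 →L[ℝ] E3 →L[ℝ] ℝ) v u := by
  set A : E3 →L[ℝ] E3 →L[ℝ] ℝ := fderiv ℝ (oneFormInChart a p) (extChartAt (𝓡 3) p p)
  change (A - A.flip) u v = -(A - A.flip) v u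
  simp

theorem reeb_spec (α : ContactForm M) (p : M) :
    α.form p (α.reeb p) = 1 ∧ ∀ v, extDerivOneForm α.form p (α.reeb p) v = 0 :=
  (α.existsUnique_reeb p).choose_spec.1

/-- The right side satisfies the Reeb equations, which have a unique solution. This gives a formula
for a field that was defined by choice. -/
theorem reeb_eq {α : ContactForm M} {p : M} {G : Mat3} (h : Adapted G (formMat α p) (formCov α p)) :
    (α.reeb p : E3).ofLp = G⁻¹ *ᵥ formCov α p := by
  set Y : E3 := WithLp.toLp 2 (G⁻¹ *ᵥ formCov α p)
  obtain ⟨h1, h2⟩ := reeb_of_adapted (W := (extDerivOneForm α.form p : E3 →L[ℝ] E3 →L[ℝ] ℝ))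
    (a := (α.form p : E3 →L[ℝ] ℝ)) (extDerivOneForm_antisymm α.form p) h
  have h3 : α.reeb p = Y := (α.existsUnique_reeb p).unique (reeb_spec α p) ⟨h1, h2⟩
  rw [h3]

theorem IsContactMetric.adapted {α : ContactForm M} {g : Metric M} (h : IsContactMetric α g)
    (p : M) : Adapted (metricMat g p) (formMat α p) (formCov α p) := by
  obtain ⟨φ, hφ⟩ := h
  obtain ⟨h1, h2, h3⟩ := hφ p
  exact adapted_of_endomorphism (g := (g.inner p : E3 →L[ℝ] E3 →L[ℝ] ℝ))
    (W := (extDerivOneForm α.form p : E3 →L[ℝ] E3 →L[ℝ] ℝ)) (a := (α.form p : E3 →L[ℝ] ℝ))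
    (X := (α.reeb p : E3)) (φ := (φ p : E3 →L[ℝ] E3)) (g.symm p) (g.pos p)
    (extDerivOneForm_antisymm α.form p) (reeb_spec α p).1 (reeb_spec α p).2 h1 h2 h3

theorem isContactMetric_of_adapted {α : ContactForm M} {g : Metric M}
    (h : ∀ p, Adapted (metricMat g p) (formMat α p) (formCov α p)) : IsContactMetric α g := by
  choose φ hφ using fun p => exists_endomorphism (g := (g.inner p : E3 →L[ℝ] E3 →L[ℝ] ℝ))
    (W := (extDerivOneForm α.form p : E3 →L[ℝ] E3 →L[ℝ] ℝ)) (a := (α.form p : E3 →L[ℝ] ℝ))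
    (X := (α.reeb p : E3)) (h p) (reeb_eq (h p))
  exact ⟨φ, hφ⟩

/-- The matrix of the coordinate frame. -/
def frameMat (x : M) (y : E3) : Mat3 := endMatrix (frame x y)

theorem isUnit_frameMat (x : M) {y : E3} (hy : y ∈ (extChartAt (𝓡 3) x).target) :
    IsUnit (frameMat x y).det := isUnit_det_endMatrix (frame_injective x hy)

/-- The matrix of a metric in the coordinates of the chart at `x`. -/
def chartMat (g : Metric M) (x : M) (y : E3) : Mat3 := bilinMatrix (bilinInChart g.inner x y)

theorem chartMat_eq (g : Metric M) (x : M) (y : E3) :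
    chartMat g x y =
      (frameMat x y)ᵀ * metricMat g ((extChartAt (𝓡 3) x).symm y) * frameMat x y :=
  bilinMatrix_comp fun u v => bilinInChart_apply g.inner x y u v

theorem covec_eq (α : ContactForm M) (x : M) (y : E3) :
    covec (oneFormInChart α.form x) y =
      (frameMat x y)ᵀ *ᵥ formCov α ((extChartAt (𝓡 3) x).symm y) :=
  formVec_comp (c := oneFormInChart α.form x y) fun u => oneFormInChart_apply α.form x y u

theorem differentiableAt_oneFormInChart (α : ContactForm M) (x : M) {y : E3}
    (hy : y ∈ (extChartAt (𝓡 3) x).target) : DifferentiableAt ℝ (oneFormInChart α.form x) y :=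
  (contDiffAt_oneFormInChart α.smooth x hy).differentiableAt (by simp)

theorem dmat_eq (α : ContactForm M) (x : M) {y : E3} (hy : y ∈ (extChartAt (𝓡 3) x).target) :
    dmat (oneFormInChart α.form x) y =
      (frameMat x y)ᵀ * formMat α ((extChartAt (𝓡 3) x).symm y) * frameMat x y := by
  set A : E3 →L[ℝ] E3 →L[ℝ] ℝ := fderiv ℝ (oneFormInChart α.form x) y with hA
  have h1 : dmat (oneFormInChart α.form x) y = bilinMatrix (A - A.flip) := by
    have hd := differentiableAt_oneFormInChart α x hy
    have e : ∀ i, fderiv ℝ (fun z => covec (oneFormInChart α.form x) z i) y =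
        A.flip (stdVec i) := fun i => by
      have := (hd.hasFDerivAt.clm_apply (hasFDerivAt_const (stdVec i) y)).fderiv
      rw [show (fun z => covec (oneFormInChart α.form x) z i) =
        fun z => oneFormInChart α.form x z (stdVec i) from rfl, this]
      simp [hA]
    ext i j
    simp [dmat, e, bilinMatrix_apply]
  rw [h1]
  exact bilinMatrix_comp fun u v => (extDerivOneForm_frame α.form
    (fun q z hz => differentiableAt_oneFormInChart α q hz) hy u v).symm

theorem smoothMat_bilin {F : Type*} [NormedAddCommGroup F] [NormedSpace ℝ F] {S : Set F}
    {b : F → E3 →L[ℝ] E3 →L[ℝ] ℝ} (hb : ContDiffOn ℝ ∞ b S) :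
    SmoothMat S fun y => bilinMatrix (b y) :=
  fun _ _ => (hb.clm_apply contDiffOn_const).clm_apply contDiffOn_const

theorem contDiffAt_chart_inner (g : Metric M) (x : M) {y : E3}
    (hy : y ∈ (extChartAt (𝓡 3) x).target) : ContDiffAt ℝ ∞ (bilinInChart g.inner x) y := by
  have hp := (extChartAt (𝓡 3) x).map_target hy
  rw [extChartAt_source] at hp
  have := (contMDiffAt_bilin_iff (fun _ => g.inner) x hp 0).mp
    ((g.contMDiff _).comp ((0 : ℝ), _) contMDiffAt_snd)
  rw [(extChartAt (𝓡 3) x).right_inv hy] at this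
  exact this.comp y (f := fun z : E3 => ((0 : ℝ), z)) (by fun_prop)

variable {α : ContactForm M} {g : Metric M}

theorem IsContactMetric.adapted_chart (h : IsContactMetric α g) (x : M) {y : E3}
    (hy : y ∈ (extChartAt (𝓡 3) x).target) :
    Adapted (chartMat g x y) (dmat (oneFormInChart α.form x) y)
      (covec (oneFormInChart α.form x) y) := by
  rw [chartMat_eq, dmat_eq α x hy, covec_eq]
  exact (h.adapted _).congr (isUnit_frameMat x hy)

theorem IsContactMetric.reeb_chart (h : IsContactMetric α g) (x : M) {y : E3}
    (hy : y ∈ (extChartAt (𝓡 3) x).target) : (vectorFieldInChart α.reeb x y).ofLp =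
      (chartMat g x y)⁻¹ *ᵥ covec (oneFormInChart α.form x) y := by
  have A := h.adapted ((extChartAt (𝓡 3) x).symm y)
  have hD := isUnit_frameMat x hy
  have h1 : frameMat x y *ᵥ (vectorFieldInChart α.reeb x y).ofLp =
      (metricMat g ((extChartAt (𝓡 3) x).symm y))⁻¹ *ᵥ formCov α ((extChartAt (𝓡 3) x).symm y) := by
    rw [frameMat, endMatrix_mulVec, frame_vectorFieldInChart _ x hy, ← reeb_eq A]
  have h2 : chartMat g x y *ᵥ (vectorFieldInChart α.reeb x y).ofLp =
      covec (oneFormInChart α.form x) y := by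
    rw [chartMat_eq, ← mulVec_mulVec, h1, ← mulVec_mulVec, mulVec_mulVec _ (metricMat g _), A.mul_inv,
      one_mulVec, covec_eq]
  rw [← h2, mulVec_mulVec, (h.adapted_chart x hy).inv_mul, one_mulVec]

/-- The Reeb field is smooth because in coordinates it is `G⁻¹ α`, with smooth entries. -/
theorem IsContactMetric.local (h : IsContactMetric α g) (x : M) :
    LocalContactMetric (extChartAt (𝓡 3) x).target (oneFormInChart α.form x)
      (vectorFieldInChart α.reeb x) (chartMat g x) := by
  have hf : ∀ i, ContDiffOn ℝ ∞ (fun y => covec (oneFormInChart α.form x) y i)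
      (extChartAt (𝓡 3) x).target := fun i y hy =>
    ((contDiffAt_oneFormInChart α.smooth x hy).clm_apply contDiffAt_const).contDiffWithinAt
  have hG : SmoothMat (extChartAt (𝓡 3) x).target (chartMat g x) :=
    smoothMat_bilin fun y hy => (contDiffAt_chart_inner g x hy).contDiffWithinAt
  refine ⟨isOpen_extChartAt_target x, hf, ?_, hG, fun y hy => h.adapted_chart x hy, fun y hy i =>
    congrFun (h.reeb_chart x hy) i⟩
  rw [contDiffOn_euclidean]
  intro i
  have hi := hG.inv fun y hy => (h.adapted_chart x hy).isUnit_det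
  refine (ContDiffOn.sum (s := Finset.univ) fun k _ => (hi i k).mul (hf k)).congr fun y hy => ?_
  exact congrFun (h.reeb_chart x hy) i

theorem IsContactMetric.differentiableAt_reeb (h : IsContactMetric α g) (x : M) {y : E3}
    (hy : y ∈ (extChartAt (𝓡 3) x).target) : DifferentiableAt ℝ (vectorFieldInChart α.reeb x) y :=
  ((h.local x).smooth_reeb.contDiffAt ((h.local x).isOpen.mem_nhds hy)).differentiableAt (by simp)

theorem bilinMatrix_coordLie {X : E3 → E3} {b : E3 → E3 →L[ℝ] E3 →L[ℝ] ℝ} {y : E3}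
    (hX : DifferentiableAt ℝ X y) (hb : DifferentiableAt ℝ b y) :
    bilinMatrix (coordLie X b y) = lieM X (fun z => bilinMatrix (b z)) y := by
  have hj : jac X y = endMatrix (fderiv ℝ X y) := by
    ext i j
    have := ((EuclideanSpace.proj i : E3 →L[ℝ] ℝ).hasFDerivAt.comp y hX.hasFDerivAt).fderiv
    have e : (fun z => X z i) = (EuclideanSpace.proj i : E3 →L[ℝ] ℝ) ∘ X := rfl
    simp only [jac, of_apply]
    rw [e, this]
    rfl
  ext i j
  rw [bilinMatrix_apply, coordLie_apply, lieM, hj]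
  have h1 : ∀ i j, fderiv ℝ (fun z => bilinMatrix (b z) i j) y (X y) =
      fderiv ℝ b y (X y) (stdVec i) (stdVec j) := fun i j =>
    fderiv_bilin_apply_const hb _ _ _
  simp only [Matrix.add_apply, of_apply, h1]
  have h2 : b y (stdVec i) (fderiv ℝ X y (stdVec j)) =
      (bilinMatrix (b y) * endMatrix (fderiv ℝ X y)) i j := by
    rw [bilin_apply, Matrix.mul_apply]
    simp [mulVec, dotProduct, endMatrix]
  have h3 : b y (fderiv ℝ X y (stdVec i)) (stdVec j) =
      ((endMatrix (fderiv ℝ X y))ᵀ * bilinMatrix (b y)) i j := by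
    rw [bilin_apply, Matrix.mul_apply]
    simp [mulVec, dotProduct, endMatrix]
  rw [h2, h3]
  ring

theorem IsContactMetric.lieM_chart (h : IsContactMetric α g) (x : M) {y : E3}
    (hy : y ∈ (extChartAt (𝓡 3) x).target) :
    lieM (vectorFieldInChart α.reeb x) (chartMat g x) y =
      (frameMat x y)ᵀ * bilinMatrix (torsion α g ((extChartAt (𝓡 3) x).symm y)) * frameMat x y := by
  have hb : ∀ (q : M) (z : E3), z ∈ (extChartAt (𝓡 3) q).target →
      DifferentiableAt ℝ (bilinInChart g.inner q) z := fun q z hz =>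
    (contDiffAt_chart_inner g q hz).differentiableAt (by simp)
  have := bilinMatrix_coordLie (h.differentiableAt_reeb x hy) (hb x y hy)
  refine this.symm.trans (bilinMatrix_comp fun u v => ?_)
  exact (lieDerivBilin_frame α.reeb g.inner (fun q z hz => h.differentiableAt_reeb q hz) hb hy u v).symm

theorem IsContactMetric.torsionNormSq_chart (h : IsContactMetric α g) (x : M) {y : E3}
    (hy : y ∈ (extChartAt (𝓡 3) x).target) :
    torsionNormSq α g ((extChartAt (𝓡 3) x).symm y) =
      torsionSq (vectorFieldInChart α.reeb x) (chartMat g x) y := by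
  rw [torsionSq, h.lieM_chart x hy, chartMat_eq, pairing_congr (isUnit_frameMat x hy)]
  rfl

theorem IsContactMetric.torsionNormSq_eq (h : IsContactMetric α g) (x : M) {p : M}
    (hp : p ∈ (extChartAt (𝓡 3) x).source) : torsionNormSq α g p =
      torsionSq (vectorFieldInChart α.reeb x) (chartMat g x) (extChartAt (𝓡 3) x p) := by
  rw [← h.torsionNormSq_chart x ((extChartAt (𝓡 3) x).map_source hp),
    (extChartAt (𝓡 3) x).left_inv hp]

theorem LocalContactMetric.torsionSq_nonneg {Ω : Set E3} {β : E3 → E3 →L[ℝ] ℝ} {X : E3 → E3}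
    {G : E3 → Mat3} (h : LocalContactMetric Ω β X G) {y : E3} (hy : y ∈ Ω) :
    0 ≤ torsionSq X G y :=
  mul_nonneg (by norm_num) ((h.admissible_torsion hy).pairing_nonneg (h.adapted y hy))

theorem IsContactMetric.torsionNormSq_nonneg (h : IsContactMetric α g) (p : M) :
    0 ≤ torsionNormSq α g p := by
  rw [h.torsionNormSq_eq p (mem_extChartAt_source p)]
  exact (h.local p).torsionSq_nonneg (mem_extChartAt_target p)

theorem IsContactMetric.scalarTorsion_sq (h : IsContactMetric α g) (p : M) :
    scalarTorsion α g p ^ 2 = torsionNormSq α g p := Real.sq_sqrt (h.torsionNormSq_nonneg p)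

theorem IsContactMetric.continuous_torsionNormSq (h : IsContactMetric α g) :
    Continuous (torsionNormSq α g) := by
  rw [continuous_iff_continuousAt]
  intro p
  have h1 : ContinuousAt (torsionSq (vectorFieldInChart α.reeb p) (chartMat g p))
      (extChartAt (𝓡 3) p p) :=
    ((h.local p).smooth_torsionSq.contDiffAt
      ((h.local p).isOpen.mem_nhds (mem_extChartAt_target p))).continuousAt
  refine (h1.comp (continuousAt_extChartAt (I := 𝓡 3) p)).congr ?_
  filter_upwards [extChartAt_source_mem_nhds (I := 𝓡 3) p] with q hq using (h.torsionNormSq_eq p hq).symm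

end ContactMetrics

/-! ### The Riemannian volume in charts -/

section Volume

theorem det_endMatrix (D : E3 →L[ℝ] E3) : (endMatrix D).det = D.det := by
  have h : endMatrix D = LinearMap.toMatrix (EuclideanSpace.basisFun (Fin 3) ℝ).toBasis
      (EuclideanSpace.basisFun (Fin 3) ℝ).toBasis (D : E3 →ₗ[ℝ] E3) := by
    ext i j
    simp [endMatrix, LinearMap.toMatrix_apply]
  rw [h, LinearMap.det_toMatrix]

variable {M : Type*} [TopologicalSpace M] [ChartedSpace E3 M] [IsManifold (𝓡 3) ∞ M]

theorem density_transition (g : Metric M) {x z : M} {y : E3}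
    (hy : y ∈ (extChartAt (𝓡 3) z).target)
    (hx : (extChartAt (𝓡 3) z).symm y ∈ (extChartAt (𝓡 3) x).source) :
    density (chartMat g z) y = |(fderiv ℝ (transition z x) y).det| *
      density (chartMat g x) (transition z x y) := by
  have h : chartMat g z y = (endMatrix (fderiv ℝ (transition z x) y))ᵀ *
      chartMat g x (transition z x y) * endMatrix (fderiv ℝ (transition z x) y) :=
    bilinMatrix_comp (bilinInChart_transition g.inner hy hx)
  rw [density, h, det_mul, det_mul, det_transpose, det_endMatrix, density,
    ← Real.sqrt_mul_self (abs_nonneg _), ← Real.sqrt_mul (mul_self_nonneg _), abs_mul_abs_self]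
  congr 1
  ring

theorem smoothMat_chartMat (g : Metric M) (x : M) :
    SmoothMat (extChartAt (𝓡 3) x).target (chartMat g x) :=
  smoothMat_bilin fun _ hy => (contDiffAt_chart_inner g x hy).contDiffWithinAt

theorem continuousOn_density (g : Metric M) (x : M) :
    ContinuousOn (density (chartMat g x)) (extChartAt (𝓡 3) x).target :=
  (smoothMat_chartMat g x).det.continuousOn.sqrt

omit [IsManifold (𝓡 3) ∞ M] in
theorem measurableSet_target (x : M) : MeasurableSet (extChartAt (𝓡 3) x).target :=
  (isOpen_extChartAt_target x).measurableSet

variable [MeasurableSpace M]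

theorem chartVolume_le (g : Metric M) (x : M) : chartVolume g x ≤ riemannianVolume g :=
  le_iSup (chartVolume g) x

variable [BorelSpace M]

omit [IsManifold (𝓡 3) ∞ M] in
theorem measurableSet_source (x : M) : MeasurableSet (extChartAt (𝓡 3) x).source :=
  (isOpen_extChartAt_source x).measurableSet

omit [IsManifold (𝓡 3) ∞ M] in
theorem aemeasurable_chart_symm (x : M) (f : E3 → ENNReal) :
    AEMeasurable (extChartAt (𝓡 3) x).symm
      ((volume.restrict (extChartAt (𝓡 3) x).target).withDensity f) :=
  ((continuousOn_extChartAt_symm x).aemeasurable (measurableSet_target x)).mono_ac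
    (withDensity_absolutelyContinuous _ _)

omit [IsManifold (𝓡 3) ∞ M] in
theorem measurableSet_chart_preimage (x : M) {A : Set M} (hA : MeasurableSet A) :
    MeasurableSet ((extChartAt (𝓡 3) x).target ∩ (extChartAt (𝓡 3) x).symm ⁻¹' A) := by
  have h1 : Measurable ((extChartAt (𝓡 3) x).target.domRestrict (extChartAt (𝓡 3) x).symm) :=
    (continuousOn_iff_continuous_domRestrict.mp (continuousOn_extChartAt_symm x)).measurable
  have h2 := (measurableSet_target x).subtype_image (h1 hA)
  convert h2 using 1
  ext y
  exact ⟨fun h => ⟨⟨y, h.1⟩, h.2, rfl⟩, by rintro ⟨w, hw, rfl⟩; exact ⟨w.2, hw⟩⟩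

theorem chartVolume_apply (g : Metric M) (x : M) {A : Set M} (hA : MeasurableSet A) :
    chartVolume g x A = ∫⁻ y in (extChartAt (𝓡 3) x).target ∩ (extChartAt (𝓡 3) x).symm ⁻¹' A,
      ENNReal.ofReal (density (chartMat g x) y) := by
  rw [chartVolume, Measure.map_apply_of_aemeasurable (aemeasurable_chart_symm x _) hA,
    withDensity_apply', Measure.restrict_restrict' (measurableSet_target x), inter_comm]
  rfl

theorem chartVolume_inter_source (g : Metric M) (x : M) {A : Set M} (hA : MeasurableSet A) :
    chartVolume g x (A ∩ (extChartAt (𝓡 3) x).source) = chartVolume g x A := by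
  rw [chartVolume_apply g x hA, chartVolume_apply g x (hA.inter (measurableSet_source x))]
  congr 2
  ext y
  simp only [mem_inter_iff, mem_preimage]
  exact ⟨fun h => ⟨h.1, h.2.1⟩, fun h => ⟨h.1, h.2, (extChartAt (𝓡 3) x).map_target h.1⟩⟩

/-- The volumes of two charts agree on the overlap. -/
theorem chartVolume_eq (g : Metric M) {x z : M} {A : Set M} (hA : MeasurableSet A)
    (hz : A ⊆ (extChartAt (𝓡 3) z).source) (hx : A ⊆ (extChartAt (𝓡 3) x).source) :
    chartVolume g z A = chartVolume g x A := by
  rw [chartVolume_apply g z hA, chartVolume_apply g x hA]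
  set s := (extChartAt (𝓡 3) z).target ∩ (extChartAt (𝓡 3) z).symm ⁻¹' A with hs
  have hsm : MeasurableSet s := measurableSet_chart_preimage z hA
  have himage : transition z x '' s =
      (extChartAt (𝓡 3) x).target ∩ (extChartAt (𝓡 3) x).symm ⁻¹' A := by
    ext y
    constructor
    · rintro ⟨w, ⟨hw, hwA⟩, rfl⟩
      refine ⟨(extChartAt (𝓡 3) x).map_source (hx hwA), ?_⟩
      rw [mem_preimage, transition, Function.comp_apply, (extChartAt (𝓡 3) x).left_inv (hx hwA)]
      exact hwA
    · rintro ⟨hy, hyA⟩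
      refine ⟨extChartAt (𝓡 3) z ((extChartAt (𝓡 3) x).symm y),
        ⟨(extChartAt (𝓡 3) z).map_source (hz hyA), ?_⟩, ?_⟩
      · rw [mem_preimage, (extChartAt (𝓡 3) z).left_inv (hz hyA)]
        exact hyA
      · rw [transition, Function.comp_apply, (extChartAt (𝓡 3) z).left_inv (hz hyA),
          (extChartAt (𝓡 3) x).right_inv hy]
  have hinj : InjOn (transition z x) s := by
    rintro y ⟨hy, hyA⟩ w ⟨hw, hwA⟩ h
    exact (extChartAt (𝓡 3) z).symm.injOn hy hw
      ((extChartAt (𝓡 3) x).injOn (hx hyA) (hx hwA) h)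
  rw [← himage, lintegral_image_eq_lintegral_abs_det_fderiv_mul volume hsm
    (f' := fun y => fderiv ℝ (transition z x) y) (fun y hy =>
      ((contDiffAt_transition hy.1 (hx hy.2)).differentiableAt
        (by simp)).hasFDerivAt.hasFDerivWithinAt) hinj]
  refine setLIntegral_congr_fun hsm fun y hy => ?_
  rw [density_transition g hy.1 (hx hy.2), ENNReal.ofReal_mul (abs_nonneg _)]

/-- The Riemannian volume is given by the density in each chart. -/
theorem riemannianVolume_restrict (g : Metric M) (x : M) :
    (riemannianVolume g).restrict (extChartAt (𝓡 3) x).source = chartVolume g x := by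
  have hS := measurableSet_source x
  -- It suffices to bound each chart volume. Inside the chart domain of `x` it agrees with the one
  -- of `x` on the overlap; outside, the least upper bound dominates it.
  have h1 : riemannianVolume g ≤
      chartVolume g x + (riemannianVolume g).restrict (extChartAt (𝓡 3) x).sourceᶜ := by
    refine iSup_le fun z => Measure.le_iff.mpr fun B hB => ?_
    rw [← measure_inter_add_sdiff B hS, Measure.add_apply, Measure.restrict_apply hB]
    refine add_le_add ?_ ?_
    · rw [← chartVolume_inter_source g z (hB.inter hS), chartVolume_eq g (x := x)
        ((hB.inter hS).inter (measurableSet_source z)) inter_subset_right fun y hy => hy.1.2]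
      exact measure_mono fun y hy => hy.1.1
    · rw [sdiff_eq]
      exact chartVolume_le g z _
  refine le_antisymm (Measure.le_iff.mpr fun B hB => ?_) (Measure.le_iff.mpr fun B hB => ?_)
  · rw [Measure.restrict_apply hB]
    refine (h1 _).trans ?_
    rw [Measure.add_apply, Measure.restrict_apply (hB.inter hS), inter_assoc, inter_compl_self,
      inter_empty, measure_empty, add_zero]
    exact measure_mono inter_subset_left
  · rw [← chartVolume_inter_source g x hB, Measure.restrict_apply hB]
    exact chartVolume_le g x _

theorem integral_riemannianVolume (g : Metric M) (x : M) {F : M → ℝ} (hF : Continuous F)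
    (h0 : ∀ p, p ∉ (extChartAt (𝓡 3) x).source → F p = 0) :
    ∫ p, F p ∂(riemannianVolume g) = ∫ y in (extChartAt (𝓡 3) x).target,
      density (chartMat g x) y * F ((extChartAt (𝓡 3) x).symm y) := by
  rw [← setIntegral_eq_integral_of_forall_compl_eq_zero h0, riemannianVolume_restrict, chartVolume,
    integral_map (aemeasurable_chart_symm x _) hF.aestronglyMeasurable,
    integral_withDensity_eq_integral_toReal_smul₀]
  · refine integral_congr_ae (Filter.Eventually.of_forall fun y => ?_)
    simp only [smul_eq_mul]
    rw [ENNReal.toReal_ofReal (Real.sqrt_nonneg _)]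
    rfl
  · exact ((continuousOn_density g x).aemeasurable (measurableSet_target x)).ennreal_ofReal
  · exact Filter.Eventually.of_forall fun y => ENNReal.ofReal_lt_top

/-- The density is bounded on a closed coordinate ball around each point, so the measure is locally
finite; compactness of `M` does the rest. -/
theorem isFiniteMeasure_riemannianVolume [CompactSpace M] (g : Metric M) :
    IsFiniteMeasure (riemannianVolume g) := by
  have : IsLocallyFiniteMeasure (riemannianVolume g) := by
    refine ⟨fun x => ?_⟩
    obtain ⟨r, hr, hball⟩ := Metric.isOpen_iff.mp (isOpen_extChartAt_target (I := 𝓡 3) x) _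
      (mem_extChartAt_target x)
    have hKt : Metric.closedBall (extChartAt (𝓡 3) x x) (r / 2) ⊆ (extChartAt (𝓡 3) x).target :=
      (Metric.closedBall_subset_ball (by linarith)).trans hball
    have hK : IsCompact (Metric.closedBall (extChartAt (𝓡 3) x x) (r / 2)) :=
      isCompact_closedBall _ _
    set U := (extChartAt (𝓡 3) x).source ∩
      extChartAt (𝓡 3) x ⁻¹' Metric.ball (extChartAt (𝓡 3) x x) (r / 2) with hU
    have hUo : IsOpen U := (continuousOn_extChartAt x).isOpen_inter_preimage
      (isOpen_extChartAt_source x) Metric.isOpen_ball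
    refine ⟨U, hUo.mem_nhds ⟨mem_extChartAt_source x, Metric.mem_ball_self (by positivity)⟩, ?_⟩
    have h1 : riemannianVolume g U = chartVolume g x U := by
      rw [← riemannianVolume_restrict, Measure.restrict_apply hUo.measurableSet,
        inter_eq_left.mpr inter_subset_left]
    rw [h1, chartVolume_apply g x hUo.measurableSet]
    obtain ⟨C, hC⟩ := hK.exists_bound_of_continuousOn ((continuousOn_density g x).mono hKt)
    have h2 : (extChartAt (𝓡 3) x).target ∩ (extChartAt (𝓡 3) x).symm ⁻¹' U ⊆
        Metric.closedBall (extChartAt (𝓡 3) x x) (r / 2) := by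
      rintro y ⟨hy, -, hyb⟩
      rw [mem_preimage, (extChartAt (𝓡 3) x).right_inv hy] at hyb
      exact Metric.ball_subset_closedBall hyb
    refine (lintegral_mono_set h2).trans_lt ?_
    refine (setLIntegral_mono' hK.measurableSet (g := fun _ => ENNReal.ofReal C)
      fun y hy => ENNReal.ofReal_le_ofReal ((le_abs_self _).trans (hC y hy))).trans_lt ?_
    rw [setLIntegral_const]
    exact ENNReal.mul_lt_top ENNReal.ofReal_lt_top hK.measure_lt_top
  exact CompactSpace.isFiniteMeasure

-- By `Adapted.det_eq` the density depends only on `α`, so only the torsion varies in the energy.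
omit [BorelSpace M] in
theorem riemannianVolume_eq {α : ContactForm M} {g g' : Metric M} (h : IsContactMetric α g)
    (h' : IsContactMetric α g') : riemannianVolume g = riemannianVolume g' := by
  refine iSup_congr fun x => ?_
  rw [chartVolume, chartVolume]
  congr 1
  refine withDensity_congr_ae (ae_restrict_of_forall_mem (measurableSet_target x) fun y hy => ?_)
  have h1 := (h.adapted_chart x hy).det_eq
  have h2 := (h'.adapted_chart x hy).det_eq
  rw [chartMat] at h1 h2
  simp only [h1, h2]

/-- The difference of the energies of two contact metrics that agree outside a chart. -/
theorem dirichletEnergy_sub [CompactSpace M] {α : ContactForm M} {g g' : Metric M}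
    (h : IsContactMetric α g) (h' : IsContactMetric α g') (x : M)
    (h0 : ∀ p, p ∉ (extChartAt (𝓡 3) x).source → torsionNormSq α g' p = torsionNormSq α g p) :
    dirichletEnergy α g' - dirichletEnergy α g =
      1 / 2 * ∫ y in (extChartAt (𝓡 3) x).target, density (chartMat g x) y *
        (torsionSq (vectorFieldInChart α.reeb x) (chartMat g' x) y -
          torsionSq (vectorFieldInChart α.reeb x) (chartMat g x) y) := by
  have hfin := isFiniteMeasure_riemannianVolume g
  -- Integrability is needed to combine the two energies into one integral, which is then supported
  -- in the chart.
  have hi : ∀ {k : Metric M}, IsContactMetric α k →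
      Integrable (torsionNormSq α k) (riemannianVolume g) := fun hk =>
    hk.continuous_torsionNormSq.integrable_of_hasCompactSupport
      (HasCompactSupport.of_compactSpace _)
  rw [dirichletEnergy, dirichletEnergy, riemannianVolume_eq h' h, ← mul_sub]
  simp only [h.scalarTorsion_sq, h'.scalarTorsion_sq]
  rw [← integral_sub (hi h') (hi h), integral_riemannianVolume g x
    (F := fun p => torsionNormSq α g' p - torsionNormSq α g p) (h'.continuous_torsionNormSq.sub h.continuous_torsionNormSq)
    fun p hp => by rw [h0 p hp, sub_self]]
  congr 1
  refine setIntegral_congr_fun (measurableSet_target x) fun y hy => ?_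
  rw [h.torsionNormSq_chart x hy, h'.torsionNormSq_chart x hy]

end Volume

/-! ### Bilinear forms with a given matrix -/

section MatrixForms

/-- The bilinear form with a given matrix. -/
def matBilin (A : Mat3) : E3 →L[ℝ] E3 →L[ℝ] ℝ :=
  ∑ i, ∑ j, A i j • (EuclideanSpace.proj i : E3 →L[ℝ] ℝ).smulRight (EuclideanSpace.proj j : E3 →L[ℝ] ℝ)

theorem matBilin_apply (A : Mat3) (u v : E3) : matBilin A u v = u.ofLp ⬝ᵥ A *ᵥ v.ofLp := by
  simp only [matBilin, _root_.sum_apply, _root_.smul_apply, ContinuousLinearMap.smulRight_apply,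
    smul_eq_mul, dotProduct, mulVec, Finset.mul_sum]
  refine Finset.sum_congr rfl fun i _ => Finset.sum_congr rfl fun j _ => ?_
  change A i j * (u i * v j) = u i * (A i j * v j)
  ring

theorem matBilin_sub (A B : Mat3) : matBilin (A - B) = matBilin A - matBilin B := by
  ext u v
  simp [matBilin_apply, Matrix.sub_mulVec]

theorem matBilin_bilinMatrix (b : E3 →L[ℝ] E3 →L[ℝ] ℝ) : matBilin (bilinMatrix b) = b := by
  ext u v
  rw [matBilin_apply, bilin_apply]

theorem bilinMatrix_matBilin (A : Mat3) : bilinMatrix (matBilin A) = A := by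
  ext i j
  rw [bilinMatrix_apply, matBilin_apply]
  simp

theorem SmoothMat.matBilin {F : Type*} [NormedAddCommGroup F] [NormedSpace ℝ F] {S : Set F}
    {A : F → Mat3} (hA : SmoothMat S A) : ContDiffOn ℝ ∞ (fun y => matBilin (A y)) S :=
  ContDiffOn.sum fun i _ => ContDiffOn.sum fun j _ =>
    ContDiffOn.clm_apply (f := fun _ => ContinuousLinearMap.toSpanSingleton ℝ
      ((EuclideanSpace.proj i : E3 →L[ℝ] ℝ).smulRight (EuclideanSpace.proj j : E3 →L[ℝ] ℝ)))
      contDiffOn_const (hA i j)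

/-- Needed as a field of the metric structure. By homogeneity, the minimum of `b` on the unit sphere
bounds `b(v, v)` below by a multiple of `‖v‖²`. -/
theorem isVonNBounded_of_pos {b : E3 →L[ℝ] E3 →L[ℝ] ℝ} (hb : ∀ v, v ≠ 0 → 0 < b v v) :
    Bornology.IsVonNBounded ℝ {v : E3 | b v v < 1} := by
  have hc : Continuous fun v : E3 => b v v := b.continuous.clm_apply continuous_id
  obtain ⟨w, hw, hmin⟩ := (isCompact_sphere (0 : E3) 1).exists_isMinOn
    (NormedSpace.sphere_nonempty.mpr zero_le_one) hc.continuousOn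
  have hw0 : w ≠ 0 := by
    rintro rfl
    simp at hw
  have hm := hb w hw0
  have key : ∀ v : E3, b w w * (‖v‖ * ‖v‖) ≤ b v v := by
    intro v
    by_cases hv : v = 0
    · simp [hv]
    have hn : ‖v‖ ≠ 0 := norm_ne_zero_iff.mpr hv
    have h1 : ‖v‖⁻¹ • v ∈ Metric.sphere (0 : E3) 1 := by
      simp [norm_smul, hn]
    have h2 : b w w ≤ b (‖v‖⁻¹ • v) (‖v‖⁻¹ • v) := hmin h1
    simp only [map_smul, _root_.smul_apply, smul_eq_mul] at h2
    have h3 : 0 ≤ ‖v‖ * ‖v‖ := mul_self_nonneg _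
    calc b w w * (‖v‖ * ‖v‖) ≤ (‖v‖⁻¹ * (‖v‖⁻¹ * b v v)) * (‖v‖ * ‖v‖) :=
          mul_le_mul_of_nonneg_right h2 h3
      _ = b v v := by field_simp
  rw [NormedSpace.isVonNBounded_iff, isBounded_iff_forall_norm_le]
  -- From `r² ≤ c` follows `r ≤ 1 + c`, which avoids a square root.
  refine ⟨1 + 1 / b w w, fun v hv => ?_⟩
  have h1 : b w w * (‖v‖ * ‖v‖) ≤ 1 := (key v).trans (le_of_lt hv)
  have h2 : ‖v‖ * ‖v‖ ≤ 1 / b w w := by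
    rw [le_div_iff₀ hm]
    linarith
  nlinarith [norm_nonneg v, mul_self_nonneg (‖v‖ - 1)]

end MatrixForms

/-! ### Gluing a local deformation into `M` -/

section Variation

variable {M : Type*} [TopologicalSpace M] [ChartedSpace E3 M] [IsManifold (𝓡 3) ∞ M]

theorem metric_ext {g g' : Metric M} (h : ∀ p, g.inner p = g'.inner p) : g = g' := by
  have h' : g.inner = g'.inner := funext h
  cases g
  cases g'
  cases h'
  rfl

theorem inverse_frame_apply (x : M) {y : E3} (hy : y ∈ (extChartAt (𝓡 3) x).target) (u : E3) :
    (frame x y).inverse (frame x y u) = u := (isInvertible_frame x hy).inverse_apply_self u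

/-- The bilinear form on `TM` that has the matrix `N` in the chart at `x` and vanishes outside. -/
def chartForm (x : M) (N : E3 → Mat3) (p : M) : E3 →L[ℝ] E3 →L[ℝ] ℝ :=
  (extChartAt (𝓡 3) x).source.indicator (fun p =>
    (matBilin (N (extChartAt (𝓡 3) x p))).bilinearComp (frame x (extChartAt (𝓡 3) x p)).inverse
      (frame x (extChartAt (𝓡 3) x p)).inverse) p

/-- The modification of a bilinear form in a chart. -/
def modifiedForm (b : ∀ p : M, TangentSpace (𝓡 3) p →L[ℝ] TangentSpace (𝓡 3) p →L[ℝ] ℝ)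
    (x : M) (N : E3 → Mat3) (p : M) : TangentSpace (𝓡 3) p →L[ℝ] TangentSpace (𝓡 3) p →L[ℝ] ℝ :=
  let B : E3 →L[ℝ] E3 →L[ℝ] ℝ := b p
  B + chartForm x (fun y => N y - bilinMatrix (bilinInChart b x y)) p

variable {b : ∀ p : M, TangentSpace (𝓡 3) p →L[ℝ] TangentSpace (𝓡 3) p →L[ℝ] ℝ}
  {x : M} {N : E3 → Mat3}

theorem modifiedForm_chart {y : E3} (hy : y ∈ (extChartAt (𝓡 3) x).target) :
    bilinInChart (modifiedForm b x N) x y = matBilin (N y) := by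
  ext u v
  have h1 : (chartForm x (fun y => N y - bilinMatrix (bilinInChart b x y))
      ((extChartAt (𝓡 3) x).symm y)) (frame x y u) (frame x y v) =
      matBilin (N y - bilinMatrix (bilinInChart b x y)) u v := by
    rw [chartForm, indicator_of_mem ((extChartAt (𝓡 3) x).map_target hy),
      ContinuousLinearMap.bilinearComp_apply, (extChartAt (𝓡 3) x).right_inv hy,
      inverse_frame_apply x hy, inverse_frame_apply x hy]
  have h2 : bilinInChart (modifiedForm b x N) x y u v = bilinInChart b x y u v +
      matBilin (N y - bilinMatrix (bilinInChart b x y)) u v := by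
    rw [← h1]; rfl
  rw [h2, matBilin_sub, matBilin_bilinMatrix]
  simp

omit [IsManifold (𝓡 3) ∞ M] in
theorem modifiedForm_of_notMem {K : Set E3}
    (hN : ∀ y, y ∉ K → N y = bilinMatrix (bilinInChart b x y)) {p : M}
    (hp : p ∉ (extChartAt (𝓡 3) x).symm '' K) : modifiedForm b x N p = b p := by
  have : chartForm x (fun y => N y - bilinMatrix (bilinInChart b x y)) p = 0 := by
    by_cases hs : p ∈ (extChartAt (𝓡 3) x).source
    · have hk : extChartAt (𝓡 3) x p ∉ K := fun hk =>
        hp ⟨_, hk, (extChartAt (𝓡 3) x).left_inv hs⟩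
      rw [chartForm, indicator_of_mem hs, hN _ hk, sub_self]
      ext u v
      change matBilin 0 _ _ = 0
      rw [matBilin_apply, zero_mulVec, dotProduct_zero]
    · exact indicator_of_notMem hs _
  rw [modifiedForm, this]
  exact add_zero (b p : E3 →L[ℝ] E3 →L[ℝ] ℝ)

/-- A property of bilinear forms that is invariant under frame changes can be checked in the chart. -/
theorem modifiedForm_induction {P : (E3 →L[ℝ] E3 →L[ℝ] ℝ) → Prop} {K : Set E3}
    (hKt : K ⊆ (extChartAt (𝓡 3) x).target)
    (hN : ∀ y, y ∉ K → N y = bilinMatrix (bilinInChart b x y)) (hb : ∀ p, P (b p))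
    (hP : ∀ y ∈ (extChartAt (𝓡 3) x).target, ∀ B : E3 →L[ℝ] E3 →L[ℝ] ℝ,
      (∀ u v, B (frame x y u) (frame x y v) = matBilin (N y) u v) → P B) (p : M) :
    P (modifiedForm b x N p) := by
  by_cases hp : p ∈ (extChartAt (𝓡 3) x).symm '' K
  · obtain ⟨y, hy, rfl⟩ := hp
    refine hP y (hKt hy) _ fun u v => ?_
    rw [← modifiedForm_chart (b := b) (hKt hy)]
    rfl
  · rw [modifiedForm_of_notMem hN hp]
    exact hb p

theorem frame_surjective (x : M) {y : E3} (hy : y ∈ (extChartAt (𝓡 3) x).target) :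
    Function.Surjective (frame x y) := fun v => ⟨_, (isInvertible_frame x hy).self_apply_inverse v⟩

variable [T2Space M]

/-- A family of bilinear forms that is modified smoothly in a compact part of a chart is smooth. -/
theorem contMDiff_modifiedForm {g : Metric M} {N : ℝ → E3 → Mat3} {K : Set E3} (hK : IsCompact K)
    (hKt : K ⊆ (extChartAt (𝓡 3) x).target)
    (hN : ∀ t y, y ∉ K → N t y = bilinMatrix (bilinInChart g.inner x y))
    (hs : SmoothMat (LocalContactMetric.prodSet (extChartAt (𝓡 3) x).target)
      fun r : ℝ × E3 => N r.1 r.2) :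
    ContMDiff ((𝓘(ℝ, ℝ)).prod (𝓡 3)) ((𝓡 3).prod 𝓘(ℝ, E3 →L[ℝ] E3 →L[ℝ] ℝ)) ∞
      (fun q : ℝ × M => (TotalSpace.mk' (E3 →L[ℝ] E3 →L[ℝ] ℝ) q.2 (modifiedForm g.inner x (N q.1) q.2) :
        TotalSpace (E3 →L[ℝ] E3 →L[ℝ] ℝ)
          (fun p : M => TangentSpace (𝓡 3) p →L[ℝ] TangentSpace (𝓡 3) p →L[ℝ] ℝ))) := by
  rintro ⟨t, p⟩
  by_cases hp : p ∈ (extChartAt (𝓡 3) x).source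
  · have hp' : p ∈ (chartAt E3 x).source := by rwa [extChartAt_source] at hp
    rw [contMDiffAt_bilin_iff (fun t => modifiedForm g.inner x (N t)) x hp' t]
    have ht : extChartAt (𝓡 3) x p ∈ (extChartAt (𝓡 3) x).target := (extChartAt (𝓡 3) x).map_source hp
    have hn : LocalContactMetric.prodSet (extChartAt (𝓡 3) x).target ∈ 𝓝 (t, extChartAt (𝓡 3) x p) :=
      (isOpen_univ.prod (isOpen_extChartAt_target x)).mem_nhds ⟨mem_univ _, ht⟩
    refine (hs.matBilin.contDiffAt hn).congr_of_eventuallyEq ?_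
    filter_upwards [hn] with r hr using modifiedForm_chart hr.2
  -- Away from the chart domain, the image of `K` is compact, hence closed in the Hausdorff space
  -- `M`; near `p` the form is unchanged.
  · have hK' : IsClosed ((extChartAt (𝓡 3) x).symm '' K) :=
      (hK.image_of_continuousOn ((continuousOn_extChartAt_symm x).mono hKt)).isClosed
    have hpK : p ∉ (extChartAt (𝓡 3) x).symm '' K := by
      rintro ⟨y, hy, rfl⟩
      exact hp ((extChartAt (𝓡 3) x).map_target (hKt hy))
    have hg := (g.contMDiff p).comp (t, p) (contMDiffAt_snd (I := 𝓘(ℝ, ℝ)))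
    refine hg.congr_of_eventuallyEq ?_
    filter_upwards [continuousAt_snd.eventually (hK'.isOpen_compl.mem_nhds hpK)] with q hq
    rw [modifiedForm_of_notMem (hN q.1) hq]
    rfl

/-- The metric with the matrix `N` in the chart at `x`. -/
def modifiedMetric (g : Metric M) (x : M) (N : E3 → Mat3) {K : Set E3} (hK : IsCompact K)
    (hKt : K ⊆ (extChartAt (𝓡 3) x).target) (hN : ∀ y, y ∉ K → N y = chartMat g x y)
    (hs : SmoothMat (extChartAt (𝓡 3) x).target N)
    (hsymm : ∀ y ∈ (extChartAt (𝓡 3) x).target, (N y)ᵀ = N y)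
    (hpos : ∀ y ∈ (extChartAt (𝓡 3) x).target, ∀ v : Fin 3 → ℝ, v ≠ 0 → 0 < v ⬝ᵥ N y *ᵥ v) :
    Metric M :=
  have hp : ∀ (p : M) (v : TangentSpace (𝓡 3) p), v ≠ 0 → 0 < modifiedForm g.inner x N p v v :=
    modifiedForm_induction (P := fun B => ∀ v, v ≠ 0 → 0 < B v v) hKt hN g.pos
      fun _ hy B hB v hv => by
        obtain ⟨w, rfl⟩ := frame_surjective x hy v
        rw [hB, matBilin_apply]
        refine hpos _ hy _ fun h0 => hv ?_
        rw [show w = 0 by simpa using h0, map_zero]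
  { inner := modifiedForm g.inner x N
    symm := modifiedForm_induction (P := fun B => ∀ u v, B u v = B v u) hKt hN g.symm
      fun y hy B hB u v => by
        obtain ⟨u, rfl⟩ := frame_surjective x hy u
        obtain ⟨v, rfl⟩ := frame_surjective x hy v
        rw [hB, hB]
        exact bilin_symm_iff.mp (by rw [bilinMatrix_matBilin, hsymm y hy]) u v
    pos := hp
    isVonNBounded := fun p => isVonNBounded_of_pos (hp p)
    contMDiff := fun p => (contMDiff_modifiedForm (x := x) hK hKt (N := fun _ => N) (fun _ => hN)
      (hs.comp contDiffOn_snd LocalContactMetric.mapsTo_snd) ((0 : ℝ), p)).comp p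
      (f := fun q => ((0 : ℝ), q)) (contMDiffAt_const.prodMk contMDiffAt_id) }

end Variation

/-! ### The Euler–Lagrange equation on `M` -/

section Criticality

variable {M : Type*} [TopologicalSpace M] [ChartedSpace E3 M] [IsManifold (𝓡 3) ∞ M]
  {α : ContactForm M} {g : Metric M}

theorem adapted_of_chart (α : ContactForm M) (g : Metric M) (x : M) {y : E3}
    (hy : y ∈ (extChartAt (𝓡 3) x).target)
    (h : Adapted (chartMat g x y) (dmat (oneFormInChart α.form x) y)
      (covec (oneFormInChart α.form x) y)) :
    Adapted (metricMat g ((extChartAt (𝓡 3) x).symm y)) (formMat α ((extChartAt (𝓡 3) x).symm y))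
      (formCov α ((extChartAt (𝓡 3) x).symm y)) := by
  have hD := isUnit_frameMat x hy
  have e1 : frameMat x y * (frameMat x y)⁻¹ = 1 := mul_nonsing_inv _ hD
  have e2 : ((frameMat x y)⁻¹)ᵀ * (frameMat x y)ᵀ = 1 := by rw [← transpose_mul, e1, transpose_one]
  have e3 : ∀ B : Mat3, ((frameMat x y)⁻¹)ᵀ * ((frameMat x y)ᵀ * B * frameMat x y) *
      (frameMat x y)⁻¹ = B := fun B => by
    calc _ = (((frameMat x y)⁻¹)ᵀ * (frameMat x y)ᵀ) * B * (frameMat x y * (frameMat x y)⁻¹) := by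
          simp only [Matrix.mul_assoc]
      _ = B := by rw [e1, e2, Matrix.one_mul, Matrix.mul_one]
  have := h.congr (D := (frameMat x y)⁻¹) (isUnit_nonsing_inv_det _ hD)
  rwa [chartMat_eq, dmat_eq α x hy, covec_eq, e3, e3, mulVec_mulVec, e2, one_mulVec] at this

theorem torsionNormSq_congr {g' : Metric M} (h : IsContactMetric α g) (h' : IsContactMetric α g')
    {p : M} (hp : ∀ᶠ q in 𝓝 p, g'.inner q = g.inner q) :
    torsionNormSq α g' p = torsionNormSq α g p := by
  rw [h.torsionNormSq_eq p (mem_extChartAt_source p), h'.torsionNormSq_eq p (mem_extChartAt_source p)]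
  refine LocalContactMetric.torsionSq_congr ?_
  have hc := (contMDiffAt_chart_symm p (mem_extChartAt_target p)).continuousAt
  rw [ContinuousAt, extChartAt_to_inv] at hc
  filter_upwards [hc.eventually hp] with z hz
  rw [chartMat, chartMat, bilinInChart, bilinInChart, hz]

variable [T2Space M] [CompactSpace M] [MeasurableSpace M] [BorelSpace M]

/-- Critical contact metrics satisfy the Euler–Lagrange equation. -/
theorem IsCriticalContactMetric.eulerLagrange (h : IsCriticalContactMetric α g) (x : M) {y : E3}
    (hy : y ∈ (extChartAt (𝓡 3) x).target) :
    ContactThree.eulerLagrange (oneFormInChart α.form x) (vectorFieldInChart α.reeb x)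
      (chartMat g x) y = 0 := by
  obtain ⟨hg, hcrit⟩ := h
  have hL := hg.local x
  refine hL.eulerLagrange_eq_zero hy fun b K hb hadm hK hKt hb0 => ?_
  set N : ℝ → E3 → Mat3 := defMetric (oneFormInChart α.form x) (chartMat g x) b with hN
  have hN0 : ∀ t y, y ∉ K → N t y = chartMat g x y := fun t y hy =>
    LocalContactMetric.defMetric_of_zero t (hb0 y hy)
  have hd := fun t => hL.deformation hb hadm t
  -- The local deformation, extended by `g`. The criticality hypothesis applies to this family.
  set γ : ℝ → Metric M := fun t => modifiedMetric g x (N t) hK hKt (hN0 t) (hd t).smooth_metric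
    (fun y hy => ((hd t).adapted y hy).symm) (fun y hy => ((hd t).adapted y hy).pos) with hγ
  have hchart : ∀ t, ∀ y ∈ (extChartAt (𝓡 3) x).target, chartMat (γ t) x y = N t y := fun t y hy => by
    have : bilinInChart (γ t).inner x y = matBilin (N t y) :=
      modifiedForm_chart (b := g.inner) hy
    rw [chartMat, this, bilinMatrix_matBilin]
  have hout : ∀ t, ∀ p, p ∉ (extChartAt (𝓡 3) x).symm '' K → (γ t).inner p = g.inner p :=
    fun t p hp => modifiedForm_of_notMem (hN0 t) hp
  have hcontact : ∀ t, IsContactMetric α (γ t) := fun t => isContactMetric_of_adapted fun p => by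
    by_cases hp : p ∈ (extChartAt (𝓡 3) x).symm '' K
    · obtain ⟨y, hy, rfl⟩ := hp
      refine adapted_of_chart α _ x (hKt hy) ?_
      rw [hchart t y (hKt hy)]
      exact (hd t).adapted y (hKt hy)
    · rw [metricMat, hout t p hp]
      exact hg.adapted p
  have hsmooth : IsSmoothFamily γ :=
    contMDiff_modifiedForm hK hKt hN0 (hL.smooth_defMetric hb hadm)
  have hγ0 : γ 0 = g := metric_ext fun p => by
    have e : N 0 = chartMat g x := funext fun y => defMetric_zero
    change modifiedForm g.inner x (N 0) p = g.inner p
    -- At `t = 0` the chart matrix is that of `g` everywhere, so the empty set serves as the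
    -- modified region.
    exact modifiedForm_of_notMem (K := ∅) (fun y _ => by rw [e]; rfl) (by simp)
  have hK' : IsClosed ((extChartAt (𝓡 3) x).symm '' K) :=
    (hK.image_of_continuousOn ((continuousOn_extChartAt_symm x).mono hKt)).isClosed
  -- The factor `2` undoes the `1/2` in the energy.
  have henergy : ∀ t, (∫ y, density (chartMat g x) y *
      (torsionSq (vectorFieldInChart α.reeb x) (N t) y -
        torsionSq (vectorFieldInChart α.reeb x) (chartMat g x) y)) =
      2 * (dirichletEnergy α (γ t) - dirichletEnergy α g) := fun t => by
    rw [dirichletEnergy_sub hg (hcontact t) x fun p hp => ?_]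
    · rw [← mul_assoc, ← setIntegral_eq_integral_of_forall_compl_eq_zero
        (s := (extChartAt (𝓡 3) x).target) fun y hy => ?_]
      · rw [show (2 : ℝ) * (1 / 2) = 1 by norm_num, one_mul]
        refine setIntegral_congr_fun (measurableSet_target x) fun y hy => ?_
        have : torsionSq (vectorFieldInChart α.reeb x) (chartMat (γ t) x) y =
            torsionSq (vectorFieldInChart α.reeb x) (N t) y :=
          LocalContactMetric.torsionSq_congr (by
            filter_upwards [hL.eventually_mem hy] with z hz using hchart t z hz)
        rw [this]
      · rw [LocalContactMetric.torsionSq_defMetric_of_zero hK.isClosed hb0 fun hk => hy (hKt hk),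
          sub_self, mul_zero]
    · refine torsionNormSq_congr hg (hcontact t) ?_
      have hpK : p ∉ (extChartAt (𝓡 3) x).symm '' K := by
        rintro ⟨y, hy, rfl⟩
        exact hp ((extChartAt (𝓡 3) x).map_target (hKt hy))
      filter_upwards [hK'.isOpen_compl.mem_nhds hpK] with q hq using hout t q hq
  simp only [henergy]
  have := ((hcrit γ hcontact hsmooth hγ0).sub_const (dirichletEnergy α g)).const_mul 2
  simpa using this

end Criticality

/-! ### Global maximum principle and conclusion -/

section Constancy

theorem dotProduct_inv_congr {D : Mat3} (hD : IsUnit D.det) (G : Mat3) (v : Fin 3 → ℝ) :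
    (Dᵀ *ᵥ v) ⬝ᵥ ((Dᵀ * G * D)⁻¹ *ᵥ (Dᵀ *ᵥ v)) = v ⬝ᵥ (G⁻¹ *ᵥ v) := by
  have e1 : D * D⁻¹ = 1 := mul_nonsing_inv _ hD
  have e2 : (D⁻¹)ᵀ * Dᵀ = 1 := by rw [← transpose_mul, e1, transpose_one]
  have hinv : (Dᵀ * G * D)⁻¹ = D⁻¹ * G⁻¹ * (D⁻¹)ᵀ := by
    rw [Matrix.mul_inv_rev, Matrix.mul_inv_rev, transpose_nonsing_inv, Matrix.mul_assoc]
  rw [hinv, ← mulVec_mulVec, mulVec_mulVec _ (D⁻¹)ᵀ, e2, one_mulVec, ← transpose_mulVec_dotProduct,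
    mulVec_mulVec, ← Matrix.mul_assoc, e1, Matrix.one_mul]

variable {M : Type*} [TopologicalSpace M] [ChartedSpace E3 M] [IsManifold (𝓡 3) ∞ M]
  {α : ContactForm M} {g : Metric M}

/-- The squared scalar torsion in the coordinates of the chart at `x`. -/
def chartTorsionSq (α : ContactForm M) (g : Metric M) (x : M) : E3 → ℝ :=
  torsionSq (vectorFieldInChart α.reeb x) (chartMat g x)

/-- The squared norm of the differential of the squared scalar torsion. -/
def diffNormSq (α : ContactForm M) (g : Metric M) (p : M) : ℝ :=
  gradSq (chartMat g p) (chartTorsionSq α g p) (extChartAt (𝓡 3) p p)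

/-- The global function uses a different chart at each point. Since `|df|²` is invariant under
transitions, one chart describes it near a maximum. -/
theorem IsContactMetric.diffNormSq_chart (h : IsContactMetric α g) (x : M) {y : E3}
    (hy : y ∈ (extChartAt (𝓡 3) x).target) :
    gradSq (chartMat g x) (chartTorsionSq α g x) y =
      diffNormSq α g ((extChartAt (𝓡 3) x).symm y) := by
  set q := (extChartAt (𝓡 3) x).symm y with hq
  have hqs : (extChartAt (𝓡 3) x).symm y ∈ (extChartAt (𝓡 3) q).source := mem_extChartAt_source q
  set T := transition x q with hT
  have hqt : T y ∈ (extChartAt (𝓡 3) q).target := (extChartAt (𝓡 3) q).map_source hqs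
  have hG : chartMat g x y = (endMatrix (fderiv ℝ T y))ᵀ * chartMat g q (T y) *
      endMatrix (fderiv ℝ T y) := bilinMatrix_comp (bilinInChart_transition g.inner hy hqs)
  have hD : IsUnit (endMatrix (fderiv ℝ T y)).det := isUnit_det_endMatrix fun u v huv => by
    apply frame_injective x hy
    rw [← frame_transition hy hqs, ← frame_transition hy hqs, ← hT, huv]
  have hF : chartTorsionSq α g x =ᶠ[𝓝 y] chartTorsionSq α g q ∘ T := by
    filter_upwards [eventually_mem_chart hy hqs] with z hz
    exact (h.torsionNormSq_chart x hz.1).symm.trans (h.torsionNormSq_eq q hz.2)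
  have hd : HasFDerivAt (chartTorsionSq α g x) ((fderiv ℝ (chartTorsionSq α g q) (T y)).comp
      (fderiv ℝ T y)) y := by
    refine HasFDerivAt.congr_of_eventuallyEq (HasFDerivAt.comp
      (g := chartTorsionSq α g q) (g' := fderiv ℝ (chartTorsionSq α g q) (T y)) y ?_ ?_) hF
    · exact (((h.local q).smooth_torsionSq.contDiffAt
        ((h.local q).isOpen.mem_nhds hqt)).differentiableAt (by simp)).hasFDerivAt
    · exact ((contDiffAt_transition hy hqs).differentiableAt (by simp)).hasFDerivAt
  have hgrad : grad (chartTorsionSq α g x) y =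
      (endMatrix (fderiv ℝ T y))ᵀ *ᵥ grad (chartTorsionSq α g q) (T y) :=
    formVec_comp (c := fderiv ℝ (chartTorsionSq α g x) y)
      (a := fderiv ℝ (chartTorsionSq α g q) (T y)) fun u => by rw [hd.fderiv]; rfl
  rw [gradSq_eq, hG, hgrad, dotProduct_inv_congr hD, ← gradSq_eq]
  rfl

theorem IsContactMetric.diffNormSq_eq (h : IsContactMetric α g) (x : M) {p : M}
    (hp : p ∈ (extChartAt (𝓡 3) x).source) : diffNormSq α g p =
      gradSq (chartMat g x) (chartTorsionSq α g x) (extChartAt (𝓡 3) x p) := by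
  rw [h.diffNormSq_chart x ((extChartAt (𝓡 3) x).map_source hp), (extChartAt (𝓡 3) x).left_inv hp]

theorem IsContactMetric.continuous_diffNormSq (h : IsContactMetric α g) :
    Continuous (diffNormSq α g) := by
  rw [continuous_iff_continuousAt]
  intro p
  have h1 : ContinuousAt (gradSq (chartMat g p) (chartTorsionSq α g p)) (extChartAt (𝓡 3) p p) :=
    ((h.local p).smooth_gradSq.contDiffAt
      ((h.local p).isOpen.mem_nhds (mem_extChartAt_target p))).continuousAt
  refine (h1.comp (continuousAt_extChartAt (I := 𝓡 3) p)).congr ?_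
  filter_upwards [extChartAt_source_mem_nhds (I := 𝓡 3) p] with q hq using (h.diffNormSq_eq p hq).symm

theorem IsContactMetric.diffNormSq_nonneg (h : IsContactMetric α g) (p : M) :
    0 ≤ diffNormSq α g p := by
  rw [diffNormSq, gradSq_eq]
  exact ((h.local p).adapted _ (mem_extChartAt_target p)).dotProduct_inv_nonneg _

theorem grad_eq_zero_iff {f : E3 → ℝ} {y : E3} : grad f y = 0 ↔ fderiv ℝ f y = 0 := by
  constructor
  · intro h0
    ext v
    rw [fderiv_eq_sum]
    exact Finset.sum_eq_zero fun i _ => by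
      have : fderiv ℝ f y (stdVec i) = 0 := congrFun h0 i
      rw [this, mul_zero]
  · intro h0
    ext i
    rw [grad, h0]
    rfl

/-- The maximum principle for the differential of the squared scalar torsion. -/
theorem IsContactMetric.diffNormSq_eq_zero [CompactSpace M] (h : IsContactMetric α g)
    (hEL : ∀ (x : M), ∀ y ∈ (extChartAt (𝓡 3) x).target,
      eulerLagrange (oneFormInChart α.form x) (vectorFieldInChart α.reeb x) (chartMat g x) y = 0)
    (p : M) : diffNormSq α g p = 0 := by
  obtain ⟨m, -, hm⟩ := isCompact_univ.exists_isMaxOn ⟨p, mem_univ p⟩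
    h.continuous_diffNormSq.continuousOn
  have hmax : ∀ q, diffNormSq α g q ≤ diffNormSq α g m := fun q => hm (mem_univ q)
  have hL := h.local m
  have hy := mem_extChartAt_target (I := 𝓡 3) m
  set y := extChartAt (𝓡 3) m m with hydef
  suffices h0 : diffNormSq α g m = 0 from le_antisymm ((hmax p).trans h0.le) (h.diffNormSq_nonneg p)
  have h1 : chartTorsionSq α g m y * diffNormSq α g m ≤ 0 :=
    hL.torsionSq_mul_gradSq_nonpos (hEL m) hy (by
      filter_upwards [hL.eventually_mem hy] with z hz
      exact (h.diffNormSq_chart m hz).trans_le (hmax _))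
  have h2 : 0 ≤ chartTorsionSq α g m y := hL.torsionSq_nonneg hy
  -- Where the torsion vanishes, the inequality is empty; but there the nonnegative squared torsion
  -- has a minimum, so its differential vanishes anyway.
  rcases h2.eq_or_lt with h3 | h3
  · have hmin : IsLocalMin (chartTorsionSq α g m) y := by
      filter_upwards [hL.eventually_mem hy] with z hz
      rw [← h3]
      exact hL.torsionSq_nonneg hz
    have h4 := grad_eq_zero_iff.mpr hmin.fderiv_eq_zero
    rw [diffNormSq, gradSq_eq, h4, zero_dotProduct]
  · exact le_antisymm (nonpos_of_mul_nonpos_right h1 h3) (h.diffNormSq_nonneg m)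

theorem IsContactMetric.isLocallyConstant (h : IsContactMetric α g)
    (h0 : ∀ p, diffNormSq α g p = 0) : IsLocallyConstant (torsionNormSq α g) := by
  rw [IsLocallyConstant.iff_eventually_eq]
  intro p
  have hL := h.local p
  have hy := mem_extChartAt_target (I := 𝓡 3) p
  obtain ⟨r, hr, hball⟩ := Metric.isOpen_iff.mp hL.isOpen _ hy
  have hconst : ∀ z ∈ Metric.ball (extChartAt (𝓡 3) p p) r,
      chartTorsionSq α g p z = chartTorsionSq α g p (extChartAt (𝓡 3) p p) := fun z hz =>
    Metric.isOpen_ball.is_const_of_fderiv_eq_zero (convex_ball _ r).isPreconnected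
      ((hL.smooth_torsionSq.differentiableOn (by simp)).mono hball) (fun w hw => by
        have h1 := h.diffNormSq_chart p (hball hw)
        rw [h0, gradSq_eq] at h1
        exact grad_eq_zero_iff.mp ((hL.adapted w (hball hw)).eq_zero_of_dotProduct_inv h1))
      hz (Metric.mem_ball_self hr)
  filter_upwards [extChartAt_source_mem_nhds (I := 𝓡 3) p,
    (continuousAt_extChartAt (I := 𝓡 3) p).eventually (Metric.ball_mem_nhds _ hr)] with q hq hqb
  rw [h.torsionNormSq_eq p hq, h.torsionNormSq_eq p (mem_extChartAt_source p)]
  exact hconst _ hqb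

/-- The scalar torsion of a critical contact metric is constant. -/
theorem IsCriticalContactMetric.exists_scalarTorsion_eq [T2Space M] [CompactSpace M]
    [ConnectedSpace M] [MeasurableSpace M] [BorelSpace M] (h : IsCriticalContactMetric α g) :
    ∃ c : ℝ, ∀ p : M, scalarTorsion α g p = c := by
  have h1 := h.1.isLocallyConstant (h.1.diffNormSq_eq_zero fun x y hy => h.eulerLagrange x hy)
  obtain ⟨p₀⟩ : Nonempty M := inferInstance
  exact ⟨scalarTorsion α g p₀, fun p => by
    rw [scalarTorsion, scalarTorsion, h1.apply_eq_of_preconnectedSpace p p₀]⟩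

end Constancy

end

end ContactThree

theorem mainTheorem5 {M : Type*} [TopologicalSpace M] [T2Space M] [CompactSpace M]
    [ConnectedSpace M] [ChartedSpace E3 M] [IsManifold (𝓡 3) ∞ M]
    [MeasurableSpace M] [BorelSpace M]
    (α : ContactThree.ContactForm M) (g : ContactThree.Metric M)
    (hg : ContactThree.IsCriticalContactMetric α g) :
    ∃ c : ℝ, ∀ p : M, ContactThree.scalarTorsion α g p = c := by
  exact hg.exists_scalarTorsion_eq
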